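/- Let $((X_t,\varepsilon_t))_{t\in\mathbb Z}$ be a stationary and ergodic process on a probability space, with $X_t\in\mathbb R^d$ (with an arbitrary norm $|\cdot|$), $\mathbb E|X_0|<\infty$, $\varepsilon_t$ uniform on $[0,1]$, and $\varepsilon_t$ independent of $\sigma((X_{t-j},\varepsilon_{t-j}):j\ge 1)$ for every $t\in\mathbb Z$. For a process $Z$ write $Z_t^-=(Z_t,Z_{t-1},\dots)$. Let $\Lambda\subseteq\mathbb R$ be a parameter set and, for $\lambda\in\Lambda$, let $F_\lambda$ be the distribution function of a probability distribution on $\mathbb N$, with quantile function $F_\lambda^{-1}$; let $g:\mathbb N\to\mathbb R$ be injective. Let $\overline y\in\mathbb R$, $\overline y^-=(\overline y,\overline y,\dots)$; let $\mathcal C\subseteq\mathbb R^{\mathbb N}$ contain all sequences that are eventually equal to $\overline y$, let $\mathcal D\subseteq(\mathbb R^d)^{\mathbb N}$ be a measurable set that contains all sequences that eventually vanish, with $\mathbb P(X_0^-\in\mathcal D)=1$, and let $f:\mathcal C\times\mathcal D\to\Lambda$ be measurable. Assume: 1. For every $\lambda\in\Lambda$, $g\circ F_\lambda^{-1}(\varepsilon_1)$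 is integrable, $f(\overline y^-,X_0^-)$ is integrable, and for all $\lambda,\lambda'\in\Lambda$, $\mathbb E|g\circ F_\lambda^{-1}(\varepsilon_1)-g\circ F_{\lambda'}^{-1}(\varepsilon_1)|\le|\lambda-\lambda'|$. 2. There are summable sequences $(a_i)_{i\ge1}$, $(b_j)_{j\ge1}$ of non-negative reals with $a:=\sum_{i\ge1}a_i<1$ such that for all $y,y'\in\mathcal C$ and $x,x'\in\mathcal D$, $|f(y,x)-f(y',x')|\le\sum_{i\ge1}a_i|y_i-y_i'|+\sum_{j\ge1}b_j|x_j-x_j'|$ (the right-hand side may be $+\infty$). Consider the equation $$Y_t=g\circ F_{\lambda_t}^{-1}(\varepsilon_t),\qquad \lambda_t=f(Y_{t-1}^-,X_{t-1}^-),\qquad t\in\mathbb Z, \qquad (\ast)$$ where the right-hand side $g\circ F_{\lambda_t}^{-1}(\varepsilon_t)$ is understood as the limit in $L^1$, as $p\to\infty$, of $g\circ F^{-1}_{\lambda_{t,p}}(\varepsilon_t)$ with $\lambda_{t,p}=f((Y_{t-1},\dots,Y_{t-p},\overline y,\overline y,\dots),X_{t-1}^-)$. Then there is a process $(Y_t)_{t\in\mathbb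 Z}$ that is stationary, ergodic, integrable, non-anticipative ($Y_t$ is $\sigma((X_s,\varepsilon_s):s\le t)$-measurable) and solves $(\ast)$, and any two such processes coincide almost surely. For every $t$ such that $Y_{t-1}^-\in\mathcal C$ almost surely, $(\ast)$ holds at time $t$ literally, almost surely. Moreover, with $\zeta_t=(X_{t-1},\varepsilon_t)$, the process $V_t=(\zeta_t,Y_t)$ is stationary and ergodic. For a stationary process $Z$ let $\alpha_Z(n)=\sup|\mathbb P(A\cap B)-\mathbb P(A)\mathbb P(B)|$ over $A\in\sigma(Z_j:j\le0)$, $B\in\sigma(Z_j:j\ge n)$. Put $S_{p+1}=\sum_{i\ge p+1}a_i$, $T_s=\sum_{j\ge \max(s,1)}b_j$ and, for $r<t$, $$\omega_{n,t,r}=\inf_{p\ge1}\Big\{a^{\frac{t-r}{p}}+S_{p+1}+\sum_{j=0}^{t-r+1}a^{j/p}\,T_{t-r+1-j}\Big\}$$ (which does not depend on $n$; $0^0=1$). Then: (i) If $g(y)=y$, there is a constant $L>0$ such that for all integers $1<r<n$, $$\alpha_V(n)\le\alpha_\zeta(r+1)+L\sum_{t\ge n}\omega_{n,t,r}.$$ (ii)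 If $g(y)=\log(1+y)$, $F_\lambda$ is the distribution function of the Poisson distribution with parameter $e^\lambda$ for every $\lambda\in\Lambda$, and $\mathbb E\exp(K|X_0|)<\infty$ for all $K\ge1$, then for every $K\ge1$ there is a constant $L>0$ such that for all integers $1<r<n$, $$\alpha_V(n)\le\alpha_\zeta(r+1)+L\sum_{t\ge n}\omega_{n,t,r}^{K/(K+1)}.$$ (The series may be $+\infty$.) -/

import Mathlib

open MeasureTheory ProbabilityTheory Filter Topology

noncomputable section

namespace Ingarch

/-- The sigma-algebra generated by `Z j`, `j ≤ k`. -/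
def past {Ω S : Type*} [MeasurableSpace S] (Z : ℤ → Ω → S) (k : ℤ) : MeasurableSpace Ω :=
  ⨆ (j : ℤ) (_ : j ≤ k), MeasurableSpace.comap (Z j) inferInstance

/-- The sigma-algebra generated by `Z j`, `j ≥ k`. -/
def future {Ω S : Type*} [MeasurableSpace S] (Z : ℤ → Ω → S) (k : ℤ) : MeasurableSpace Ω :=
  ⨆ (j : ℤ) (_ : k ≤ j), MeasurableSpace.comap (Z j) inferInstance

/-- The strong mixing coefficient of two sub-sigma-algebras: the supremum of
`|P(A ∩ B) - P(A) P(B)|` over `A` in the first and `B` in the second. -/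
def alphaCoeff {Ω : Type*} [MeasurableSpace Ω] (P : Measure Ω) (F G : MeasurableSpace Ω) : ℝ :=
  sSup {x : ℝ | ∃ A B : Set Ω, MeasurableSet[F] A ∧ MeasurableSet[G] B ∧
    x = |P.real (A ∩ B) - P.real A * P.real B|}

/-- The strong mixing coefficient of order `n` of a process indexed by `ℤ`. -/
def alphaMix {Ω S : Type*} [MeasurableSpace Ω] [MeasurableSpace S] (P : Measure Ω)
    (Z : ℤ → Ω → S) (n : ℤ) : ℝ :=
  alphaCoeff P (past Z 0) (future Z n)

/-- The process `Z` is (strictly) stationary and ergodic: the shift on path space preserves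
the law of `Z` and is ergodic for it. (Used for processes with measurable coordinates.) -/
def IsStationaryErgodic {Ω S : Type*} [MeasurableSpace Ω] [MeasurableSpace S] (P : Measure Ω)
    (Z : ℤ → Ω → S) : Prop :=
  Ergodic (fun (z : ℤ → S) (t : ℤ) => z (t + 1)) (P.map (fun ω t => Z t ω))

/-- The process `(X t, ε t)`. -/
def joint {Ω H : Type*} (X : ℤ → Ω → H) (ε : ℤ → Ω → ℝ) (t : ℤ) (ω : Ω) : H × ℝ :=
  (X t ω, ε t ω)

/-- The process `ζ t = (X (t-1), ε t)`. -/
def zeta {Ω H : Type*} (X : ℤ → Ω → H) (ε : ℤ → Ω → ℝ) (t : ℤ) (ω : Ω) : H × ℝ :=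
  (X (t - 1) ω, ε t ω)

/-- The process `V t = (ζ t, Y t)`. -/
def fullProc {Ω H : Type*} (X : ℤ → Ω → H) (ε Y : ℤ → Ω → ℝ) (t : ℤ) (ω : Ω) : (H × ℝ) × ℝ :=
  (zeta X ε t ω, Y t ω)

/-- The sequence `(Z t, Z (t-1), Z (t-2), …)`. -/
def hist {Ω S : Type*} (Z : ℤ → Ω → S) (t : ℤ) (ω : Ω) : ℕ → S :=
  fun j => Z (t - j) ω

/-- The sequence whose first `p` terms are those of `y` and whose other terms are `c`. -/
def truncSeq (c : ℝ) (p : ℕ) (y : ℕ → ℝ) : ℕ → ℝ :=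
  fun i => if i < p then y i else c

/-- The quantile function `u ↦ inf {k : u ≤ F k}` of a probability distribution on `ℕ` with
distribution function `F`. -/
def quantile (ν : Measure ℕ) (u : ℝ) : ℕ :=
  sInf {k : ℕ | u ≤ ν.real (Set.Iic k)}

/-- `Y` is a stationary and ergodic, non-anticipative, integrable solution of
`Y t = g (quantile (ν (f (Y (t-1), Y (t-2), …) (X (t-1), X (t-2), …))) (ε t))`.
Since `f` need not be defined at the infinite past of `Y`, the right-hand side means the limit
in `L¹`, as `p → ∞`, of the same expression with the past of `Y` replaced by `c` beyond
lag `p`. -/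
structure IsSolution {Ω H : Type*} [MeasurableSpace Ω] [MeasurableSpace H] (P : Measure Ω)
    (X : ℤ → Ω → H) (ε : ℤ → Ω → ℝ) (ν : ℝ → Measure ℕ) (g : ℕ → ℝ)
    (f : (ℕ → ℝ) → (ℕ → H) → ℝ) (c : ℝ) (Y : ℤ → Ω → ℝ) : Prop where
  nonanticipative : ∀ t, Measurable[past (joint X ε) t] (Y t)
  integrable : ∀ t, Integrable (Y t) P
  stationary_ergodic : IsStationaryErgodic P Y
  equation : ∀ t, Tendsto
    (fun p : ℕ => ∫⁻ ω, ‖g (quantile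
      (ν (f (truncSeq c p (hist Y (t - 1) ω)) (hist X (t - 1) ω))) (ε t ω)) - Y t ω‖ₑ ∂P)
    atTop (𝓝 0)

/-- For coefficients written from lag one on (`c i` is the coefficient of lag `i + 1`), the sum
of the coefficients of all lags `≥ s`; for `s = 0` this is the same as for `s = 1`. -/
def lagTail (c : ℕ → ℝ) (s : ℕ) : ℝ := ∑' i : ℕ, c (s - 1 + i)

/-- `inf_{p ≥ 1} (a^((t-r)/p) + S_{p+1} + ∑_{j=0}^{t-r+1} a^(j/p) T_{t-r+1-j})`, where `a` is
the sum of the `a_i` and `S`, `T` are the tails of `(a_i)` and `(b_j)`; used for `r < t`. -/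
def omega (a b : ℕ → ℝ) (t r : ℕ) : ℝ :=
  ⨅ p : ℕ+, ((∑' i, a i) ^ (((t : ℝ) - r) / ((p : ℕ) : ℝ)) + lagTail a (p + 1)
    + ∑ j ∈ Finset.range (t - r + 2),
        (∑' i, a i) ^ ((j : ℝ) / ((p : ℕ) : ℝ)) * lagTail b (t - r + 1 - j))

end Ingarch

end

/-! The recursion is a contraction in `L¹`. Since `ε t` is uniform and independent of the past,
conditioning on the past turns the Lipschitz hypothesis on the quantile transforms into a one-step
bound (`Model.step`): run from two pasts with the same noise, the outputs differ in mean by at most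
`∑ a_i E|y_i - y'_i| + ∑ b_j E|x_j - x'_j|`.

The solution is the limit of backward iterates (`approx`), started `s` steps ago from the constant
`c` with all earlier covariates set to zero. Their pasts are eventually constant, so `f` is
evaluated only where it is defined. By stationarity the mean distance of consecutive iterates
depends on `s` alone and satisfies a renewal inequality of mass `a < 1`, hence is summable
(`tsum_ne_top_of_renewal`). The iterates therefore converge almost surely and in `L¹`. The limit is
one fixed measurable function of the history of `ζ`, which gives stationarity and ergodicity, also
jointly with `ζ`. Two solutions coincide because `sup_t E|Y_t - Y'_t|` is finite and at most `a`
times itself.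

For the mixing bound, the past of `V` is a function of the past of `ζ`. In the future of `V`, each
`Y_t` with `t ≥ n` is replaced by the iterate of order `t - r`, which reads only `ζ_{r+1}, …, ζ_t`.
This costs at most twice the sum of the probabilities that the two differ
(`Model.ofReal_alphaMix_le`). The mean error of the iterates obeys a recursion whose solution is
bounded by a multiple of `omega` (`le_of_recursion`): lags up to `p` gain a factor `a` every `p`
steps, longer lags cost `S_{p+1}`, and the missing covariates give the sum with `T`.

It remains to pass from mean errors to probabilities. If `g(y) = y`, distinct values are at least
one apart and Markov's inequality suffices. If `g(y) = log(1 + y)`, distinct values `y, y'` are at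
least `exp(-max y y')` apart, and Hölder's inequality with uniformly bounded exponential moments
(`Model.exists_exp_moment_iter_le`) yields the exponent `K/(K+1)`. -/

noncomputable section

namespace Ingarch
open scoped ENNReal

/-! ### Quantile functions -/

/-- The set defining the quantile is closed upwards, and nonempty because `u < 1`. At `u = 1` it may
be empty, and then `sInf ∅ = 0` would break the equivalence. -/
theorem quantile_le_iff (ν : Measure ℕ) [IsProbabilityMeasure ν] {u : ℝ} (hu : u < 1) (k : ℕ) :
    quantile ν u ≤ k ↔ u ≤ ν.real (Set.Iic k) := by
  have hmono : Monotone fun k : ℕ => ν.real (Set.Iic k) := fun i j hij =>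
    measureReal_mono (Set.Iic_subset_Iic.2 hij)
  have hne : {k : ℕ | u ≤ ν.real (Set.Iic k)}.Nonempty := by
    have h1 : Tendsto (fun k : ℕ => ν (Set.Iic k)) atTop (𝓝 (ν Set.univ)) :=
      tendsto_measure_Iic_atTop ν
    rw [measure_univ] at h1
    have h2 : Tendsto (fun k : ℕ => ν.real (Set.Iic k)) atTop (𝓝 1) := by
      exact (ENNReal.tendsto_toReal ENNReal.one_ne_top).comp h1
    obtain ⟨k, hk⟩ := ((tendsto_order.1 h2).1 u hu).exists
    exact ⟨k, hk.le⟩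
  constructor
  · intro h
    exact (Nat.sInf_mem hne : u ≤ _).trans (hmono h)
  · intro h
    exact Nat.sInf_le h

/-- Because `sInf ∅ = 0`, the infimum is at most `k` also at points where no index qualifies; this
accounts for the first set in the union. -/
theorem measurable_sInf_le {α : Type*} [MeasurableSpace α] {F : ℕ → α → ℝ} {v : α → ℝ}
    (hF : ∀ k, Measurable (F k)) (hv : Measurable v) :
    Measurable fun x => sInf {k : ℕ | v x ≤ F k x} := by
  refine measurable_of_Iic fun k => ?_
  have : (fun x => sInf {k : ℕ | v x ≤ F k x}) ⁻¹' Set.Iic k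
      = {x | ∀ j, ¬ v x ≤ F j x} ∪ ⋃ j ∈ Set.Iic k, {x | v x ≤ F j x} := by
    ext x
    simp only [Set.mem_preimage, Set.mem_Iic, Set.mem_union, Set.mem_ofPred_eq, Set.mem_iUnion]
    constructor
    · intro h
      by_cases hne : {k : ℕ | v x ≤ F k x}.Nonempty
      · exact Or.inr ⟨_, h, Nat.sInf_mem hne⟩
      · left
        intro j hj
        exact hne ⟨j, hj⟩
    · rintro (h | ⟨j, hj, h⟩)
      · have : {k : ℕ | v x ≤ F k x} = ∅ := by
          ext j; simpa using h j
        simp [this]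
      · exact (Nat.sInf_le h).trans hj
  rw [this]
  refine MeasurableSet.union ?_ ?_
  · simp only [Set.ofPred_forall]
    exact MeasurableSet.iInter fun j => (measurableSet_le hv (hF j)).compl
  · exact MeasurableSet.biUnion (Set.to_countable _) fun j _ => measurableSet_le hv (hF j)

theorem measurable_quantile (ν : Measure ℕ) : Measurable (quantile ν) :=
  measurable_sInf_le (F := fun k _ => ν.real (Set.Iic k)) (fun _ => measurable_const) measurable_id

/-- The uniform distribution on the unit interval. -/
abbrev unif : Measure ℝ := volume.restrict (Set.Icc (0 : ℝ) 1)

instance : IsProbabilityMeasure unif := ⟨by simp [unif]⟩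

/-- Inverse transform sampling; the exceptional point `u = 1` is a null set. -/
theorem map_quantile (ν : Measure ℕ) [IsProbabilityMeasure ν] : unif.map (quantile ν) = ν := by
  have : IsProbabilityMeasure (unif.map (quantile ν)) :=
    Measure.isProbabilityMeasure_map (measurable_quantile ν).aemeasurable
  refine Measure.ext_of_Iic _ _ fun k => ?_
  rw [Measure.map_apply (measurable_quantile ν) measurableSet_Iic]
  have hF0 : 0 ≤ ν.real (Set.Iic k) := measureReal_nonneg
  have hF1 : ν.real (Set.Iic k) ≤ 1 := measureReal_le_one
  have hae : (quantile ν ⁻¹' Set.Iic k : Set ℝ) =ᵐ[unif] Set.Iic (ν.real (Set.Iic k)) := by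
    have h1 : ∀ᵐ u ∂unif, u < 1 := by
      have h2 : ∀ᵐ u : ℝ ∂volume, u ≠ 1 := by
        simp [ae_iff]
      filter_upwards [ae_restrict_mem measurableSet_Icc, ae_restrict_of_ae h2] with u h3 h4
      exact lt_of_le_of_ne h3.2 h4
    filter_upwards [h1] with u hu
    exact propext (quantile_le_iff ν hu k)
  rw [measure_congr hae, Measure.restrict_apply measurableSet_Iic]
  have : Set.Iic (ν.real (Set.Iic k)) ∩ Set.Icc 0 1 = Set.Icc 0 (ν.real (Set.Iic k)) := by
    ext x
    simp only [Set.mem_inter_iff, Set.mem_Iic, Set.mem_Icc]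
    constructor
    · rintro ⟨h1, h2, h3⟩; exact ⟨h2, h1⟩
    · rintro ⟨h1, h2⟩; exact ⟨h2, h1, h2.trans hF1⟩
  rw [this, Real.volume_Icc, sub_zero, ofReal_measureReal]

/-- The family `(ν l)`, transformed by `g` and realised by quantile functions, is
`1`-Lipschitz in the Wasserstein-type distance. -/
def QuantileLipschitz (Λ : Set ℝ) (ν : ℝ → Measure ℕ) (g : ℕ → ℝ) : Prop :=
  ∀ l ∈ Λ, ∀ l' ∈ Λ,
    ∫⁻ u, ‖g (quantile (ν l) u) - g (quantile (ν l') u)‖ₑ ∂unif ≤ ‖l - l'‖ₑ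

/-- Measurability in the parameter comes from the Lipschitz condition. The functions `φ m`,
integrals of the positive part of `1 - m |g(Q_l(u)) - g(k)|`, are `m`-Lipschitz in `l`. As `m → ∞`
they converge to the mass at `k`, since injectivity of `g` makes the integrand tend to the indicator
of `Q_l(u) = k`. -/
theorem measurable_measure_singleton {Λ : Set ℝ} {ν : ℝ → Measure ℕ}
    (hν : ∀ l ∈ Λ, IsProbabilityMeasure (ν l)) {g : ℕ → ℝ} (hg : Function.Injective g)
    (hlip : QuantileLipschitz Λ ν g) (k : ℕ) :
    Measurable fun l : Λ => ν l {k} := by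
  have hgQ : ∀ l : ℝ, Measurable fun u => g (quantile (ν l) u) := fun l =>
    measurable_from_nat.comp (measurable_quantile _)
  let φ : ℕ → Λ → ℝ≥0∞ := fun m l => ∫⁻ u, (1 - m * ‖g (quantile (ν l) u) - g k‖ₑ) ∂unif
  have hmeas : ∀ (m : ℕ) (l : ℝ),
      Measurable fun u => (1 - m * ‖g (quantile (ν l) u) - g k‖ₑ : ℝ≥0∞) := fun m l =>
    measurable_const.sub (((hgQ l).sub_const _).enorm.const_mul _)
  have hφ : ∀ m, Continuous (φ m) := by
    intro m
    refine continuous_of_le_add_edist m (by simp) fun l l' => ?_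
    calc φ m l ≤ ∫⁻ u, ((1 - m * ‖g (quantile (ν l') u) - g k‖ₑ)
          + m * ‖g (quantile (ν l) u) - g (quantile (ν l') u)‖ₑ) ∂unif := by
          refine lintegral_mono fun u => ?_
          rw [tsub_le_iff_right, add_assoc, ← mul_add]
          have h1 : ‖g (quantile (ν l') u) - g k‖ₑ
              ≤ ‖g (quantile (ν l) u) - g (quantile (ν l') u)‖ₑ
                + ‖g (quantile (ν l) u) - g k‖ₑ := by
            rw [← enorm_neg (g (quantile (ν l) u) - g (quantile (ν l') u))]
            refine le_trans (le_of_eq ?_) (enorm_add_le _ _)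
            congr 1; ring
          calc (1 : ℝ≥0∞) ≤ 1 - m * ‖g (quantile (ν l') u) - g k‖ₑ
                + m * ‖g (quantile (ν l') u) - g k‖ₑ := le_tsub_add
            _ ≤ _ := by gcongr
      _ = φ m l' + m * ∫⁻ u, ‖g (quantile (ν l) u) - g (quantile (ν l') u)‖ₑ ∂unif := by
          rw [lintegral_add_left (hmeas m l'), lintegral_const_mul]
          exact ((hgQ l).sub (hgQ l')).enorm
      _ ≤ φ m l' + m * edist l l' := by
          gcongr
          refine (hlip l l.2 l' l'.2).trans (le_of_eq ?_)
          rw [Subtype.edist_eq, edist_eq_enorm_sub]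
  refine ENNReal.measurable_of_tendsto (fun m => (hφ m).measurable) ?_
  rw [tendsto_pi_nhds]
  intro l
  have := hν l l.2
  have h1 : ν l {k} = ∫⁻ u, (if quantile (ν l) u = k then 1 else 0) ∂unif := by
    conv_lhs => rw [← map_quantile (ν l)]
    rw [Measure.map_apply (measurable_quantile _) (measurableSet_singleton k)]
    have : (fun u => if quantile (ν l) u = k then (1 : ℝ≥0∞) else 0)
        = (quantile (ν l) ⁻¹' {k}).indicator 1 := by
      ext u; simp [Set.indicator]
    rw [this, lintegral_indicator_one (measurable_quantile _ (measurableSet_singleton k))]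
  rw [h1]
  refine tendsto_lintegral_of_dominated_convergence (fun _ => 1) (fun m => hmeas m l)
    (fun m => ae_of_all _ fun u => tsub_le_self) (by simp) (ae_of_all _ fun u => ?_)
  split_ifs with h
  · simp [h]
  · have hx : ‖g (quantile (ν l) u) - g k‖ₑ ≠ 0 := by
      rw [enorm_ne_zero, sub_ne_zero]
      exact fun h' => h (hg h')
    have h2 : Tendsto (fun m : ℕ => (m : ℝ≥0∞) * ‖g (quantile (ν l) u) - g k‖ₑ) atTop (𝓝 ⊤) := by
      have := ENNReal.Tendsto.mul_const (b := ‖g (quantile (ν l) u) - g k‖ₑ)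
        ENNReal.tendsto_nat_nhds_top (Or.inl ENNReal.top_ne_zero)
      rwa [ENNReal.top_mul hx] at this
    refine tendsto_const_nhds.congr' ?_
    filter_upwards [(tendsto_order.1 h2).1 1 ENNReal.one_lt_top] with m hm
    exact (tsub_eq_zero_of_le hm.le).symm

theorem measurable_real_Iic {Λ : Set ℝ} {ν : ℝ → Measure ℕ}
    (hν : ∀ l ∈ Λ, IsProbabilityMeasure (ν l)) {g : ℕ → ℝ} (hg : Function.Injective g)
    (hlip : QuantileLipschitz Λ ν g) (k : ℕ) :
    Measurable fun l : Λ => (ν l).real (Set.Iic k) := by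
  refine Measurable.ennreal_toReal ?_
  have : (fun l : Λ => ν l (Set.Iic k)) = fun l : Λ => ∑ i ∈ Finset.Iic k, ν l {i} := by
    ext l
    rw [sum_measure_singleton, Finset.coe_Iic]
  rw [this]
  exact Finset.measurable_sum _ fun i _ => measurable_measure_singleton hν hg hlip i

/-- `Λ` need not be a measurable set, so the distribution functions, measurable on the subtype, are
first extended to measurable functions on `ℝ`. -/
theorem exists_measurable_eq_quantile {Λ : Set ℝ} {ν : ℝ → Measure ℕ}
    (hν : ∀ l ∈ Λ, IsProbabilityMeasure (ν l)) {g : ℕ → ℝ} (hg : Function.Injective g)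
    (hlip : QuantileLipschitz Λ ν g) :
    ∃ G : ℝ × ℝ → ℝ, Measurable G ∧ ∀ l ∈ Λ, ∀ u, G (l, u) = g (quantile (ν l) u) := by
  have h : ∀ k, ∃ F : ℝ → ℝ, Measurable F ∧ ∀ l : Λ, (ν l).real (Set.Iic k) = F l := fun k => by
    obtain ⟨F, hF, h⟩ := Measurable.exists_eq_measurable_comp (f := ((↑) : Λ → ℝ))
      (g := fun l : Λ => (ν l).real (Set.Iic k)) (measurable_real_Iic hν hg hlip k)
    exact ⟨F, hF, fun l => congrFun h l⟩
  choose F hF h using h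
  refine ⟨fun q => g (sInf {k : ℕ | q.2 ≤ F k q.1}), ?_, fun l hl u => ?_⟩
  · exact measurable_from_nat.comp
      (measurable_sInf_le (fun k => (hF k).comp measurable_fst) measurable_snd)
  · simp only [quantile, fun k => h k ⟨l, hl⟩]

/-- Averaging over a uniform noise that is independent of the parameters contracts distances. -/
theorem lintegral_sub_quantile_le {Ω : Type*} {m mΩ : MeasurableSpace Ω} {P : Measure Ω}
    [IsProbabilityMeasure P] {Λ : Set ℝ} {ν : ℝ → Measure ℕ} {g : ℕ → ℝ} {G : ℝ × ℝ → ℝ}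
    (hG : Measurable G) (hGg : ∀ l ∈ Λ, ∀ u, G (l, u) = g (quantile (ν l) u))
    (hlip : QuantileLipschitz Λ ν g) {e : Ω → ℝ} (he : Measurable e) (hu : P.map e = unif)
    (hm : m ≤ mΩ)
    (hind : Indep (MeasurableSpace.comap e inferInstance) m P) {l l' : Ω → ℝ}
    (hl : Measurable[m] l) (hl' : Measurable[m] l') (hΛ : ∀ᵐ ω ∂P, l ω ∈ Λ)
    (hΛ' : ∀ᵐ ω ∂P, l' ω ∈ Λ) :
    ∫⁻ ω, ‖G (l ω, e ω) - G (l' ω, e ω)‖ₑ ∂P ≤ ∫⁻ ω, ‖l ω - l' ω‖ₑ ∂P := by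
  let L : Ω → ℝ × ℝ := fun ω => (l ω, l' ω)
  have hLm : Measurable[m] L := hl.prodMk hl'
  have hL : Measurable L := hLm.mono hm le_rfl
  have hi : IndepFun L e P := by
    rw [IndepFun_iff_Indep]
    exact indep_of_indep_of_le_left hind.symm hLm.comap_le
  -- By independence the joint law is a product, so the noise can be integrated out with both
  -- parameters frozen.
  have hprod : P.map (fun ω => (L ω, e ω)) = (P.map L).prod (P.map e) :=
    (indepFun_iff_map_prod_eq_prod_map_map hL.aemeasurable he.aemeasurable).1 hi
  let Ψ : (ℝ × ℝ) × ℝ → ℝ≥0∞ := fun q => ‖G (q.1.1, q.2) - G (q.1.2, q.2)‖ₑ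
  have hΨ : Measurable Ψ :=
    ((hG.comp ((measurable_fst.comp measurable_fst).prodMk measurable_snd)).sub
      (hG.comp ((measurable_snd.comp measurable_fst).prodMk measurable_snd))).enorm
  have : IsProbabilityMeasure (P.map L) := Measure.isProbabilityMeasure_map hL.aemeasurable
  calc ∫⁻ ω, ‖G (l ω, e ω) - G (l' ω, e ω)‖ₑ ∂P
      = ∫⁻ q, Ψ q ∂(P.map (fun ω => (L ω, e ω))) := (lintegral_map hΨ (hL.prodMk he)).symm
    _ = ∫⁻ q, ∫⁻ u, Ψ (q, u) ∂unif ∂(P.map L) := by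
        rw [hprod, hu, lintegral_prod _ hΨ.aemeasurable]
    _ = ∫⁻ ω, ∫⁻ u, Ψ (L ω, u) ∂unif ∂P :=
        lintegral_map hΨ.lintegral_prod_right' hL
    _ ≤ ∫⁻ ω, ‖l ω - l' ω‖ₑ ∂P := by
        refine lintegral_mono_ae ?_
        filter_upwards [hΛ, hΛ'] with ω h1 h2
        refine le_trans (le_of_eq ?_) (hlip _ h1 _ h2)
        simp only [Ψ, L, hGg _ h1, hGg _ h2]

/-- The expectation of a function of the quantile transform, conditionally on the parameter. -/
theorem lintegral_comp_quantile {Ω : Type*} {m mΩ : MeasurableSpace Ω} {P : Measure Ω}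
    [IsProbabilityMeasure P] {Λ : Set ℝ} {ν : ℝ → Measure ℕ}
    (hν : ∀ l ∈ Λ, IsProbabilityMeasure (ν l)) {g : ℕ → ℝ} {G : ℝ × ℝ → ℝ}
    (hG : Measurable G) (hGg : ∀ l ∈ Λ, ∀ u, G (l, u) = g (quantile (ν l) u))
    {e : Ω → ℝ} (he : Measurable e) (hu : P.map e = unif)
    (hm : m ≤ mΩ)
    (hind : Indep (MeasurableSpace.comap e inferInstance) m P) {l : Ω → ℝ}
    (hl : Measurable[m] l) (hΛ : ∀ᵐ ω ∂P, l ω ∈ Λ) {φ : ℝ → ℝ≥0∞} (hφ : Measurable φ) :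
    ∫⁻ ω, φ (G (l ω, e ω)) ∂P = ∫⁻ ω, ∫⁻ k, φ (g k) ∂(ν (l ω)) ∂P := by
  have hL : Measurable l := hl.mono hm le_rfl
  have hi : IndepFun l e P := by
    rw [IndepFun_iff_Indep]
    exact indep_of_indep_of_le_left hind.symm hl.comap_le
  have hprod : P.map (fun ω => (l ω, e ω)) = (P.map l).prod (P.map e) :=
    (indepFun_iff_map_prod_eq_prod_map_map hL.aemeasurable he.aemeasurable).1 hi
  have : IsProbabilityMeasure (P.map l) := Measure.isProbabilityMeasure_map hL.aemeasurable
  have hΨ : Measurable fun q => φ (G q) := hφ.comp hG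
  calc ∫⁻ ω, φ (G (l ω, e ω)) ∂P
      = ∫⁻ q, φ (G q) ∂(P.map (fun ω => (l ω, e ω))) := (lintegral_map hΨ (hL.prodMk he)).symm
    _ = ∫⁻ q, ∫⁻ u, φ (G (q, u)) ∂unif ∂(P.map l) := by
        rw [hprod, hu, lintegral_prod _ hΨ.aemeasurable]
    _ = ∫⁻ ω, ∫⁻ u, φ (G (l ω, u)) ∂unif ∂P :=
        lintegral_map hΨ.lintegral_prod_right' hL
    _ = _ := by
        refine lintegral_congr_ae ?_
        filter_upwards [hΛ] with ω h1
        have := hν _ h1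
        simp only [hGg _ h1]
        conv_rhs => rw [← map_quantile (ν (l ω))]
        rw [lintegral_map (f := fun k => φ (g k)) measurable_from_nat (measurable_quantile _)]

/-! ### Stationary and ergodic processes -/

theorem past_le {Ω S : Type*} [mΩ : MeasurableSpace Ω] [MeasurableSpace S] {Z : ℤ → Ω → S}
    (hZ : ∀ t, Measurable (Z t)) (k : ℤ) : past Z k ≤ mΩ :=
  iSup₂_le fun j _ => (hZ j).comap_le

theorem future_le {Ω S : Type*} [mΩ : MeasurableSpace Ω] [MeasurableSpace S] {Z : ℤ → Ω → S}
    (hZ : ∀ t, Measurable (Z t)) (k : ℤ) : future Z k ≤ mΩ :=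
  iSup₂_le fun j _ => (hZ j).comap_le

theorem past_mono {Ω S : Type*} [MeasurableSpace S] (Z : ℤ → Ω → S) {k l : ℤ} (h : k ≤ l) :
    past Z k ≤ past Z l :=
  iSup₂_le fun j hj => le_iSup₂_of_le j (hj.trans h) le_rfl

theorem measurable_past {Ω S : Type*} [MeasurableSpace S] (Z : ℤ → Ω → S) {j k : ℤ} (h : j ≤ k) :
    Measurable[past Z k] (Z j) :=
  Measurable.of_comap_le (le_iSup₂_of_le j h le_rfl)

theorem measurable_future {Ω S : Type*} [MeasurableSpace S] (Z : ℤ → Ω → S) {j k : ℤ}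
    (h : k ≤ j) : Measurable[future Z k] (Z j) :=
  Measurable.of_comap_le (le_iSup₂_of_le j h le_rfl)

theorem measurable_hist_past {Ω S : Type*} [MeasurableSpace S] (Z : ℤ → Ω → S) (t : ℤ) :
    Measurable[past Z t] (hist Z t) :=
  @measurable_pi_lambda _ _ _ (past Z t) _ _ fun j => measurable_past Z (by omega)

theorem IsStationaryErgodic.map_shift {Ω S : Type*} [MeasurableSpace Ω] [MeasurableSpace S]
    {P : Measure Ω} {Z : ℤ → Ω → S} (hZ : ∀ t, Measurable (Z t)) (h : IsStationaryErgodic P Z)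
    (t : ℤ) : P.map (fun ω j => Z (j + t) ω) = P.map (fun ω j => Z j ω) := by
  have hS : ∀ t : ℤ, Measurable fun (z : ℤ → S) (j : ℤ) => z (j + t) := fun t =>
    measurable_pi_lambda _ fun j => measurable_pi_apply _
  have hp : ∀ t : ℤ, Measurable fun ω (j : ℤ) => Z (j + t) ω := fun t =>
    measurable_pi_lambda _ fun j => hZ _
  have hp0 : Measurable fun ω (j : ℤ) => Z j ω := measurable_pi_lambda _ fun j => hZ _
  have h1 : (P.map (fun ω j => Z j ω)).map (fun (z : ℤ → S) (j : ℤ) => z (j + 1))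
      = P.map (fun ω j => Z j ω) := h.toMeasurePreserving.map_eq
  -- Invariance under the inverse shift follows by applying it to the invariance `h1`.
  have h2 : (P.map (fun ω j => Z j ω)).map (fun (z : ℤ → S) (j : ℤ) => z (j + -1))
      = P.map (fun ω j => Z j ω) := by
    conv_lhs => rw [← h1]
    rw [Measure.map_map (hS _) (hS _)]
    have : (fun (z : ℤ → S) (j : ℤ) => z (j + -1)) ∘ (fun (z : ℤ → S) (j : ℤ) => z (j + 1))
        = id := by
      ext z j; simp
    rw [this, Measure.map_id]
  induction t using Int.induction_on with
  | zero => simp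
  | succ n ih =>
    have : (fun ω (j : ℤ) => Z (j + (n + 1)) ω)
        = (fun (z : ℤ → S) (j : ℤ) => z (j + 1)) ∘ fun ω (j : ℤ) => Z (j + n) ω := by
      ext ω j; simp only [Function.comp]; congr 1; ring
    rw [this, ← Measure.map_map (hS _) (hp _), ih, h1]
  | pred n ih =>
    have : (fun ω (j : ℤ) => Z (j + (-n - 1)) ω)
        = (fun (z : ℤ → S) (j : ℤ) => z (j + -1)) ∘ fun ω (j : ℤ) => Z (j + -n) ω := by
      ext ω j; simp only [Function.comp]; congr 1; ring
    rw [this, ← Measure.map_map (hS _) (hp _), ih, h2]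

/-- A process obtained from a stationary and ergodic process by a measurable, time-invariant
transformation of its paths is stationary and ergodic. -/
theorem IsStationaryErgodic.factor {Ω S S' : Type*} [MeasurableSpace Ω] [MeasurableSpace S]
    [MeasurableSpace S'] {P : Measure Ω} {Z : ℤ → Ω → S} (hZ : ∀ t, Measurable (Z t))
    (h : IsStationaryErgodic P Z) {φ : (ℤ → S) → S'} (hφ : Measurable φ) :
    IsStationaryErgodic P fun t ω => φ fun j => Z (j + t) ω := by
  let Φ : (ℤ → S) → ℤ → S' := fun z t => φ fun j => z (j + t)
  have hΦ : Measurable Φ := measurable_pi_lambda _ fun t =>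
    hφ.comp (measurable_pi_lambda _ fun j => measurable_pi_apply _)
  have hp0 : Measurable fun ω (j : ℤ) => Z j ω := measurable_pi_lambda _ fun j => hZ _
  have hmap : P.map (fun ω (t : ℤ) => φ fun j => Z (j + t) ω)
      = (P.map fun ω j => Z j ω).map Φ := by
    rw [Measure.map_map hΦ hp0]; rfl
  unfold IsStationaryErgodic
  rw [hmap]
  -- The path map `Φ` commutes with the shifts, and ergodicity passes to factors.
  refine MeasurePreserving.ergodic_of_ergodic_semiconj (f := fun (z : ℤ → S) (t : ℤ) => z (t + 1))
    (g := Φ) ⟨hΦ, rfl⟩ h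
    (measurable_pi_lambda _ fun j => measurable_pi_apply _) fun z => ?_
  ext t
  simp only [Φ]
  congr 1
  ext j
  congr 1
  ring

/-- The history at `t` is a fixed function of the path shifted by `t`. This makes the mean distances
between iterates functions of the order alone. -/
theorem IsStationaryErgodic.lintegral_hist {Ω S : Type*} [MeasurableSpace Ω] [MeasurableSpace S]
    {P : Measure Ω} {Z : ℤ → Ω → S} (hZ : ∀ t, Measurable (Z t)) (h : IsStationaryErgodic P Z)
    {φ : (ℕ → S) → ℝ≥0∞} (hφ : Measurable φ) (t t' : ℤ) :
    ∫⁻ ω, φ (hist Z t ω) ∂P = ∫⁻ ω, φ (hist Z t' ω) ∂P := by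
  suffices H : ∀ t, ∫⁻ ω, φ (hist Z t ω) ∂P = ∫⁻ z, φ (fun j => z (-j)) ∂(P.map fun ω j => Z j ω) by
    rw [H t, H t']
  intro t
  rw [← h.map_shift hZ t, lintegral_map]
  · simp only [neg_add_eq_sub]
    rfl
  · exact hφ.comp (measurable_pi_lambda _ fun j => measurable_pi_apply _)
  · exact measurable_pi_lambda _ fun j => hZ _

/-! ### Auxiliary facts on series -/

theorem tsum_ite_lt_eq_tsum_add (h : ℕ → ℝ≥0∞) (p : ℕ) :
    ∑' i, (if i < p then 0 else h i) = ∑' k, h (k + p) := by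
  rw [← ENNReal.summable.sum_add_tsum_nat_add' (f := fun i => if i < p then 0 else h i) (k := p)]
  rw [Finset.sum_eq_zero fun i hi => if_pos (Finset.mem_range.1 hi), zero_add]
  exact tsum_congr fun k => if_neg (by omega)

/-- A non-negative solution of a defective renewal inequality is summable. -/
theorem tsum_ne_top_of_renewal {A δ r : ℕ → ℝ≥0∞} (hA : ∑' i, A i < 1) (h0 : δ 0 ≠ ⊤)
    (hr : ∑' s, r s ≠ ⊤)
    (h : ∀ s, δ (s + 1) ≤ ∑ i ∈ Finset.range (s + 1), A i * δ (s - i) + r s) :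
    ∑' s, δ s ≠ ⊤ := by
  set α := ∑' i, A i with hα
  -- `K` is the fixed point of `x = δ 0 + ∑ r + α x`, so the bound by `K` on the partial sums
  -- reproduces itself.
  set K := (δ 0 + ∑' s, r s) / (1 - α) with hK
  have h1α : 1 - α ≠ 0 := (tsub_pos_of_lt hA).ne'
  have hKt : K ≠ ⊤ := ENNReal.div_ne_top (ENNReal.add_ne_top.2 ⟨h0, hr⟩) h1α
  have hKeq : δ 0 + ∑' s, r s + α * K = K := by
    have h2 : K * (1 - α) = δ 0 + ∑' s, r s :=
      ENNReal.div_mul_cancel h1α (ENNReal.sub_ne_top ENNReal.one_ne_top)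
    rw [← h2, mul_comm α K, ← mul_add, tsub_add_cancel_of_le hA.le, mul_one]
  have hN : ∀ N, ∑ s ∈ Finset.range N, δ s ≤ K := by
    intro N
    induction N with
    | zero => simp
    | succ N ih =>
      rw [Finset.sum_range_succ', add_comm]
      calc δ 0 + ∑ s ∈ Finset.range N, δ (s + 1)
          ≤ δ 0 + ∑ s ∈ Finset.range N,
              (∑ i ∈ Finset.range (s + 1), A i * δ (s - i) + r s) := by
            gcongr with s; exact h s
        _ = δ 0 + ((∑ i ∈ Finset.range N, ∑ s ∈ Finset.Ico i N, A i * δ (s - i))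
              + ∑ s ∈ Finset.range N, r s) := by
            rw [Finset.sum_add_distrib]
            congr 2
            -- With the order of summation exchanged, each `A i` multiplies a partial sum of `δ`, to
            -- which the induction hypothesis applies.
            refine Finset.sum_comm' fun s i => ?_
            simp only [Finset.mem_range, Finset.mem_Ico]
            omega
        _ ≤ δ 0 + ((∑ i ∈ Finset.range N, A i * K) + ∑' s, r s) := by
            gcongr with i hi
            · rw [← Finset.mul_sum, Finset.sum_Ico_eq_sum_range]
              gcongr
              simp only [add_tsub_cancel_left]
              exact (Finset.sum_le_sum_of_subset
                (Finset.range_subset_range.2 (Nat.sub_le N i))).trans ih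
            · exact ENNReal.sum_le_tsum _
        _ ≤ δ 0 + (α * K + ∑' s, r s) := by
            rw [← Finset.sum_mul]
            gcongr
            exact ENNReal.sum_le_tsum _
        _ = K := by rw [add_comm (α * K), ← add_assoc, hKeq]
  rw [ENNReal.tsum_eq_iSup_nat]
  exact ne_top_of_le_ne_top hKt (iSup_le hN)

/-- Dominated convergence for the counting measure, with dominating sequence `A i * K`. Here `A`
stands for the coefficients `a_i` and `u` for the errors of the iterates. -/
theorem tendsto_tsum_mul_sub {A u : ℕ → ℝ≥0∞} {K : ℝ≥0∞} (hA : ∑' i, A i ≠ ⊤) (hK : K ≠ ⊤)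
    (hu : ∀ s, u s ≤ K) (hu0 : Tendsto u atTop (𝓝 0)) :
    Tendsto (fun p => ∑' i, A i * if i < p then u (p - i) else 0) atTop (𝓝 0) := by
  have h1 : ∀ p, ∑' i, (A i * if i < p then u (p - i) else 0)
      = ∫⁻ i, (A i * if i < p then u (p - i) else 0) ∂Measure.count := fun p =>
    (lintegral_count _).symm
  simp only [h1]
  suffices h : Tendsto (fun p => ∫⁻ i, (A i * if i < p then u (p - i) else 0) ∂Measure.count)
      atTop (𝓝 (∫⁻ _ : ℕ, 0 ∂Measure.count)) by simpa only [lintegral_zero] using h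
  refine tendsto_lintegral_of_dominated_convergence (fun i => A i * K)
    (fun p => measurable_from_nat) (fun p => ae_of_all _ fun i => ?_) ?_
    (ae_of_all _ fun i => ?_)
  · dsimp only
    split_ifs
    · exact mul_le_mul_right (hu _) _
    · simp
  · rw [lintegral_count, ENNReal.tsum_mul_right]
    exact ENNReal.mul_ne_top hA hK
  · have h3 : Tendsto (fun p => A i * u (p - i)) atTop (𝓝 (A i * 0)) :=
      ENNReal.Tendsto.const_mul (hu0.comp (tendsto_sub_atTop_nat i))
        (Or.inr (ne_top_of_le_ne_top hA (ENNReal.le_tsum i)))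
    rw [mul_zero] at h3
    refine h3.congr' ?_
    filter_upwards [eventually_gt_atTop i] with p hp
    rw [if_pos hp]

/-! ### The model -/

/-- The sequence whose first `p` terms are those of `x` and whose other terms vanish. -/
def zeroTrunc {H : Type*} [Zero H] (p : ℕ) (x : ℕ → H) : ℕ → H :=
  fun j => if j < p then x j else 0

/-- The iterates of the recursion, started `s` steps in the past from the value `c` and with
the covariates before that time replaced by zero, as functions of the history of
`(X (t-1), ε t)`. -/
def approx {H : Type*} [Zero H] (ν : ℝ → Measure ℕ) (g : ℕ → ℝ) (f : (ℕ → ℝ) → (ℕ → H) → ℝ)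
    (c : ℝ) : ℕ → (ℕ → H × ℝ) → ℝ
  | 0, _ => c
  | s + 1, w => g (quantile (ν (f (fun j => approx ν g f c (s - j) fun i => w (i + j + 1))
      (zeroTrunc (s + 1) fun j => (w j).1))) (w 0).2)
  termination_by s => s

/-- The limit of the iterates of the recursion. -/
def limitFun {H : Type*} [Zero H] (ν : ℝ → Measure ℕ) (g : ℕ → ℝ) (f : (ℕ → ℝ) → (ℕ → H) → ℝ)
    (c : ℝ) (w : ℕ → H × ℝ) : ℝ :=
  limUnder atTop fun s => approx ν g f c s w

/-- The hypotheses on the model, with integrals in `[0, ∞]` and a measurable extension `G` of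
`(l, u) ↦ g (quantile (ν l) u)`. -/
structure Model {Ω H : Type*} [MeasurableSpace Ω] [NormedAddCommGroup H] [MeasurableSpace H]
    (P : Measure Ω) (X : ℤ → Ω → H) (ε : ℤ → Ω → ℝ) (Λ : Set ℝ) (ν : ℝ → Measure ℕ)
    (g : ℕ → ℝ) (G : ℝ × ℝ → ℝ) (f : (ℕ → ℝ) → (ℕ → H) → ℝ) (c : ℝ) (C : Set (ℕ → ℝ))
    (D : Set (ℕ → H)) (a b : ℕ → ℝ) : Prop where
  measurable_X : ∀ t, Measurable (X t)
  measurable_ε : ∀ t, Measurable (ε t)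
  map_ε : ∀ t, P.map (ε t) = unif
  stationary : IsStationaryErgodic P (joint X ε)
  indep : ∀ t, Indep (MeasurableSpace.comap (ε t) inferInstance) (past (joint X ε) (t - 1)) P
  integrable_X : ∫⁻ ω, ‖X 0 ω‖ₑ ∂P ≠ ⊤
  prob : ∀ l ∈ Λ, IsProbabilityMeasure (ν l)
  measurable_G : Measurable G
  G_eq : ∀ l ∈ Λ, ∀ u, G (l, u) = g (quantile (ν l) u)
  lip : QuantileLipschitz Λ ν g
  mem_C : ∀ y : ℕ → ℝ, (∃ k, ∀ i, k ≤ i → y i = c) → y ∈ C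
  mem_D : ∀ x : ℕ → H, (∃ k, ∀ i, k ≤ i → x i = 0) → x ∈ D
  measurableSet_D : MeasurableSet D
  hist_mem_D : ∀ᵐ ω ∂P, hist X 0 ω ∈ D
  f_mem : ∀ y ∈ C, ∀ x ∈ D, f y x ∈ Λ
  measurable_f : Measurable fun q : C × D => f q.1 q.2
  integrable_g : ∀ l ∈ Λ, ∫⁻ u, ‖g (quantile (ν l) u)‖ₑ ∂unif ≠ ⊤
  a_nonneg : ∀ i, 0 ≤ a i
  b_nonneg : ∀ j, 0 ≤ b j
  summable_a : Summable a
  summable_b : Summable b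
  tsum_a : ∑' i, a i < 1
  f_lip : ∀ y ∈ C, ∀ y' ∈ C, ∀ x ∈ D, ∀ x' ∈ D, ‖f y x - f y' x'‖ₑ
    ≤ ∑' i, ENNReal.ofReal (a i) * ‖y i - y' i‖ₑ + ∑' j, ENNReal.ofReal (b j) * ‖x j - x' j‖ₑ

/-- Finite memory: along the process, an iterate of order `s` at time `t` reads only `ζ_t, …,
ζ_{t-s+1}`. The zero truncation of the covariates in `approx` serves this purpose, and the coupling
in the mixing bound relies on it. -/
theorem approx_congr {H : Type*} [Zero H] (ν : ℝ → Measure ℕ) (g : ℕ → ℝ)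
    (f : (ℕ → ℝ) → (ℕ → H) → ℝ) (c : ℝ) (s : ℕ) {w w' : ℕ → H × ℝ}
    (h : ∀ j < s, w j = w' j) : approx ν g f c s w = approx ν g f c s w' := by
  induction s using Nat.strong_induction_on generalizing w w' with
  | _ s ih =>
    cases s with
    | zero => rw [approx, approx]
    | succ s =>
      rw [approx, approx, h 0 (by omega)]
      have h1 : (fun j => approx ν g f c (s - j) fun i => w (i + j + 1))
          = fun j => approx ν g f c (s - j) fun i => w' (i + j + 1) := by
        ext j
        exact ih _ (by omega) fun i hi => h _ (by omega)
      have h2 : (zeroTrunc (s + 1) fun j => (w j).1) = zeroTrunc (s + 1) fun j => (w' j).1 := by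
        ext j
        unfold zeroTrunc
        split_ifs with hj
        · exact congrArg Prod.fst (h j hj)
        · rfl
      rw [h1, h2]

theorem hist_shift {Ω S : Type*} (Z : ℤ → Ω → S) (t : ℤ) (ω : Ω) (j : ℕ) :
    (fun i => hist Z t ω (i + j + 1)) = hist Z (t - 1 - j) ω := by
  ext i
  simp only [hist]
  congr 1
  push_cast
  ring

/-- All iterates fed into the step start at the same instant `t - s - 1`, whence the decreasing
order `s - j` at time `t - 1 - j`. From `j = s` on, the order is `0` and the entry is `c`. -/
theorem approx_succ_hist {Ω H : Type*} [Zero H] (X : ℤ → Ω → H) (ε : ℤ → Ω → ℝ)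
    (ν : ℝ → Measure ℕ) (g : ℕ → ℝ) (f : (ℕ → ℝ) → (ℕ → H) → ℝ) (c : ℝ) (s : ℕ) (t : ℤ) (ω : Ω) :
    approx ν g f c (s + 1) (hist (zeta X ε) t ω)
      = g (quantile (ν (f (fun j => approx ν g f c (s - j) (hist (zeta X ε) (t - 1 - j) ω))
          (zeroTrunc (s + 1) (hist X (t - 1) ω)))) (ε t ω)) := by
  rw [approx]
  simp only [hist_shift]
  have h1 : (fun j => (hist (zeta X ε) t ω j).1) = hist X (t - 1) ω := by
    ext j
    simp only [hist, zeta]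
    congr 1
    ring
  have h2 : (hist (zeta X ε) t ω 0).2 = ε t ω := by simp [hist, zeta]
  rw [h1, h2]

theorem measurable_hist_X_past {Ω H : Type*} [MeasurableSpace H] (X : ℤ → Ω → H)
    (ε : ℤ → Ω → ℝ) {t k : ℤ} (h : t ≤ k) : Measurable[past (joint X ε) k] (hist X t) :=
  @measurable_pi_lambda _ _ _ (past (joint X ε) k) _ _ fun j =>
    measurable_fst.comp (measurable_past (joint X ε) (j := t - j) (by omega))

theorem measurable_hist_zeta_past {Ω H : Type*} [MeasurableSpace H] (X : ℤ → Ω → H)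
    (ε : ℤ → Ω → ℝ) {t k : ℤ} (h : t ≤ k) :
    Measurable[past (joint X ε) k] (hist (zeta X ε) t) := by
  refine @measurable_pi_lambda _ _ _ (past (joint X ε) k) _ _ fun j => ?_
  have h1 : Measurable[past (joint X ε) k] (X (t - j - 1)) :=
    measurable_fst.comp (measurable_past (joint X ε) (j := t - j - 1) (by omega))
  have h2 : Measurable[past (joint X ε) k] (ε (t - j)) :=
    measurable_snd.comp (measurable_past (joint X ε) (j := t - j) (by omega))
  exact h1.prodMk h2

/-! ### Admissibility and measurability of the iterates, and the one-step contraction. -/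

section Iterates

variable {Ω H : Type*} [MeasurableSpace Ω] [NormedAddCommGroup H] [MeasurableSpace H]
  {P : Measure Ω} {X : ℤ → Ω → H} {ε : ℤ → Ω → ℝ} {Λ : Set ℝ} {ν : ℝ → Measure ℕ}
  {g : ℕ → ℝ} {G : ℝ × ℝ → ℝ} {f : (ℕ → ℝ) → (ℕ → H) → ℝ} {c : ℝ} {C : Set (ℕ → ℝ)}
  {D : Set (ℕ → H)} {a b : ℕ → ℝ}

theorem truncSeq_mem (hM : Model P X ε Λ ν g G f c C D a b) (p : ℕ) (y : ℕ → ℝ) :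
    truncSeq c p y ∈ C :=
  hM.mem_C _ ⟨p, fun i hi => by simp [truncSeq, not_lt.2 hi]⟩

theorem zeroTrunc_mem (hM : Model P X ε Λ ν g G f c C D a b) (p : ℕ) (x : ℕ → H) :
    zeroTrunc p x ∈ D :=
  hM.mem_D _ ⟨p, fun i hi => by simp [zeroTrunc, not_lt.2 hi]⟩

theorem approx_seq_mem (hM : Model P X ε Λ ν g G f c C D a b) (s : ℕ)
    (w : ℕ → ℕ → H × ℝ) : (fun j => approx ν g f c (s - j) (w j)) ∈ C :=
  hM.mem_C _ ⟨s, fun i hi => by rw [Nat.sub_eq_zero_of_le hi, approx]⟩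

theorem measurable_zeroTrunc {α : Type*} {m : MeasurableSpace α} (p : ℕ) {x : α → ℕ → H}
    (hx : Measurable x) : Measurable fun z => zeroTrunc p (x z) := by
  refine measurable_pi_lambda _ fun j => ?_
  unfold zeroTrunc
  split_ifs
  · exact (measurable_pi_apply j).comp hx
  · exact measurable_const

theorem measurable_truncSeq {α : Type*} {m : MeasurableSpace α} (p : ℕ) {y : α → ℕ → ℝ}
    (hy : Measurable y) : Measurable fun z => truncSeq c p (y z) := by
  refine measurable_pi_lambda _ fun j => ?_
  unfold truncSeq
  split_ifs
  · exact (measurable_pi_apply j).comp hy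
  · exact measurable_const

theorem Model.measurable_f_comp (hM : Model P X ε Λ ν g G f c C D a b) {α : Type*}
    {m : MeasurableSpace α} {y : α → ℕ → ℝ} {x : α → ℕ → H} (hy : Measurable y)
    (hx : Measurable x) (hyC : ∀ z, y z ∈ C) (hxD : ∀ z, x z ∈ D) :
    Measurable fun z => f (y z) (x z) :=
  hM.measurable_f.comp ((hy.subtype_mk (h := hyC)).prodMk (hx.subtype_mk (h := hxD)))

theorem measurable_approx (hM : Model P X ε Λ ν g G f c C D a b) (s : ℕ) :
    Measurable (approx ν g f c s) := by
  induction s using Nat.strong_induction_on with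
  | _ s ih =>
    cases s with
    | zero =>
      have : approx ν g f c 0 = fun _ => c := by ext w; rw [approx]
      rw [this]
      exact measurable_const
    | succ s =>
      let l : (ℕ → H × ℝ) → ℝ := fun w => f (fun j => approx ν g f c (s - j) fun i => w (i + j + 1))
        (zeroTrunc (s + 1) fun j => (w j).1)
      have hl : Measurable l := by
        refine hM.measurable_f_comp ?_ ?_ (fun w => approx_seq_mem hM s _)
          fun w => zeroTrunc_mem hM _ _
        · exact measurable_pi_lambda _ fun j => (ih _ (by omega)).comp
            (measurable_pi_lambda _ fun i => measurable_pi_apply _)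
        · exact measurable_zeroTrunc _
            (measurable_pi_lambda _ fun j => measurable_fst.comp (measurable_pi_apply j))
      have : approx ν g f c (s + 1) = fun w => G (l w, (w 0).2) := by
        ext w
        rw [approx, hM.G_eq _ (hM.f_mem _ (approx_seq_mem hM s _) _ (zeroTrunc_mem hM _ _))]
      rw [this]
      exact hM.measurable_G.comp (hl.prodMk (measurable_snd.comp (measurable_pi_apply 0)))

theorem measurable_limitFun (hM : Model P X ε Λ ν g G f c C D a b) :
    Measurable (limitFun ν g f c) :=
  (StronglyMeasurable.limUnder fun s => (measurable_approx hM s).stronglyMeasurable).measurable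

theorem Model.measurable_joint (hM : Model P X ε Λ ν g G f c C D a b) (t : ℤ) :
    Measurable (joint X ε t) := (hM.measurable_X t).prodMk (hM.measurable_ε t)

theorem Model.measurable_zeta (hM : Model P X ε Λ ν g G f c C D a b) (t : ℤ) :
    Measurable (zeta X ε t) := (hM.measurable_X _).prodMk (hM.measurable_ε t)

theorem Model.past_le (hM : Model P X ε Λ ν g G f c C D a b) (t : ℤ) :
    past (joint X ε) t ≤ ‹MeasurableSpace Ω› := Ingarch.past_le hM.measurable_joint t

theorem Model.stationary_zeta (hM : Model P X ε Λ ν g G f c C D a b) :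
    IsStationaryErgodic P (zeta X ε) := by
  have h := hM.stationary.factor hM.measurable_joint
    (φ := fun z : ℤ → H × ℝ => ((z (-1)).1, (z 0).2))
    ((measurable_fst.comp (measurable_pi_apply _)).prodMk
      (measurable_snd.comp (measurable_pi_apply _)))
  convert h using 2 with t
  ext ω
  · simp only [zeta, joint, neg_add_eq_sub]
  · simp only [zeta, joint, zero_add]

theorem Model.lintegral_X (hM : Model P X ε Λ ν g G f c C D a b) [OpensMeasurableSpace H]
    (t : ℤ) : ∫⁻ ω, ‖X t ω‖ₑ ∂P = ∫⁻ ω, ‖X 0 ω‖ₑ ∂P := by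
  have h := hM.stationary.lintegral_hist hM.measurable_joint
    (φ := fun w : ℕ → H × ℝ => ‖(w 0).1‖ₑ)
    (measurable_fst.comp (measurable_pi_apply 0)).enorm t 0
  simpa [hist, joint] using h

theorem Model.ae_hist_mem_D (hM : Model P X ε Λ ν g G f c C D a b) (t : ℤ) :
    ∀ᵐ ω ∂P, hist X t ω ∈ D := by
  have hm : Measurable fun w : ℕ → H × ℝ => fun j => (w j).1 :=
    measurable_pi_lambda _ fun j => measurable_fst.comp (measurable_pi_apply j)
  have hφ : Measurable fun w : ℕ → H × ℝ => Dᶜ.indicator (1 : (ℕ → H) → ℝ≥0∞) fun j => (w j).1 :=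
    (measurable_one.indicator hM.measurableSet_D.compl).comp hm
  have h := hM.stationary.lintegral_hist hM.measurable_joint hφ t 0
  have key : ∀ t, (∫⁻ ω, Dᶜ.indicator (1 : (ℕ → H) → ℝ≥0∞)
      (fun j => (hist (joint X ε) t ω j).1) ∂P = 0) ↔ ∀ᵐ ω ∂P, hist X t ω ∈ D := by
    intro t
    have hmh : Measurable (hist (joint X ε) t) :=
      measurable_pi_lambda _ fun j => hM.measurable_joint _
    rw [lintegral_eq_zero_iff (f := fun ω => Dᶜ.indicator (1 : (ℕ → H) → ℝ≥0∞)
      (fun j => (hist (joint X ε) t ω j).1)) (hφ.comp hmh)]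
    refine eventually_congr (ae_of_all _ fun ω => ?_)
    have : (fun j => (hist (joint X ε) t ω j).1) = hist X t ω := rfl
    simp only [this, Pi.zero_apply, Set.indicator_apply_eq_zero, Set.mem_compl_iff,
      Pi.one_apply, one_ne_zero, imp_false, not_not]
  rw [← key, h, key]
  exact hM.hist_mem_D

theorem Model.tsum_ofReal_a_lt (hM : Model P X ε Λ ν g G f c C D a b) :
    ∑' i, ENNReal.ofReal (a i) < 1 := by
  rw [← ENNReal.ofReal_tsum_of_nonneg hM.a_nonneg hM.summable_a, ENNReal.ofReal_lt_one]
  exact hM.tsum_a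

theorem Model.tsum_ofReal_b_ne_top (hM : Model P X ε Λ ν g G f c C D a b) :
    ∑' i, ENNReal.ofReal (b i) ≠ ⊤ := by
  rw [← ENNReal.ofReal_tsum_of_nonneg hM.b_nonneg hM.summable_b]
  exact ENNReal.ofReal_ne_top

/-- The parameter of the recursion agrees almost surely with a predictable variable with values
in the parameter set. -/
theorem Model.exists_param (hM : Model P X ε Λ ν g G f c C D a b) (t : ℤ) {y : Ω → ℕ → ℝ}
    {x : Ω → ℕ → H} (hy : Measurable[past (joint X ε) (t - 1)] y)
    (hx : Measurable[past (joint X ε) (t - 1)] x) (hyC : ∀ ω, y ω ∈ C) (hxD : ∀ᵐ ω ∂P, x ω ∈ D) :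
    ∃ l : Ω → ℝ, Measurable[past (joint X ε) (t - 1)] l ∧ (∀ ω, l ω ∈ Λ) ∧
      ∀ᵐ ω ∂P, f (y ω) (x ω) = l ω := by
  classical
  -- Histories lie in `D` only almost surely; those outside are replaced by the zero sequence, which
  -- belongs to `D`, so that the parameter lies in `Λ` everywhere.
  let pr : (ℕ → H) → ℕ → H := fun x => if x ∈ D then x else fun _ => 0
  have hpr : Measurable pr := Measurable.ite hM.measurableSet_D measurable_id measurable_const
  have hprD : ∀ x, pr x ∈ D := by
    intro x
    by_cases h : x ∈ D
    · simp [pr, h]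
    · simp only [pr, h, if_false]
      exact hM.mem_D _ ⟨0, fun _ _ => rfl⟩
  refine ⟨fun ω => f (y ω) (pr (x ω)), hM.measurable_f_comp hy (hpr.comp hx) hyC fun _ => hprD _,
    fun ω => hM.f_mem _ (hyC ω) _ (hprD _), ?_⟩
  filter_upwards [hxD] with ω h1
  simp only [pr, h1, if_true]

theorem Model.aemeasurable_step (hM : Model P X ε Λ ν g G f c C D a b) (t : ℤ) {y : Ω → ℕ → ℝ}
    {x : Ω → ℕ → H} (hy : Measurable[past (joint X ε) (t - 1)] y)
    (hx : Measurable[past (joint X ε) (t - 1)] x) (hyC : ∀ ω, y ω ∈ C) (hxD : ∀ᵐ ω ∂P, x ω ∈ D) :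
    AEMeasurable (fun ω => g (quantile (ν (f (y ω) (x ω))) (ε t ω))) P := by
  obtain ⟨l, hl, hΛ, hfl⟩ := hM.exists_param t hy hx hyC hxD
  refine ⟨fun ω => G (l ω, ε t ω), hM.measurable_G.comp
    ((hl.mono (hM.past_le _) le_rfl).prodMk (hM.measurable_ε t)), ?_⟩
  filter_upwards [hfl] with ω h
  rw [h, hM.G_eq _ (hΛ ω)]

/-- Comparison of one step of the recursion from two pasts. -/
theorem Model.step (hM : Model P X ε Λ ν g G f c C D a b) [IsProbabilityMeasure P]
    [BorelSpace H] [SecondCountableTopology H] (t : ℤ) {y y' : Ω → ℕ → ℝ} {x x' : Ω → ℕ → H}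
    (hy : Measurable[past (joint X ε) (t - 1)] y) (hy' : Measurable[past (joint X ε) (t - 1)] y')
    (hx : Measurable[past (joint X ε) (t - 1)] x) (hx' : Measurable[past (joint X ε) (t - 1)] x')
    (hyC : ∀ ω, y ω ∈ C) (hyC' : ∀ ω, y' ω ∈ C) (hxD : ∀ᵐ ω ∂P, x ω ∈ D)
    (hxD' : ∀ᵐ ω ∂P, x' ω ∈ D) :
    ∫⁻ ω, ‖g (quantile (ν (f (y ω) (x ω))) (ε t ω))
        - g (quantile (ν (f (y' ω) (x' ω))) (ε t ω))‖ₑ ∂P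
      ≤ ∑' i, ENNReal.ofReal (a i) * ∫⁻ ω, ‖y ω i - y' ω i‖ₑ ∂P
        + ∑' j, ENNReal.ofReal (b j) * ∫⁻ ω, ‖x ω j - x' ω j‖ₑ ∂P := by
  have hm := hM.past_le (t - 1)
  obtain ⟨l, hl, hΛ, hfl⟩ := hM.exists_param t hy hx hyC hxD
  obtain ⟨l', hl', hΛ', hfl'⟩ := hM.exists_param t hy' hx' hyC' hxD'
  have hmy : ∀ i, Measurable fun ω => ‖y ω i - y' ω i‖ₑ := fun i =>
    (((measurable_pi_apply i).comp (hy.mono hm le_rfl)).sub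
      ((measurable_pi_apply i).comp (hy'.mono hm le_rfl))).enorm
  have hmx : ∀ i, Measurable fun ω => ‖x ω i - x' ω i‖ₑ := fun i =>
    (((measurable_pi_apply i).comp (hx.mono hm le_rfl)).sub
      ((measurable_pi_apply i).comp (hx'.mono hm le_rfl))).enorm
  calc ∫⁻ ω, ‖g (quantile (ν (f (y ω) (x ω))) (ε t ω))
        - g (quantile (ν (f (y' ω) (x' ω))) (ε t ω))‖ₑ ∂P
      = ∫⁻ ω, ‖G (l ω, ε t ω) - G (l' ω, ε t ω)‖ₑ ∂P := by
        refine lintegral_congr_ae ?_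
        filter_upwards [hfl, hfl'] with ω h1 h2
        rw [h1, h2, hM.G_eq _ (hΛ ω), hM.G_eq _ (hΛ' ω)]
    _ ≤ ∫⁻ ω, ‖l ω - l' ω‖ₑ ∂P :=
        lintegral_sub_quantile_le hM.measurable_G hM.G_eq hM.lip (hM.measurable_ε t)
          (hM.map_ε t) hm (hM.indep t) hl hl' (ae_of_all _ hΛ) (ae_of_all _ hΛ')
    _ ≤ ∫⁻ ω, (∑' i, ENNReal.ofReal (a i) * ‖y ω i - y' ω i‖ₑ
          + ∑' j, ENNReal.ofReal (b j) * ‖x ω j - x' ω j‖ₑ) ∂P := by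
        refine lintegral_mono_ae ?_
        filter_upwards [hfl, hfl', hxD, hxD'] with ω h1 h2 h3 h4
        rw [← h1, ← h2]
        exact hM.f_lip _ (hyC ω) _ (hyC' ω) _ h3 _ h4
    _ = _ := by
        rw [lintegral_add_left (Measurable.tsum fun i => (hmy i).const_mul _),
          lintegral_tsum fun i => ((hmy i).const_mul _).aemeasurable,
          lintegral_tsum fun i => ((hmx i).const_mul _).aemeasurable]
        congr 1
        · exact tsum_congr fun i => lintegral_const_mul _ (hmy i)
        · exact tsum_congr fun i => lintegral_const_mul _ (hmx i)

end Iterates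

/-- The iterate of order `s` at time `t`. -/
abbrev iter {Ω H : Type*} [Zero H] (X : ℤ → Ω → H) (ε : ℤ → Ω → ℝ) (ν : ℝ → Measure ℕ)
    (g : ℕ → ℝ) (f : (ℕ → ℝ) → (ℕ → H) → ℝ) (c : ℝ) (s : ℕ) (t : ℤ) (ω : Ω) : ℝ :=
  approx ν g f c s (hist (zeta X ε) t ω)

/-- The limit of the iterates at time `t`. -/
abbrev sol {Ω H : Type*} [Zero H] (X : ℤ → Ω → H) (ε : ℤ → Ω → ℝ) (ν : ℝ → Measure ℕ)
    (g : ℕ → ℝ) (f : (ℕ → ℝ) → (ℕ → H) → ℝ) (c : ℝ) (t : ℤ) (ω : Ω) : ℝ :=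
  limitFun ν g f c (hist (zeta X ε) t ω)

/-- The mean distance of two consecutive iterates. -/
def iterDist {Ω H : Type*} [MeasurableSpace Ω] [Zero H] (P : Measure Ω) (X : ℤ → Ω → H)
    (ε : ℤ → Ω → ℝ) (ν : ℝ → Measure ℕ) (g : ℕ → ℝ) (f : (ℕ → ℝ) → (ℕ → H) → ℝ) (c : ℝ)
    (s : ℕ) : ℝ≥0∞ :=
  ∫⁻ ω, ‖iter X ε ν g f c (s + 1) 0 ω - iter X ε ν g f c s 0 ω‖ₑ ∂P

/-- The mean distance of an iterate and the limit. -/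
def iterErr {Ω H : Type*} [MeasurableSpace Ω] [Zero H] (P : Measure Ω) (X : ℤ → Ω → H)
    (ε : ℤ → Ω → ℝ) (ν : ℝ → Measure ℕ) (g : ℕ → ℝ) (f : (ℕ → ℝ) → (ℕ → H) → ℝ) (c : ℝ)
    (s : ℕ) : ℝ≥0∞ :=
  ∫⁻ ω, ‖iter X ε ν g f c s 0 ω - sol X ε ν g f c 0 ω‖ₑ ∂P

theorem iter_zero {Ω H : Type*} [Zero H] (X : ℤ → Ω → H) (ε : ℤ → Ω → ℝ) (ν : ℝ → Measure ℕ)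
    (g : ℕ → ℝ) (f : (ℕ → ℝ) → (ℕ → H) → ℝ) (c : ℝ) (t : ℤ) (ω : Ω) :
    iter X ε ν g f c 0 t ω = c := by rw [iter, approx]

theorem measurable_enorm_sub {Ω : Type*} {m : MeasurableSpace Ω} {x y : Ω → ℝ}
    (hx : Measurable x) (hy : Measurable y) : Measurable fun ω => ‖x ω - y ω‖ₑ :=
  (hx.sub hy).enorm

theorem lintegral_enorm_sub_le {Ω : Type*} [MeasurableSpace Ω] {P : Measure Ω} {x y z : Ω → ℝ}
    (hx : AEMeasurable x P) (hy : AEMeasurable y P) :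
    ∫⁻ ω, ‖x ω - z ω‖ₑ ∂P ≤ ∫⁻ ω, ‖x ω - y ω‖ₑ ∂P + ∫⁻ ω, ‖y ω - z ω‖ₑ ∂P := by
  rw [← lintegral_add_left' (f := fun ω => ‖x ω - y ω‖ₑ) (hx.sub hy).enorm]
  refine lintegral_mono fun ω => ?_
  simp only [← edist_eq_enorm_sub]
  exact edist_triangle _ _ _

theorem lintegral_enorm_sub_comm {Ω : Type*} [MeasurableSpace Ω] {P : Measure Ω}
    (x y : Ω → ℝ) : ∫⁻ ω, ‖x ω - y ω‖ₑ ∂P = ∫⁻ ω, ‖y ω - x ω‖ₑ ∂P := by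
  simp only [← edist_eq_enorm_sub, edist_comm]

theorem measurable_hist_past_of {Ω H : Type*} [MeasurableSpace H] {X : ℤ → Ω → H}
    {ε : ℤ → Ω → ℝ} {Y : ℤ → Ω → ℝ} (hY : ∀ t, Measurable[past (joint X ε) t] (Y t)) (t : ℤ) :
    Measurable[past (joint X ε) t] (hist Y t) :=
  @measurable_pi_lambda _ _ _ (past (joint X ε) t) _ _ fun j =>
    (hY (t - j)).mono (past_mono _ (by omega)) le_rfl

/-! ### Convergence of the iterates and the truncated equation. -/

section Solution

variable {Ω H : Type*} [MeasurableSpace Ω] [NormedAddCommGroup H] [MeasurableSpace H]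
  {P : Measure Ω} {X : ℤ → Ω → H} {ε : ℤ → Ω → ℝ} {Λ : Set ℝ} {ν : ℝ → Measure ℕ}
  {g : ℕ → ℝ} {G : ℝ × ℝ → ℝ} {f : (ℕ → ℝ) → (ℕ → H) → ℝ} {c : ℝ} {C : Set (ℕ → ℝ)}
  {D : Set (ℕ → H)} {a b : ℕ → ℝ}

theorem Model.measurable_hist_zeta (hM : Model P X ε Λ ν g G f c C D a b) (t : ℤ) :
    Measurable (hist (zeta X ε) t) :=
  measurable_pi_lambda _ fun _ => hM.measurable_zeta _

theorem Model.measurable_iter (hM : Model P X ε Λ ν g G f c C D a b) (s : ℕ) (t : ℤ) :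
    Measurable (iter X ε ν g f c s t) :=
  (measurable_approx hM s).comp (hM.measurable_hist_zeta t)

theorem Model.measurable_sol (hM : Model P X ε Λ ν g G f c C D a b) (t : ℤ) :
    Measurable (sol X ε ν g f c t) :=
  (measurable_limitFun hM).comp (hM.measurable_hist_zeta t)

theorem Model.measurable_iter_past (hM : Model P X ε Λ ν g G f c C D a b) (s : ℕ) {t k : ℤ}
    (h : t ≤ k) : Measurable[past (joint X ε) k] (iter X ε ν g f c s t) :=
  (measurable_approx hM s).comp (measurable_hist_zeta_past X ε h)

theorem Model.measurable_sol_past (hM : Model P X ε Λ ν g G f c C D a b) {t k : ℤ}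
    (h : t ≤ k) : Measurable[past (joint X ε) k] (sol X ε ν g f c t) :=
  (measurable_limitFun hM).comp (measurable_hist_zeta_past X ε h)

theorem Model.iterDist_eq (hM : Model P X ε Λ ν g G f c C D a b) (s : ℕ) (t : ℤ) :
    ∫⁻ ω, ‖iter X ε ν g f c (s + 1) t ω - iter X ε ν g f c s t ω‖ₑ ∂P
      = iterDist P X ε ν g f c s :=
  hM.stationary_zeta.lintegral_hist hM.measurable_zeta
    (φ := fun w => ‖approx ν g f c (s + 1) w - approx ν g f c s w‖ₑ)
    ((measurable_approx hM _).sub (measurable_approx hM _)).enorm t 0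

theorem Model.iterErr_eq (hM : Model P X ε Λ ν g G f c C D a b) (s : ℕ) (t : ℤ) :
    ∫⁻ ω, ‖iter X ε ν g f c s t ω - sol X ε ν g f c t ω‖ₑ ∂P = iterErr P X ε ν g f c s :=
  hM.stationary_zeta.lintegral_hist hM.measurable_zeta
    (φ := fun w => ‖approx ν g f c s w - limitFun ν g f c w‖ₑ)
    ((measurable_approx hM _).sub (measurable_limitFun hM)).enorm t 0

theorem Model.measurable_iterSeq_past (hM : Model P X ε Λ ν g G f c C D a b) (s : ℕ) (t : ℤ) :
    Measurable[past (joint X ε) (t - 1)] fun ω j => iter X ε ν g f c (s - j) (t - 1 - j) ω :=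
  @measurable_pi_lambda _ _ _ (past (joint X ε) (t - 1)) _ _ fun j =>
    hM.measurable_iter_past (s - j) (by omega)

theorem Model.aemeasurable_step_trunc (hM : Model P X ε Λ ν g G f c C D a b) {Y : ℤ → Ω → ℝ}
    (hY : ∀ t, Measurable[past (joint X ε) t] (Y t)) (p : ℕ) (t : ℤ) :
    AEMeasurable (fun ω => g (quantile (ν (f (truncSeq c p (hist Y (t - 1) ω))
      (hist X (t - 1) ω))) (ε t ω))) P :=
  hM.aemeasurable_step t (measurable_truncSeq p (measurable_hist_past_of hY _))
    (measurable_hist_X_past X ε le_rfl) (fun _ => truncSeq_mem hM _ _) (hM.ae_hist_mem_D _)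

variable [IsProbabilityMeasure P] [BorelSpace H] [SecondCountableTopology H]

/-- The first iterate is compared with the quantile transform at the fixed parameter `f (c, c, …)
(0, 0, …)`, which is integrable. By the one-step bound the difference has mean at most `∑ b_j` times
`E|X_0|`. -/
theorem Model.iterDist_zero_ne_top (hM : Model P X ε Λ ν g G f c C D a b) :
    iterDist P X ε ν g f c 0 ≠ ⊤ := by
  have hl0 : f (fun _ => c) (fun _ => 0) ∈ Λ :=
    hM.f_mem _ (hM.mem_C _ ⟨0, fun _ _ => rfl⟩) _ (hM.mem_D _ ⟨0, fun _ _ => rfl⟩)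
  set l0 := f (fun _ => c) (fun _ => 0) with hl0_def
  have hg0 : Measurable fun u => g (quantile (ν l0) u) :=
    measurable_from_nat.comp (measurable_quantile _)
  have hz : Measurable fun ω => g (quantile (ν l0) (ε 0 ω)) := hg0.comp (hM.measurable_ε 0)
  have h1 := hM.step 0 (y := fun ω j => iter X ε ν g f c (0 - j) (0 - 1 - j) ω)
    (y' := fun _ _ => c) (x := fun ω => zeroTrunc (0 + 1) (hist X (0 - 1) ω))
    (x' := fun _ _ => 0) (hM.measurable_iterSeq_past 0 0) measurable_const
    (measurable_zeroTrunc _ (measurable_hist_X_past X ε le_rfl)) measurable_const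
    (fun ω => approx_seq_mem hM 0 _) (fun ω => hM.mem_C _ ⟨0, fun _ _ => rfl⟩)
    (ae_of_all _ fun ω => zeroTrunc_mem hM _ _)
    (ae_of_all _ fun ω => hM.mem_D _ ⟨0, fun _ _ => rfl⟩)
  have h2 : ∫⁻ ω, ‖iter X ε ν g f c (0 + 1) 0 ω - g (quantile (ν l0) (ε 0 ω))‖ₑ ∂P ≠ ⊤ := by
    simp only [iter, approx_succ_hist]
    refine ne_top_of_le_ne_top ?_ h1
    refine ENNReal.add_ne_top.2 ⟨?_, ?_⟩
    · simp [iter_zero]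
    · refine ne_top_of_le_ne_top (ENNReal.mul_ne_top hM.tsum_ofReal_b_ne_top hM.integrable_X) ?_
      rw [← ENNReal.tsum_mul_right]
      refine ENNReal.tsum_le_tsum fun j => ?_
      refine mul_le_mul_right ?_ _
      rw [← hM.lintegral_X (0 - 1 - j)]
      refine lintegral_mono fun ω => ?_
      simp only [zeroTrunc, hist]
      split_ifs <;> simp
  have h3 : ∫⁻ ω, ‖g (quantile (ν l0) (ε 0 ω)) - c‖ₑ ∂P ≠ ⊤ := by
    have h4 : ∫⁻ ω, ‖g (quantile (ν l0) (ε 0 ω))‖ₑ ∂P ≠ ⊤ := by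
      have := lintegral_map (μ := P) hg0.enorm (hM.measurable_ε 0)
      rw [hM.map_ε] at this
      rw [← this]
      exact hM.integrable_g _ hl0
    refine ne_top_of_le_ne_top (ENNReal.add_ne_top.2 ⟨h4, enorm_ne_top (x := c)⟩) ?_
    calc ∫⁻ ω, ‖g (quantile (ν l0) (ε 0 ω)) - c‖ₑ ∂P
        ≤ ∫⁻ ω, (‖g (quantile (ν l0) (ε 0 ω))‖ₑ + ‖c‖ₑ) ∂P :=
          lintegral_mono fun ω => enorm_sub_le
      _ = _ := by rw [lintegral_add_left hz.enorm]; simp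
  refine ne_top_of_le_ne_top (ENNReal.add_ne_top.2 ⟨h2, h3⟩) ?_
  unfold iterDist
  simp only [iter_zero]
  exact lintegral_enorm_sub_le (hM.measurable_iter _ _).aemeasurable hz.aemeasurable

/-- The two iterates differ only through their starting times. Entries with index `i > s` equal `c`
in both, so the first sum is finite, and the two zero truncations differ only in entry `s + 1`. -/
theorem Model.iterDist_succ_le (hM : Model P X ε Λ ν g G f c C D a b) (s : ℕ) :
    iterDist P X ε ν g f c (s + 1)
      ≤ ∑ i ∈ Finset.range (s + 1), ENNReal.ofReal (a i) * iterDist P X ε ν g f c (s - i)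
        + ENNReal.ofReal (b (s + 1)) * ∫⁻ ω, ‖X 0 ω‖ₑ ∂P := by
  have h1 := hM.step 0 (hM.measurable_iterSeq_past (s + 1) 0) (hM.measurable_iterSeq_past s 0)
    (measurable_zeroTrunc (s + 1 + 1) (measurable_hist_X_past X ε le_rfl))
    (measurable_zeroTrunc (s + 1) (measurable_hist_X_past X ε le_rfl))
    (fun ω => approx_seq_mem hM _ _) (fun ω => approx_seq_mem hM _ _)
    (ae_of_all _ fun ω => zeroTrunc_mem hM _ _)
    (ae_of_all _ fun ω => zeroTrunc_mem hM _ _)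
  unfold iterDist
  conv_lhs => simp only [iter, approx_succ_hist X ε ν g f c]
  refine h1.trans (add_le_add ?_ ?_)
  · rw [tsum_eq_sum (s := Finset.range (s + 1))]
    · refine Finset.sum_le_sum fun i hi => ?_
      have hi' : i ≤ s := Nat.lt_succ_iff.1 (Finset.mem_range.1 hi)
      refine mul_le_mul_right ?_ _
      rw [Nat.succ_sub hi']
      exact (hM.iterDist_eq (s - i) _).le
    · intro i hi
      have hi' : s + 1 ≤ i := by simpa using hi
      have h2 : s + 1 - i = 0 := by omega
      have h3 : s - i = 0 := by omega
      simp [h2, h3, iter_zero]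
  · rw [tsum_eq_single (s + 1)]
    · refine mul_le_mul_right ?_ _
      rw [← hM.lintegral_X (0 - 1 - (s + 1 : ℕ))]
      refine lintegral_mono fun ω => ?_
      simp [zeroTrunc, hist]
    · intro j hj
      have : ∀ ω, zeroTrunc (s + 1 + 1) (hist X (0 - 1) ω) j
          = zeroTrunc (s + 1) (hist X (0 - 1) ω) j := by
        intro ω
        unfold zeroTrunc
        have : j < s + 1 + 1 ↔ j < s + 1 := by omega
        simp only [this]
      simp only [this, sub_self, enorm_zero, lintegral_zero, mul_zero]

theorem Model.tsum_iterDist_ne_top (hM : Model P X ε Λ ν g G f c C D a b) :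
    ∑' s, iterDist P X ε ν g f c s ≠ ⊤ := by
  refine tsum_ne_top_of_renewal (r := fun s => ENNReal.ofReal (b (s + 1)) * ∫⁻ ω, ‖X 0 ω‖ₑ ∂P)
    hM.tsum_ofReal_a_lt hM.iterDist_zero_ne_top ?_ hM.iterDist_succ_le
  rw [ENNReal.tsum_mul_right]
  refine ENNReal.mul_ne_top (ne_top_of_le_ne_top hM.tsum_ofReal_b_ne_top ?_) hM.integrable_X
  exact ENNReal.tsum_comp_le_tsum_of_injective (add_left_injective 1)
    (fun i => ENNReal.ofReal (b i))

/-- Increments with summable means are almost surely summable, so the iterates are almost surely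
Cauchy. -/
theorem Model.ae_tendsto_iter (hM : Model P X ε Λ ν g G f c C D a b) (t : ℤ) :
    ∀ᵐ ω ∂P, Tendsto (fun s => iter X ε ν g f c s t ω) atTop (𝓝 (sol X ε ν g f c t ω)) := by
  have h1 : ∫⁻ ω, ∑' s, ‖iter X ε ν g f c (s + 1) t ω - iter X ε ν g f c s t ω‖ₑ ∂P ≠ ⊤ := by
    rw [lintegral_tsum fun s =>
      (measurable_enorm_sub (hM.measurable_iter (s + 1) t) (hM.measurable_iter s t)).aemeasurable]
    simp only [hM.iterDist_eq]
    exact hM.tsum_iterDist_ne_top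
  filter_upwards [ae_lt_top (Measurable.tsum fun s =>
    (measurable_enorm_sub (hM.measurable_iter (s + 1) t) (hM.measurable_iter s t))) h1] with ω hω
  have hc : CauchySeq fun s => iter X ε ν g f c s t ω :=
    cauchySeq_of_edist_le_of_tsum_ne_top _
      (fun s => by rw [edist_comm, edist_eq_enorm_sub]) hω.ne
  exact tendsto_nhds_limUnder (cauchySeq_tendsto_of_complete hc)

theorem Model.iterErr_le (hM : Model P X ε Λ ν g G f c C D a b) (s : ℕ) :
    iterErr P X ε ν g f c s ≤ ∑' k, iterDist P X ε ν g f c (k + s) := by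
  have h1 : ∀ᵐ ω ∂P, ‖iter X ε ν g f c s 0 ω - sol X ε ν g f c 0 ω‖ₑ
      ≤ ∑' k, ‖iter X ε ν g f c (k + s + 1) 0 ω - iter X ε ν g f c (k + s) 0 ω‖ₑ := by
    filter_upwards [hM.ae_tendsto_iter 0] with ω hω
    have h2 := edist_le_tsum_of_edist_le_of_tendsto
      (fun k => ‖iter X ε ν g f c (k + 1) 0 ω - iter X ε ν g f c k 0 ω‖ₑ)
      (fun k => by rw [edist_comm, edist_eq_enorm_sub]) hω s
    rw [edist_eq_enorm_sub] at h2
    simpa only [add_comm s] using h2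
  calc iterErr P X ε ν g f c s
      ≤ ∫⁻ ω, ∑' k, ‖iter X ε ν g f c (k + s + 1) 0 ω - iter X ε ν g f c (k + s) 0 ω‖ₑ ∂P :=
        lintegral_mono_ae h1
    _ = _ := by
        rw [lintegral_tsum fun k => (measurable_enorm_sub (hM.measurable_iter (k + s + 1) 0)
          (hM.measurable_iter (k + s) 0)).aemeasurable]
        rfl

theorem Model.iterErr_le_tsum (hM : Model P X ε Λ ν g G f c C D a b) (s : ℕ) :
    iterErr P X ε ν g f c s ≤ ∑' k, iterDist P X ε ν g f c k :=
  (hM.iterErr_le s).trans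
    (ENNReal.tsum_comp_le_tsum_of_injective (add_left_injective s) _)

theorem Model.iterErr_ne_top (hM : Model P X ε Λ ν g G f c C D a b) (s : ℕ) :
    iterErr P X ε ν g f c s ≠ ⊤ :=
  ne_top_of_le_ne_top hM.tsum_iterDist_ne_top (hM.iterErr_le_tsum s)

theorem Model.tendsto_iterErr (hM : Model P X ε Λ ν g G f c C D a b) :
    Tendsto (iterErr P X ε ν g f c) atTop (𝓝 0) :=
  tendsto_of_tendsto_of_tendsto_of_le_of_le tendsto_const_nhds
    (ENNReal.tendsto_sum_nat_add _ hM.tsum_iterDist_ne_top) (fun _ => bot_le) hM.iterErr_le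

theorem Model.integrable_sol (hM : Model P X ε Λ ν g G f c C D a b) (t : ℤ) :
    Integrable (sol X ε ν g f c t) P := by
  have h1 : Integrable (fun ω => c - sol X ε ν g f c t ω) P := by
    refine ⟨(measurable_const.sub (hM.measurable_sol t)).aestronglyMeasurable, ?_⟩
    have := hM.iterErr_eq 0 t
    simp only [iter_zero] at this
    rw [hasFiniteIntegral_iff_enorm, this]
    exact (hM.iterErr_ne_top 0).lt_top
  refine ((integrable_const c).sub h1).congr (ae_of_all _ fun ω => ?_)
  simp

/-- The distance of an iterate and of one step of the recursion started from the truncated past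
of a process. -/
theorem Model.step_iter (hM : Model P X ε Λ ν g G f c C D a b) {Y : ℤ → Ω → ℝ}
    (hY : ∀ t, Measurable[past (joint X ε) t] (Y t)) (s p : ℕ) (t : ℤ) :
    ∫⁻ ω, ‖iter X ε ν g f c (s + 1) t ω
        - g (quantile (ν (f (truncSeq c p (hist Y (t - 1) ω)) (hist X (t - 1) ω))) (ε t ω))‖ₑ ∂P
      ≤ ∑' i, ENNReal.ofReal (a i) * ∫⁻ ω, ‖iter X ε ν g f c (s - i) (t - 1 - i) ω
            - truncSeq c p (hist Y (t - 1) ω) i‖ₑ ∂P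
        + (∑' j, ENNReal.ofReal (b (j + (s + 1)))) * ∫⁻ ω, ‖X 0 ω‖ₑ ∂P := by
  have hYh := measurable_hist_past_of hY (t - 1)
  have h1 := hM.step t (hM.measurable_iterSeq_past s t) (measurable_truncSeq (c := c) p hYh)
    (measurable_zeroTrunc (s + 1) (measurable_hist_X_past X ε le_rfl))
    (measurable_hist_X_past X ε le_rfl)
    (fun ω => approx_seq_mem hM _ _) (fun ω => truncSeq_mem hM _ _)
    (ae_of_all _ fun ω => zeroTrunc_mem hM _ _) (hM.ae_hist_mem_D (t - 1))
  conv_lhs => simp only [iter, approx_succ_hist X ε ν g f c]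
  refine h1.trans (add_le_add le_rfl ?_)
  -- The zero truncation alters only the entries `j ≥ s + 1`, each with mean norm `E|X_0|`.
  rw [← ENNReal.tsum_mul_right, ← tsum_ite_lt_eq_tsum_add
    (fun j => ENNReal.ofReal (b j) * ∫⁻ ω, ‖X 0 ω‖ₑ ∂P) (s + 1)]
  refine ENNReal.tsum_le_tsum fun j => ?_
  split_ifs with hj
  · simp [zeroTrunc, hj]
  · refine mul_le_mul_right ?_ _
    rw [← hM.lintegral_X (t - 1 - j)]
    refine lintegral_mono fun ω => ?_
    simp [zeroTrunc, hj, hist]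

/-- Both sides are compared with the iterate of order `p + 1`: its inputs and the truncated past
have the same horizon, both being `c` from index `p` on. -/
theorem Model.tendsto_sol (hM : Model P X ε Λ ν g G f c C D a b) (t : ℤ) :
    Tendsto (fun p : ℕ => ∫⁻ ω, ‖g (quantile (ν (f (truncSeq c p
        (hist (sol X ε ν g f c) (t - 1) ω)) (hist X (t - 1) ω))) (ε t ω))
        - sol X ε ν g f c t ω‖ₑ ∂P) atTop (𝓝 0) := by
  have hb := ENNReal.tendsto_sum_nat_add _ hM.tsum_ofReal_b_ne_top
  have hb1 : Tendsto (fun p => (∑' j, ENNReal.ofReal (b (j + (p + 1)))) * ∫⁻ ω, ‖X 0 ω‖ₑ ∂P)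
      atTop (𝓝 (0 * ∫⁻ ω, ‖X 0 ω‖ₑ ∂P)) :=
    ENNReal.Tendsto.mul_const (hb.comp (tendsto_add_atTop_nat 1)) (Or.inr hM.integrable_X)
  have ha := tendsto_tsum_mul_sub hM.tsum_ofReal_a_lt.ne_top hM.tsum_iterDist_ne_top
    hM.iterErr_le_tsum hM.tendsto_iterErr
  have hlim := (ha.add hb1).add (hM.tendsto_iterErr.comp (tendsto_add_atTop_nat 1))
  rw [zero_mul, add_zero, add_zero] at hlim
  refine tendsto_of_tendsto_of_tendsto_of_le_of_le tendsto_const_nhds hlim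
    (fun _ => bot_le) fun p => ?_
  dsimp only [Function.comp_apply]
  rw [lintegral_enorm_sub_comm]
  have h1 := hM.step_iter (fun t => hM.measurable_sol_past (le_refl t)) p p t
  have h2 := hM.iterErr_eq (p + 1) t
  rw [lintegral_enorm_sub_comm] at h2
  refine (lintegral_enorm_sub_le (hM.measurable_sol t).aemeasurable
    (hM.measurable_iter (p + 1) t).aemeasurable).trans ?_
  rw [h2, add_comm]
  refine add_le_add (h1.trans (add_le_add ?_ le_rfl)) le_rfl
  refine ENNReal.tsum_le_tsum fun i => ?_
  gcongr
  split_ifs with hi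
  · simp only [truncSeq, hi, if_true, hist]
    exact (hM.iterErr_eq (p - i) (t - 1 - i)).le
  · have : p - i = 0 := by omega
    simp [truncSeq, hi, this, iter_zero]

/-- The limit solves the equation only in the sense of truncated pasts, so the inequality is proved
up to the truncation error for `p ≥ s`, and then `p → ∞`. For `i ≥ s` natural subtraction gives
order `0`, the distance from the constant `c`. -/
theorem Model.iterErr_succ_le (hM : Model P X ε Λ ν g G f c C D a b) (s : ℕ) :
    iterErr P X ε ν g f c (s + 1)
      ≤ ∑' i, ENNReal.ofReal (a i) * iterErr P X ε ν g f c (s - i)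
        + (∑' j, ENNReal.ofReal (b (j + (s + 1)))) * ∫⁻ ω, ‖X 0 ω‖ₑ ∂P := by
  have hlim := (hM.tendsto_sol 0).const_add
    (∑' i, ENNReal.ofReal (a i) * iterErr P X ε ν g f c (s - i)
        + (∑' j, ENNReal.ofReal (b (j + (s + 1)))) * ∫⁻ ω, ‖X 0 ω‖ₑ ∂P)
  rw [add_zero] at hlim
  refine ge_of_tendsto hlim ?_
  filter_upwards [eventually_ge_atTop s] with p hp
  have h1 := hM.step_iter (fun t => hM.measurable_sol_past (le_refl t)) s p 0
  refine (lintegral_enorm_sub_le (hM.measurable_iter (s + 1) 0).aemeasurable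
    (hM.aemeasurable_step_trunc (fun t => hM.measurable_sol_past (le_refl t)) p 0)).trans (add_le_add (h1.trans (add_le_add ?_ le_rfl)) le_rfl)
  refine ENNReal.tsum_le_tsum fun i => mul_le_mul_right ?_ _
  by_cases hi : i < p
  · simp only [truncSeq, hi, if_true, hist]
    exact (hM.iterErr_eq (s - i) (0 - 1 - i)).le
  · have : s - i = 0 := by omega
    simp [truncSeq, hi, this, iter_zero]

end Solution

theorem measurable_limUnder_real {α : Type*} {m : MeasurableSpace α} {l : ℕ → α → ℝ}
    (hl : ∀ p, Measurable (l p)) : Measurable fun x => limUnder atTop fun p => l p x :=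
  (StronglyMeasurable.limUnder fun p => (hl p).stronglyMeasurable).measurable

/-! ### Stationarity, uniqueness, and the equation without truncation. -/

section Uniqueness

variable {Ω H : Type*} [MeasurableSpace Ω] [NormedAddCommGroup H] [MeasurableSpace H]
  {P : Measure Ω} {X : ℤ → Ω → H} {ε : ℤ → Ω → ℝ} {Λ : Set ℝ} {ν : ℝ → Measure ℕ}
  {g : ℕ → ℝ} {G : ℝ × ℝ → ℝ} {f : (ℕ → ℝ) → (ℕ → H) → ℝ} {c : ℝ} {C : Set (ℕ → ℝ)}
  {D : Set (ℕ → H)} {a b : ℕ → ℝ}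

theorem Model.stationary_sol (hM : Model P X ε Λ ν g G f c C D a b) :
    IsStationaryErgodic P (sol X ε ν g f c) := by
  have h := hM.stationary_zeta.factor hM.measurable_zeta
    (φ := fun z : ℤ → H × ℝ => limitFun ν g f c fun j => z (-j))
    ((measurable_limitFun hM).comp (measurable_pi_lambda _ fun j => measurable_pi_apply _))
  convert h using 2 with t
  ext ω
  simp only [sol, neg_add_eq_sub]
  rfl

theorem Model.stationary_fullProc (hM : Model P X ε Λ ν g G f c C D a b) :
    IsStationaryErgodic P (fullProc X ε (sol X ε ν g f c)) := by
  have h := hM.stationary_zeta.factor hM.measurable_zeta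
    (φ := fun z : ℤ → H × ℝ => (z 0, limitFun ν g f c fun j => z (-j)))
    ((measurable_pi_apply _).prodMk
      ((measurable_limitFun hM).comp (measurable_pi_lambda _ fun j => measurable_pi_apply _)))
  convert h using 2 with t
  ext ω : 1
  simp only [fullProc, sol, neg_add_eq_sub, zero_add]
  rfl

variable [IsProbabilityMeasure P] [BorelSpace H] [SecondCountableTopology H]

theorem Model.isSolution_sol (hM : Model P X ε Λ ν g G f c C D a b) :
    IsSolution P X ε ν g f c (sol X ε ν g f c) where
  nonanticipative _ := hM.measurable_sol_past le_rfl
  integrable := hM.integrable_sol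
  stationary_ergodic := hM.stationary_sol
  equation := hM.tendsto_sol

/-- The distances `d t` are bounded uniformly in `t`, because both processes are stationary and
integrable. Comparing the two equations truncated at the same `p`, where the entries from index `p`
on cancel, and letting `p → ∞` gives `sup d ≤ a sup d`, hence `sup d = 0`. -/
theorem Model.eq_sol (hM : Model P X ε Λ ν g G f c C D a b) {Y : ℤ → Ω → ℝ}
    (hY : IsSolution P X ε ν g f c Y) (t : ℤ) : Y t =ᵐ[P] sol X ε ν g f c t := by
  set S := sol X ε ν g f c with hS
  have hYm : ∀ t, Measurable (Y t) := fun t => (hY.nonanticipative t).mono (hM.past_le t) le_rfl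
  have hSp : ∀ t, Measurable[past (joint X ε) t] (S t) := fun t => hM.measurable_sol_past le_rfl
  have hSm : ∀ t, Measurable (S t) := hM.measurable_sol
  let d : ℤ → ℝ≥0∞ := fun t => ∫⁻ ω, ‖Y t ω - S t ω‖ₑ ∂P
  have hYe : ∀ t, ∫⁻ ω, ‖Y t ω‖ₑ ∂P = ∫⁻ ω, ‖Y 0 ω‖ₑ ∂P := fun t => by
    simpa [hist] using hY.stationary_ergodic.lintegral_hist hYm
      (φ := fun w : ℕ → ℝ => ‖w 0‖ₑ) (measurable_pi_apply 0).enorm t 0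
  have hSe : ∀ t, ∫⁻ ω, ‖S t ω‖ₑ ∂P = ∫⁻ ω, ‖S 0 ω‖ₑ ∂P := fun t => by
    simpa [hist] using hM.stationary_sol.lintegral_hist hSm
      (φ := fun w : ℕ → ℝ => ‖w 0‖ₑ) (measurable_pi_apply 0).enorm t 0
  have hdK : ∀ t, d t ≤ ∫⁻ ω, ‖Y 0 ω‖ₑ ∂P + ∫⁻ ω, ‖S 0 ω‖ₑ ∂P := fun t => by
    rw [← hYe t, ← hSe t, ← lintegral_add_left (hYm t).enorm]
    exact lintegral_mono fun ω => enorm_sub_le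
  have hsup : ⨆ t, d t ≠ ⊤ := by
    refine ne_top_of_le_ne_top (ENNReal.add_ne_top.2 ⟨?_, ?_⟩) (iSup_le hdK)
    · exact (hY.integrable 0).2.ne
    · exact (hM.integrable_sol 0).2.ne
  have hle : ∀ t, d t ≤ (∑' i, ENNReal.ofReal (a i)) * ⨆ t, d t := by
    intro t
    have hlim := ((hY.equation t).add_const ((∑' i, ENNReal.ofReal (a i)) * ⨆ t, d t)).add
      (hM.tendsto_sol t)
    rw [zero_add, add_zero] at hlim
    refine ge_of_tendsto' hlim fun p => ?_
    refine (lintegral_enorm_sub_le (hYm t).aemeasurable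
      (hM.aemeasurable_step_trunc hY.nonanticipative p t)).trans ?_
    rw [lintegral_enorm_sub_comm (Y t), add_assoc]
    refine add_le_add le_rfl ((lintegral_enorm_sub_le
      (hM.aemeasurable_step_trunc hY.nonanticipative p t)
      (hM.aemeasurable_step_trunc hSp p t)).trans (add_le_add ?_ le_rfl))
    have h1 := hM.step t (measurable_truncSeq (c := c) p
      (measurable_hist_past_of hY.nonanticipative _))
      (measurable_truncSeq (c := c) p (measurable_hist_past_of hSp _))
      (measurable_hist_X_past X ε le_rfl) (measurable_hist_X_past X ε le_rfl)
      (fun ω => truncSeq_mem hM _ _) (fun ω => truncSeq_mem hM _ _)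
      (hM.ae_hist_mem_D (t - 1)) (hM.ae_hist_mem_D (t - 1))
    refine h1.trans ?_
    simp only [sub_self, enorm_zero, lintegral_zero, mul_zero, tsum_zero, add_zero]
    rw [← ENNReal.tsum_mul_right]
    refine ENNReal.tsum_le_tsum fun i => mul_le_mul_right ?_ _
    by_cases hi : i < p
    · simp only [truncSeq, hi, if_true]
      exact le_iSup d (t - 1 - i)
    · simp [truncSeq, hi]
  have h0 : ⨆ t, d t = 0 := by
    by_contra hne
    have h1 : ⨆ t, d t ≤ (∑' i, ENNReal.ofReal (a i)) * ⨆ t, d t := iSup_le hle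
    have h2 : (∑' i, ENNReal.ofReal (a i)) * ⨆ t, d t < 1 * ⨆ t, d t :=
      ENNReal.mul_lt_mul_left hne hsup hM.tsum_ofReal_a_lt
    rw [one_mul] at h2
    exact absurd h1 (not_le.2 h2)
  have hd : d t = 0 := le_antisymm (h0 ▸ le_iSup d t) bot_le
  rw [lintegral_eq_zero_iff (measurable_enorm_sub (hYm t) (hSm t))] at hd
  filter_upwards [hd] with ω hω
  simpa [sub_eq_zero] using hω

/-- The equation holds literally where the regression function is defined. -/
theorem Model.sol_eq (hM : Model P X ε Λ ν g G f c C D a b) (t : ℤ)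
    (hC : ∀ᵐ ω ∂P, hist (sol X ε ν g f c) (t - 1) ω ∈ C) :
    ∀ᵐ ω ∂P, sol X ε ν g f c t ω = g (quantile
      (ν (f (hist (sol X ε ν g f c) (t - 1) ω) (hist X (t - 1) ω))) (ε t ω)) := by
  set S := sol X ε ν g f c with hS
  have hSp : ∀ t, Measurable[past (joint X ε) t] (S t) := fun t => hM.measurable_sol_past le_rfl
  have hSm : ∀ t, Measurable (S t) := hM.measurable_sol
  have hm := hM.past_le (t - 1)
  have hpar := fun p : ℕ => hM.exists_param t
    (measurable_truncSeq (c := c) p (measurable_hist_past_of hSp (t - 1)))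
    (measurable_hist_X_past X ε le_rfl) (fun _ => truncSeq_mem hM _ _) (hM.ae_hist_mem_D (t - 1))
  choose l hlm hlΛ hl using hpar
  -- `h i` bounds the effect on `f` of replacing entry `i` of the past by `c`. Its sum has finite
  -- mean, since `E|c - Y_t|` does not depend on `t`, so its tails control the truncation error.
  let h : ℕ → Ω → ℝ≥0∞ := fun i ω => ENNReal.ofReal (a i) * ‖c - hist S (t - 1) ω i‖ₑ
  have hhm : ∀ i, Measurable (h i) := fun i =>
    (measurable_enorm_sub measurable_const (hSm _)).const_mul _
  have hhint : ∑' i, ∫⁻ ω, h i ω ∂P ≠ ⊤ := by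
    have : ∀ i, ∫⁻ ω, h i ω ∂P = ENNReal.ofReal (a i) * iterErr P X ε ν g f c 0 := fun i => by
      simp only [h, hist]
      rw [lintegral_const_mul _ (measurable_enorm_sub measurable_const (hSm _)),
        ← hM.iterErr_eq 0 (t - 1 - i)]
      simp only [iter_zero]
      rfl
    simp only [this]
    rw [ENNReal.tsum_mul_right]
    exact ENNReal.mul_ne_top hM.tsum_ofReal_a_lt.ne_top (hM.iterErr_ne_top 0)
  have hfin : ∀ᵐ ω ∂P, ∑' i, h i ω < ⊤ := by
    refine ae_lt_top (Measurable.tsum hhm) ?_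
    rwa [lintegral_tsum fun i => (hhm i).aemeasurable]
  let l' : Ω → ℝ := fun ω => f (hist S (t - 1) ω) (hist X (t - 1) ω)
  have hdist : ∀ᵐ ω ∂P, ∀ p, ‖l p ω - l' ω‖ₑ ≤ ∑' k, h (k + p) ω := by
    filter_upwards [hC, hM.ae_hist_mem_D (t - 1), ae_all_iff.2 hl] with ω h1 h2 h3 p
    rw [← h3 p]
    refine (hM.f_lip _ (truncSeq_mem hM _ _) _ h1 _ h2 _ h2).trans ?_
    simp only [sub_self, enorm_zero, mul_zero, tsum_zero, add_zero]
    rw [← tsum_ite_lt_eq_tsum_add (fun i => h i ω)]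
    refine ENNReal.tsum_le_tsum fun i => ?_
    split_ifs with hi
    · simp [truncSeq, hi]
    · simp [truncSeq, hi, h]
  -- `C` is not assumed measurable, so `l'` need not be measurable. The limit `L` of the predictable
  -- variables `l p` is, and it equals `l'` almost surely.
  let L : Ω → ℝ := fun ω => limUnder atTop fun p => l p ω
  have hLm : Measurable[past (joint X ε) (t - 1)] L :=
    measurable_limUnder_real hlm
  have hL : ∀ᵐ ω ∂P, L ω = l' ω := by
    filter_upwards [hdist, hfin] with ω h1 h2
    refine Tendsto.limUnder_eq ?_
    rw [tendsto_iff_edist_tendsto_0]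
    refine tendsto_of_tendsto_of_tendsto_of_le_of_le tendsto_const_nhds
      (ENNReal.tendsto_sum_nat_add (fun i => h i ω) h2.ne) (fun _ => bot_le) fun p => ?_
    rw [edist_eq_enorm_sub]
    exact h1 p
  have hLΛ : ∀ᵐ ω ∂P, L ω ∈ Λ := by
    filter_upwards [hL, hC, hM.ae_hist_mem_D (t - 1)] with ω h1 h2 h3
    rw [h1]
    exact hM.f_mem _ h2 _ h3
  have hGm : Measurable fun ω => G (L ω, ε t ω) :=
    hM.measurable_G.comp ((hLm.mono hm le_rfl).prodMk (hM.measurable_ε t))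
  have hGl : ∀ p, Measurable fun ω => G (l p ω, ε t ω) := fun p =>
    hM.measurable_G.comp (((hlm p).mono hm le_rfl).prodMk (hM.measurable_ε t))
  have hzero : ∫⁻ ω, ‖S t ω - G (L ω, ε t ω)‖ₑ ∂P = 0 := by
    refine le_antisymm ?_ bot_le
    have hlim := (hM.tendsto_sol t).add (ENNReal.tendsto_sum_nat_add _ hhint)
    rw [add_zero] at hlim
    refine ge_of_tendsto' hlim fun p => ?_
    refine (lintegral_enorm_sub_le (hSm t).aemeasurable (hGl p).aemeasurable).trans
      (add_le_add ?_ ?_)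
    · rw [lintegral_enorm_sub_comm]
      refine (lintegral_congr_ae ?_).le
      filter_upwards [hl p] with ω h1
      rw [h1, hM.G_eq _ (hlΛ p ω)]
    · refine (lintegral_sub_quantile_le hM.measurable_G hM.G_eq hM.lip (hM.measurable_ε t)
        (hM.map_ε t) hm (hM.indep t) (hlm p) hLm (ae_of_all _ (hlΛ p)) hLΛ).trans ?_
      rw [← lintegral_tsum fun k => (hhm (k + p)).aemeasurable]
      refine lintegral_mono_ae ?_
      filter_upwards [hL, hdist] with ω h1 h2
      rw [h1]
      exact h2 p
  rw [lintegral_eq_zero_iff (measurable_enorm_sub (hSm t) hGm)] at hzero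
  filter_upwards [hzero, hL, hLΛ] with ω h1 h2 h3
  have h4 : S t ω = G (L ω, ε t ω) := by simpa [sub_eq_zero] using h1
  rw [h4, hM.G_eq _ h3, h2]

end Uniqueness

/-! ### Mixing coefficients -/

theorem le_alphaCoeff {Ω : Type*} {F G : MeasurableSpace Ω} [MeasurableSpace Ω] (P : Measure Ω)
    [IsProbabilityMeasure P] {A B : Set Ω} (hA : MeasurableSet[F] A) (hB : MeasurableSet[G] B) :
    |P.real (A ∩ B) - P.real A * P.real B| ≤ alphaCoeff P F G := by
  refine le_csSup ⟨1, ?_⟩ ⟨A, B, hA, hB, rfl⟩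
  rintro x ⟨A, B, -, -, rfl⟩
  have h1 : P.real A * P.real B ≤ 1 :=
    mul_le_one₀ measureReal_le_one measureReal_nonneg measureReal_le_one
  have h2 : 0 ≤ P.real A * P.real B := mul_nonneg measureReal_nonneg measureReal_nonneg
  have h3 : P.real (A ∩ B) ≤ 1 := measureReal_le_one
  have h4 : 0 ≤ P.real (A ∩ B) := measureReal_nonneg
  rw [abs_le]
  constructor <;> linarith

/-- Mixing coefficients under approximation of the events of the second sigma-algebra. -/
theorem ofReal_alphaCoeff_le {Ω : Type*} {F F' G G' : MeasurableSpace Ω} [mΩ : MeasurableSpace Ω]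
    (P : Measure Ω) [IsProbabilityMeasure P] (hFF' : F ≤ F') (hF' : F' ≤ mΩ) (hG : G ≤ mΩ)
    (hG' : G' ≤ mΩ) {δ : ℝ≥0∞}
    (h : ∀ B, MeasurableSet[G] B → ∃ B', MeasurableSet[G'] B' ∧ P (symmDiff B B') ≤ δ) :
    ENNReal.ofReal (alphaCoeff P F G) ≤ ENNReal.ofReal (alphaCoeff P F' G') + 2 * δ := by
  by_cases hδ : δ = ⊤
  · simp [hδ]
  have hα : 0 ≤ alphaCoeff P F' G' := (abs_nonneg _).trans
    (le_alphaCoeff P (F := F') (G := G') (A := ∅) (B := ∅) (@MeasurableSet.empty _ F')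
      (@MeasurableSet.empty _ G'))
  -- Replacing `B` by `B'` costs `δ` once in `P(A ∩ B)` and once in `P(A) P(B)`.
  have key : alphaCoeff P F G ≤ alphaCoeff P F' G' + 2 * δ.toReal := by
    refine csSup_le ⟨_, ∅, ∅, @MeasurableSet.empty _ F, @MeasurableSet.empty _ G, rfl⟩ ?_
    rintro x ⟨A, B, hA, hB, rfl⟩
    obtain ⟨B', hB', hBB'⟩ := h B hB
    have h1 := le_alphaCoeff P (hFF' _ hA) hB'
    have hAm : MeasurableSet A := hF' _ (hFF' _ hA)
    have hBm : MeasurableSet B := hG _ hB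
    have hBm' : MeasurableSet B' := hG' _ hB'
    have hδr : P.real (symmDiff B B') ≤ δ.toReal := ENNReal.toReal_mono hδ hBB'
    have h2 : |P.real B - P.real B'| ≤ δ.toReal :=
      (abs_measureReal_sub_le_measureReal_symmDiff hBm.nullMeasurableSet
        hBm'.nullMeasurableSet).trans hδr
    have h3 : |P.real (A ∩ B) - P.real (A ∩ B')| ≤ δ.toReal := by
      refine (abs_measureReal_sub_le_measureReal_symmDiff (hAm.inter hBm).nullMeasurableSet
        (hAm.inter hBm').nullMeasurableSet).trans (le_trans (measureReal_mono ?_) hδr)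
      rw [← Set.inter_symmDiff_distrib_left]
      exact Set.inter_subset_right
    have h4 : |P.real A * P.real B' - P.real A * P.real B| ≤ δ.toReal := by
      rw [← mul_sub, abs_mul, abs_of_nonneg measureReal_nonneg, abs_sub_comm]
      exact (mul_le_of_le_one_left (abs_nonneg _) measureReal_le_one).trans h2
    rw [abs_le] at *
    constructor <;> linarith [h1.1, h1.2, h3.1, h3.2, h4.1, h4.2]
  calc ENNReal.ofReal (alphaCoeff P F G)
      ≤ ENNReal.ofReal (alphaCoeff P F' G' + 2 * δ.toReal) := ENNReal.ofReal_le_ofReal key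
    _ = _ := by
      rw [ENNReal.ofReal_add hα (by positivity), ENNReal.ofReal_mul (by norm_num),
        ENNReal.ofReal_toReal hδ, ENNReal.ofReal_ofNat]

theorem future_eq_comap {Ω S : Type*} [MeasurableSpace S] (Z : ℤ → Ω → S) (k : ℤ) :
    future Z k = MeasurableSpace.comap (fun ω (j : Set.Ici k) => Z j ω) inferInstance := by
  have : (inferInstance : MeasurableSpace (Set.Ici k → S))
      = ⨆ j : Set.Ici k, MeasurableSpace.comap (fun z => z j) inferInstance := rfl
  rw [this, MeasurableSpace.comap_iSup, future, iSup_subtype']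
  simp only [MeasurableSpace.comap_comp]
  rfl

/-- Mixing coefficients under approximation of the future by another process. -/
theorem ofReal_alphaCoeff_future_le {Ω S : Type*} {F F' G' : MeasurableSpace Ω}
    [mΩ : MeasurableSpace Ω] [MeasurableSpace S] (P : Measure Ω) [IsProbabilityMeasure P]
    (hFF' : F ≤ F') (hF' : F' ≤ mΩ) (hG' : G' ≤ mΩ) {V V' : ℤ → Ω → S}
    (hV : ∀ t, Measurable (V t)) (n : ℕ) (hV' : ∀ t : ℕ, n ≤ t → Measurable[G'] (V' t)) :
    ENNReal.ofReal (alphaCoeff P F (future V n)) ≤ ENNReal.ofReal (alphaCoeff P F' G')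
      + 2 * ∑' t : {t : ℕ // n ≤ t}, P {ω | V (t : ℕ) ω ≠ V' (t : ℕ) ω} := by
  refine ofReal_alphaCoeff_le P hFF' hF' (future_le hV n) hG' fun B hB => ?_
  rw [future_eq_comap] at hB
  obtain ⟨U, hU, rfl⟩ := hB
  have hm : Measurable[G'] fun ω (j : Set.Ici (n : ℤ)) => V' j ω := by
    refine @measurable_pi_lambda _ _ _ G' _ _ fun j => ?_
    obtain ⟨t, ht⟩ := Int.eq_ofNat_of_zero_le ((Int.natCast_nonneg n).trans j.2)
    have hj : (j : ℤ) = (t : ℤ) := ht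
    have hnt : n ≤ t := by
      have : (n : ℤ) ≤ j := j.2
      omega
    rw [hj]
    exact hV' t hnt
  -- Both events are preimages of the same set `U` under the two future paths, so they differ only
  -- where the paths do; a union bound over times `t ≥ n` follows.
  refine ⟨_, hm hU, (measure_mono ?_).trans (measure_iUnion_le _)⟩
  intro ω hω
  by_contra hne
  simp only [Set.mem_iUnion, Subtype.exists, not_exists] at hne
  have heq : (fun j : Set.Ici (n : ℤ) => V j ω) = fun j : Set.Ici (n : ℤ) => V' j ω := by
    ext j
    obtain ⟨t, ht⟩ := Int.eq_ofNat_of_zero_le ((Int.natCast_nonneg n).trans j.2)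
    have hj : (j : ℤ) = (t : ℤ) := ht
    have hnt : n ≤ t := by
      have : (n : ℤ) ≤ j := j.2
      omega
    have := hne t hnt
    rw [hj]
    by_contra h'
    exact this h'
  rw [Set.mem_symmDiff] at hω
  simp only [Set.mem_preimage, heq] at hω
  tauto

/-! ### Coupling of the future with iterates of finite memory. -/

section Coupling

variable {Ω H : Type*} [MeasurableSpace Ω] [NormedAddCommGroup H] [MeasurableSpace H]
  {P : Measure Ω} {X : ℤ → Ω → H} {ε : ℤ → Ω → ℝ} {Λ : Set ℝ} {ν : ℝ → Measure ℕ}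
  {g : ℕ → ℝ} {G : ℝ × ℝ → ℝ} {f : (ℕ → ℝ) → (ℕ → H) → ℝ} {c : ℝ} {C : Set (ℕ → ℝ)}
  {D : Set (ℕ → H)} {a b : ℕ → ℝ}

theorem Model.measurable_iter_future (hM : Model P X ε Λ ν g G f c C D a b) (s : ℕ) {t k : ℤ}
    (h : k ≤ t - s + 1) : Measurable[future (zeta X ε) k] (iter X ε ν g f c s t) := by
  -- Entries from index `s` on are irrelevant and may be set to zero, leaving `ζ_{t-s+1}` as the
  -- oldest variable.
  have h1 : iter X ε ν g f c s t = fun ω => approx ν g f c s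
      fun j => if j < s then zeta X ε (t - j) ω else 0 := by
    ext ω
    refine approx_congr ν g f c s fun j hj => ?_
    simp [hj, hist]
  rw [h1]
  refine (measurable_approx hM s).comp
    (@measurable_pi_lambda _ _ _ (future (zeta X ε) k) _ _ fun j => ?_)
  split_ifs with hj
  · exact measurable_future _ (by omega)
  · exact measurable_const

theorem Model.past_fullProc_le (hM : Model P X ε Λ ν g G f c C D a b) (k : ℤ) :
    past (fullProc X ε (sol X ε ν g f c)) k ≤ past (zeta X ε) k := by
  refine iSup₂_le fun j hj => Measurable.comap_le ?_
  exact (measurable_past _ hj).prodMk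
    ((measurable_limitFun hM).comp ((measurable_hist_past _ j).mono (past_mono _ hj) le_rfl))

theorem Model.ofReal_alphaMix_le (hM : Model P X ε Λ ν g G f c C D a b) [IsProbabilityMeasure P]
    {r n : ℕ} (hrn : r < n) :
    ENNReal.ofReal (alphaMix P (fullProc X ε (sol X ε ν g f c)) n)
      ≤ ENNReal.ofReal (alphaMix P (zeta X ε) (r + 1))
        + 2 * ∑' t : {t : ℕ // n ≤ t},
          P {ω | sol X ε ν g f c (t : ℕ) ω ≠ iter X ε ν g f c (t - r) (t : ℕ) ω} := by
  have h := ofReal_alphaCoeff_future_le P (hM.past_fullProc_le 0) (Ingarch.past_le hM.measurable_zeta 0)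
    (future_le hM.measurable_zeta (r + 1))
    -- An iterate of order `t - r` reaches back exactly to `ζ_{r+1}`. The conversion `toNat` only
    -- serves to define the process at all integer times.
    (V' := fun t ω => (zeta X ε t ω, iter X ε ν g f c (t.toNat - r) t ω))
    (fun t => (hM.measurable_zeta t).prodMk (hM.measurable_sol t)) n
    (fun t ht => (measurable_future _ (by omega)).prodMk
      (hM.measurable_iter_future _ (by simp only [Int.toNat_natCast]; omega)))
  refine h.trans (add_le_add le_rfl (mul_le_mul_right (ENNReal.tsum_le_tsum fun t => ?_) _))
  refine measure_mono fun ω hω => ?_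
  simpa [fullProc] using hω

end Coupling

/-! ### Solution of the recursive inequality -/

theorem lagTail_nonneg {b : ℕ → ℝ} (hb : ∀ j, 0 ≤ b j) (s : ℕ) : 0 ≤ lagTail b s :=
  tsum_nonneg fun _ => hb _

/-- Each `β i` is at most `γ / α`. If `α = 0` nothing is known about `β`, but then all the weights
vanish. -/
theorem sum_mul_le_of_mul_le {a β : ℕ → ℝ} {α γ : ℝ} {p : ℕ} (ha : ∀ i, 0 ≤ a i)
    (hα : ∑ i ∈ Finset.range p, a i ≤ α) (hγ : 0 ≤ γ) (h : ∀ i < p, α * β i ≤ γ) :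
    ∑ i ∈ Finset.range p, a i * β i ≤ γ := by
  have hα0 : 0 ≤ α := (Finset.sum_nonneg fun i _ => ha i).trans hα
  rcases hα0.eq_or_lt with h0 | h0
  · have : ∀ i ∈ Finset.range p, a i = 0 := by
      refine (Finset.sum_eq_zero_iff_of_nonneg fun i _ => ha i).1 (le_antisymm ?_ ?_)
      · rwa [h0]
      · exact Finset.sum_nonneg fun i _ => ha i
    rw [Finset.sum_eq_zero fun i hi => by rw [this i hi, zero_mul]]
    exact hγ
  · calc ∑ i ∈ Finset.range p, a i * β i ≤ ∑ i ∈ Finset.range p, a i * (γ / α) := by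
          refine Finset.sum_le_sum fun i hi => mul_le_mul_of_nonneg_left ?_ (ha i)
          rw [le_div_iff₀' h0]
          exact h i (Finset.mem_range.1 hi)
      _ ≤ α * (γ / α) := by
          rw [← Finset.sum_mul]
          exact mul_le_mul_of_nonneg_right hα (div_nonneg hγ hα0)
      _ = γ := by field_simp

/-- A factor `α` buys one unit in the exponent. The case `α = 0` is separate because of `0 ^ 0 = 1`;
there the left side vanishes. -/
theorem mul_rpow_le_rpow {α x y : ℝ} (h0 : 0 ≤ α) (h1 : α ≤ 1)
    (h : y ≤ x + 1) : α * α ^ x ≤ α ^ y := by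
  rcases h0.eq_or_lt with rfl | h0
  · rw [zero_mul]
    exact Real.rpow_nonneg le_rfl _
  · calc α * α ^ x = α ^ (x + 1) := by rw [Real.rpow_add_one h0.ne', mul_comm]
      _ ≤ α ^ y := Real.rpow_le_rpow_of_exponent_ge h0 h1 h

/-- The sum that carries the influence of the remote covariates. -/
def covSum (α : ℝ) (b : ℕ → ℝ) (p s : ℕ) : ℝ :=
  ∑ j ∈ Finset.range (s + 2), α ^ ((j : ℝ) / (p : ℝ)) * lagTail b (s + 1 - j)

theorem covSum_nonneg {α : ℝ} {b : ℕ → ℝ} (h0 : 0 ≤ α) (hb : ∀ j, 0 ≤ b j) (p s : ℕ) :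
    0 ≤ covSum α b p s :=
  Finset.sum_nonneg fun _ _ => mul_nonneg (Real.rpow_nonneg h0 _) (lagTail_nonneg hb _)

/-- Exponents are `j / p`, so a factor `α` pays for any index shift up to `p`; the shift needed is
`s - s' + 1 ≤ p`. The term `j = 0` of the larger sum supplies `lagTail b (s + 2)`. -/
theorem mul_covSum_add_le {α : ℝ} {b : ℕ → ℝ} (h0 : 0 ≤ α) (h1 : α ≤ 1) (hb : ∀ j, 0 ≤ b j)
    {p s s' : ℕ} (hs' : s' ≤ s) (hp : s + 1 ≤ s' + p) (hp0 : 0 < p) :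
    α * covSum α b p s' + lagTail b (s + 2) ≤ covSum α b p (s + 1) := by
  have hp' : (0 : ℝ) < p := by exact_mod_cast hp0
  have hsplit : covSum α b p (s + 1) = ∑ j ∈ Finset.range (s + 2),
      α ^ (((j + 1 : ℕ) : ℝ) / (p : ℝ)) * lagTail b (s + 1 - j) + lagTail b (s + 2) := by
    unfold covSum
    rw [Finset.sum_range_succ']
    congr 1
    · refine Finset.sum_congr rfl fun j _ => ?_
      congr 2
      omega
    · simp
  rw [hsplit]
  gcongr
  calc α * covSum α b p s'
      ≤ ∑ k ∈ Finset.range (s' + 2), α ^ (((s - s' + k + 1 : ℕ) : ℝ) / (p : ℝ))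
          * lagTail b (s + 1 - (s - s' + k)) := by
        unfold covSum
        rw [Finset.mul_sum]
        refine Finset.sum_le_sum fun k hk => ?_
        have h2 : s + 1 - (s - s' + k) = s' + 1 - k := by omega
        rw [h2, ← mul_assoc]
        refine mul_le_mul_of_nonneg_right (mul_rpow_le_rpow h0 h1 ?_) (lagTail_nonneg hb _)
        rw [div_add_one hp'.ne']
        refine div_le_div_of_nonneg_right ?_ hp'.le
        have : s - s' + k + 1 ≤ k + p := by omega
        exact_mod_cast this
    _ = ∑ j ∈ Finset.Ico (s - s') (s + 2), α ^ (((j + 1 : ℕ) : ℝ) / (p : ℝ))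
          * lagTail b (s + 1 - j) := by
        rw [Finset.sum_Ico_eq_sum_range]
        have : s + 2 - (s - s') = s' + 2 := by omega
        rw [this]
    _ ≤ _ := by
        refine Finset.sum_le_sum_of_subset_of_nonneg (fun j hj => ?_) fun j _ _ =>
          mul_nonneg (Real.rpow_nonneg h0 _) (lagTail_nonneg hb _)
        simp only [Finset.mem_Ico, Finset.mem_range] at *
        exact hj.2

/-- Strong induction, splitting the sum at `p`. The entries `i ≥ p` contribute at most `M S_{p+1}`.
For `i < p` the induction hypothesis at `s - i ≥ s + 1 - p` is multiplied by total weight at most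
`α`, which advances every exponent by one, that is, time by `p` steps. -/
theorem le_of_recursion {a b u : ℕ → ℝ} {M B : ℝ} (ha : ∀ i, 0 ≤ a i) (hb : ∀ j, 0 ≤ b j)
    (hsa : Summable a) (ha1 : ∑' i, a i < 1) (hB : 0 ≤ B) (hu0 : ∀ s, 0 ≤ u s)
    (hu : ∀ s, u s ≤ M)
    (hrec : ∀ s, u (s + 1) ≤ ∑' i, a i * u (s - i) + B * lagTail b (s + 2)) {p : ℕ} (hp : 0 < p)
    (s : ℕ) :
    u s ≤ M * (∑' i, a i) ^ ((s : ℝ) / (p : ℝ)) + M / (1 - ∑' i, a i) * lagTail a (p + 1)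
      + B * covSum (∑' i, a i) b p s := by
  set α := ∑' i, a i with hα
  have hα0 : 0 ≤ α := tsum_nonneg ha
  have hM : 0 ≤ M := (hu0 0).trans (hu 0)
  have hp' : (0 : ℝ) < p := by exact_mod_cast hp
  have h1α : 0 < 1 - α := by linarith
  set S := lagTail a (p + 1) with hS
  have hS0 : 0 ≤ S := lagTail_nonneg ha _
  induction s using Nat.strong_induction_on with
  | _ s ih =>
    cases s with
    | zero =>
      have h1 := covSum_nonneg hα0 hb p 0
      have : 0 ≤ M / (1 - α) * S := mul_nonneg (div_nonneg hM h1α.le) hS0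
      have h2 : 0 ≤ B * covSum α b p 0 := mul_nonneg hB h1
      simp only [Nat.cast_zero, zero_div, Real.rpow_zero, mul_one]
      linarith [hu 0]
    | succ s =>
      have hsum : Summable fun i => a i * u (s - i) :=
        Summable.of_nonneg_of_le (fun i => mul_nonneg (ha i) (hu0 _))
          (fun i => mul_le_mul_of_nonneg_left (hu _) (ha i)) (hsa.mul_right M)
      have htail : ∑' i, a (i + p) * u (s - (i + p)) ≤ M * S := by
        have h1 : Summable fun i => a (i + p) := (summable_nat_add_iff p).2 hsa
        calc ∑' i, a (i + p) * u (s - (i + p)) ≤ ∑' i, a (i + p) * M :=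
              ((summable_nat_add_iff p).2 hsum).tsum_le_tsum
                (fun i => mul_le_mul_of_nonneg_left (hu _) (ha _)) (h1.mul_right M)
          _ = M * S := by
              rw [tsum_mul_right, mul_comm, hS, lagTail]
              simp only [Nat.add_sub_cancel, add_comm]
      have hhead : ∑ i ∈ Finset.range p, a i * u (s - i)
          ≤ M * α ^ (((s + 1 : ℕ) : ℝ) / (p : ℝ)) + α * (M / (1 - α) * S)
            + B * (covSum α b p (s + 1) - lagTail b (s + 2)) := by
        have hcov : 0 ≤ covSum α b p (s + 1) - lagTail b (s + 2) := by
          have := mul_covSum_add_le hα0 ha1.le hb (le_refl s) (by omega) hp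
          have h2 := mul_nonneg hα0 (covSum_nonneg hα0 hb p s)
          linarith
        refine sum_mul_le_of_mul_le ha (hsa.sum_le_tsum _ fun i _ => ha i) ?_ fun i hi => ?_
        · have := Real.rpow_nonneg hα0 (((s + 1 : ℕ) : ℝ) / (p : ℝ))
          positivity
        · have h1 := ih (s - i) (by omega)
          have h2 := mul_covSum_add_le hα0 ha1.le hb (Nat.sub_le s i) (p := p) (by omega) hp
          have h3 : α * α ^ (((s - i : ℕ) : ℝ) / (p : ℝ)) ≤ α ^ (((s + 1 : ℕ) : ℝ) / (p : ℝ)) := by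
            refine mul_rpow_le_rpow hα0 ha1.le ?_
            rw [div_add_one hp'.ne']
            refine div_le_div_of_nonneg_right ?_ hp'.le
            have : s + 1 ≤ s - i + p := by omega
            exact_mod_cast this
          calc α * u (s - i) ≤ α * (M * α ^ (((s - i : ℕ) : ℝ) / (p : ℝ)) + M / (1 - α) * S
                + B * covSum α b p (s - i)) := mul_le_mul_of_nonneg_left h1 hα0
            _ = M * (α * α ^ (((s - i : ℕ) : ℝ) / (p : ℝ))) + α * (M / (1 - α) * S)
                + B * (α * covSum α b p (s - i)) := by ring
            _ ≤ _ := by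
                gcongr
                linarith
      -- The coefficient `M / (1 - α)` is the one that absorbs a fresh `M * S` at every step.
      have hfin : α * (M / (1 - α) * S) + M * S = M / (1 - α) * S := by
        field_simp
        ring
      calc u (s + 1) ≤ ∑' i, a i * u (s - i) + B * lagTail b (s + 2) := hrec s
        _ = ∑ i ∈ Finset.range p, a i * u (s - i) + ∑' i, a (i + p) * u (s - (i + p))
            + B * lagTail b (s + 2) := by rw [hsum.sum_add_tsum_nat_add p]
        _ ≤ _ := by linarith

theorem omega_nonneg {a b : ℕ → ℝ} (ha : ∀ i, 0 ≤ a i) (hb : ∀ j, 0 ≤ b j) (t r : ℕ) :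
    0 ≤ omega a b t r :=
  Real.iInf_nonneg fun _ => add_nonneg (add_nonneg (Real.rpow_nonneg (tsum_nonneg ha) _)
    (lagTail_nonneg ha _)) (Finset.sum_nonneg fun _ _ =>
      mul_nonneg (Real.rpow_nonneg (tsum_nonneg ha) _) (lagTail_nonneg hb _))

theorem exists_le_mul_omega {a b u : ℕ → ℝ} {M B : ℝ} (ha : ∀ i, 0 ≤ a i) (hb : ∀ j, 0 ≤ b j)
    (hsa : Summable a) (ha1 : ∑' i, a i < 1) (hB : 0 ≤ B) (hu0 : ∀ s, 0 ≤ u s)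
    (hu : ∀ s, u s ≤ M)
    (hrec : ∀ s, u (s + 1) ≤ ∑' i, a i * u (s - i) + B * lagTail b (s + 2)) :
    ∃ L : ℝ, 0 < L ∧ ∀ r t : ℕ, r < t → u (t - r) ≤ L * omega a b t r := by
  have hα0 : 0 ≤ ∑' i, a i := tsum_nonneg ha
  have hM : 0 ≤ M := (hu0 0).trans (hu 0)
  have h1α : 0 < 1 - ∑' i, a i := by linarith
  have hMα : 0 ≤ M / (1 - ∑' i, a i) := div_nonneg hM h1α.le
  -- The constant dominates the three coefficients in `le_of_recursion`; the summand `1` makes it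
  -- positive.
  refine ⟨1 + M + M / (1 - ∑' i, a i) + B, by positivity, fun r t hrt => ?_⟩
  rw [← div_le_iff₀' (by positivity)]
  refine le_ciInf fun p => ?_
  rw [div_le_iff₀' (by positivity)]
  have h := le_of_recursion ha hb hsa ha1 hB hu0 hu hrec p.pos (t - r)
  rw [Nat.cast_sub hrt.le] at h
  have h1 := Real.rpow_nonneg hα0 (((t : ℝ) - r) / ((p : ℕ) : ℝ))
  have h2 := lagTail_nonneg ha (p + 1)
  have h3 := covSum_nonneg hα0 hb p (t - r)
  unfold covSum at h h3
  set x := (∑' i, a i) ^ (((t : ℝ) - r) / ((p : ℕ) : ℝ))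
  set y := lagTail a (p + 1)
  set z := ∑ j ∈ Finset.range (t - r + 2),
        (∑' i, a i) ^ ((j : ℝ) / ((p : ℕ) : ℝ)) * lagTail b (t - r + 1 - j)
  set N := M / (1 - ∑' i, a i)
  refine h.trans ?_
  have e1 : M * x ≤ (1 + M + N + B) * x := mul_le_mul_of_nonneg_right (by linarith) h1
  have e2 : N * y ≤ (1 + M + N + B) * y := mul_le_mul_of_nonneg_right (by linarith) h2
  have e3 : B * z ≤ (1 + M + N + B) * z := mul_le_mul_of_nonneg_right (by linarith) h3
  rw [mul_add, mul_add]
  linarith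

/-! ### The error of the iterates in terms of `omega`. -/

section Error

variable {Ω H : Type*} [MeasurableSpace Ω] [NormedAddCommGroup H] [MeasurableSpace H]
  {P : Measure Ω} {X : ℤ → Ω → H} {ε : ℤ → Ω → ℝ} {Λ : Set ℝ} {ν : ℝ → Measure ℕ}
  {g : ℕ → ℝ} {G : ℝ × ℝ → ℝ} {f : (ℕ → ℝ) → (ℕ → H) → ℝ} {c : ℝ} {C : Set (ℕ → ℝ)}
  {D : Set (ℕ → H)} {a b : ℕ → ℝ} [IsProbabilityMeasure P] [BorelSpace H]
  [SecondCountableTopology H]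

theorem Model.exists_iterErr_le (hM : Model P X ε Λ ν g G f c C D a b) :
    ∃ L : ℝ, 0 < L ∧ ∀ r t : ℕ, r < t →
      iterErr P X ε ν g f c (t - r) ≤ ENNReal.ofReal (L * omega a b t r) := by
  set u : ℕ → ℝ := fun s => (iterErr P X ε ν g f c s).toReal with hu
  set M : ℝ := (∑' s, iterDist P X ε ν g f c s).toReal with hMdef
  have huM : ∀ s, u s ≤ M := fun s =>
    ENNReal.toReal_mono hM.tsum_iterDist_ne_top (hM.iterErr_le_tsum s)
  have hu0 : ∀ s, 0 ≤ u s := fun s => ENNReal.toReal_nonneg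
  have hue : ∀ s, iterErr P X ε ν g f c s = ENNReal.ofReal (u s) := fun s =>
    (ENNReal.ofReal_toReal (hM.iterErr_ne_top s)).symm
  set B : ℝ := (∫⁻ ω, ‖X 0 ω‖ₑ ∂P).toReal with hB
  have hB0 : 0 ≤ B := ENNReal.toReal_nonneg
  have hrec : ∀ s, u (s + 1) ≤ ∑' i, a i * u (s - i) + B * lagTail b (s + 2) := by
    intro s
    have h1 := hM.iterErr_succ_le s
    have hsum : Summable fun i => a i * u (s - i) :=
      Summable.of_nonneg_of_le (fun i => mul_nonneg (hM.a_nonneg i) (hu0 _))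
        (fun i => mul_le_mul_of_nonneg_left (huM _) (hM.a_nonneg i)) (hM.summable_a.mul_right M)
    have h2 : ∑' i, ENNReal.ofReal (a i) * iterErr P X ε ν g f c (s - i)
        = ENNReal.ofReal (∑' i, a i * u (s - i)) := by
      rw [ENNReal.ofReal_tsum_of_nonneg (fun i => mul_nonneg (hM.a_nonneg i) (hu0 _)) hsum]
      exact tsum_congr fun i => by rw [hue, ENNReal.ofReal_mul (hM.a_nonneg i)]
    -- Index `s + 1` is lag `s + 2`, since `b j` is the coefficient of lag `j + 1`.
    have h3 : ∑' j, ENNReal.ofReal (b (j + (s + 1))) = ENNReal.ofReal (lagTail b (s + 2)) := by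
      rw [← ENNReal.ofReal_tsum_of_nonneg (fun j => hM.b_nonneg _)
        ((summable_nat_add_iff (s + 1)).2 hM.summable_b), lagTail]
      congr 1
      refine tsum_congr fun j => ?_
      congr 1
      omega
    have h4 : ∫⁻ ω, ‖X 0 ω‖ₑ ∂P = ENNReal.ofReal B :=
      (ENNReal.ofReal_toReal hM.integrable_X).symm
    rw [h2, h3, h4, ← ENNReal.ofReal_mul (lagTail_nonneg hM.b_nonneg _), mul_comm _ B,
      ← ENNReal.ofReal_add (tsum_nonneg fun i => mul_nonneg (hM.a_nonneg i) (hu0 _))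
        (mul_nonneg hB0 (lagTail_nonneg hM.b_nonneg _)), hue] at h1
    exact (ENNReal.ofReal_le_ofReal_iff (add_nonneg
      (tsum_nonneg fun i => mul_nonneg (hM.a_nonneg i) (hu0 _))
      (mul_nonneg hB0 (lagTail_nonneg hM.b_nonneg _)))).1 h1
  obtain ⟨L, hL, h⟩ := exists_le_mul_omega hM.a_nonneg hM.b_nonneg hM.summable_a hM.tsum_a hB0 hu0
    huM hrec
  refine ⟨L, hL, fun r t hrt => ?_⟩
  rw [hue]
  exact ENNReal.ofReal_le_ofReal (h r t hrt)

/-- A closed set that contains the values of `g` contains the values of the solution. -/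
theorem Model.ae_sol_mem (hM : Model P X ε Λ ν g G f c C D a b) {T : Set ℝ} (hT : IsClosed T)
    (hg : ∀ k, g k ∈ T) (t : ℤ) : ∀ᵐ ω ∂P, sol X ε ν g f c t ω ∈ T := by
  filter_upwards [hM.ae_tendsto_iter t] with ω hω
  refine hT.mem_of_tendsto hω ?_
  filter_upwards [eventually_ge_atTop 1] with s hs
  obtain ⟨s, rfl⟩ := Nat.exists_eq_add_of_le' hs
  rw [iter, approx_succ_hist]
  exact hg _

end Error

/-! ### Exponential moments -/

theorem lintegral_exp_mul_poissonMeasure (μ : NNReal) (s : ℝ) :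
    ∫⁻ j, ENNReal.ofReal (Real.exp (s * j)) ∂(poissonMeasure μ)
      = ENNReal.ofReal (Real.exp (μ * (Real.exp s - 1))) := by
  rw [lintegral_countable']
  simp only [poissonMeasure_singleton]
  -- Exponential tilting: `exp (s j)` times the Poisson weights of mean `μ` is a constant multiple
  -- of the Poisson weights of mean `μ exp s`.
  set μ' : NNReal := μ * Real.toNNReal (Real.exp s) with hμ'
  have hμr : (μ' : ℝ) = μ * Real.exp s := by
    rw [hμ', NNReal.coe_mul, Real.coe_toNNReal _ (Real.exp_pos s).le]
  have h1 := (hasSum_one_poissonMeasure μ').mul_left (Real.exp (μ * (Real.exp s - 1)))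
  rw [mul_one] at h1
  rw [← h1.tsum_eq, ENNReal.ofReal_tsum_of_nonneg (fun n => by positivity) h1.summable]
  refine tsum_congr fun n => ?_
  rw [← ENNReal.ofReal_mul (Real.exp_pos _).le]
  congr 1
  rw [hμr, mul_pow, ← Real.exp_nat_mul, mul_comm s]
  have : Real.exp (-(μ : ℝ)) = Real.exp (μ * (Real.exp s - 1)) * Real.exp (-(μ * Real.exp s)) := by
    rw [← Real.exp_add]
    congr 1
    ring
  rw [this]
  ring

/-- At the scale `s = 1 / (1 + μ)`, the inequality `v ^ k ≤ k! exp v` with `v = s (1 + j)` reduces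
the power moment to an exponential one, which is bounded independently of `μ` because `μ (exp s - 1)
≤ 2 μ s ≤ 2`. -/
theorem lintegral_pow_poissonMeasure_le (μ : NNReal) (k : ℕ) :
    ∫⁻ j, ENNReal.ofReal ((1 + j : ℝ) ^ k) ∂(poissonMeasure μ)
      ≤ ENNReal.ofReal (k.factorial * Real.exp 3 * (1 + μ) ^ k) := by
  have hμ : (0 : ℝ) ≤ μ := μ.2
  set s : ℝ := 1 / (1 + μ) with hs
  have hs0 : 0 ≤ s := by positivity
  have hs1 : s ≤ 1 := by
    rw [hs, div_le_one (by positivity)]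
    linarith
  have hμs : μ * s ≤ 1 := by
    rw [hs, mul_one_div, div_le_one (by positivity)]
    linarith
  have hpt : ∀ j : ℕ, (1 + j : ℝ) ^ k
      ≤ k.factorial * Real.exp 1 * (1 + μ) ^ k * Real.exp (s * j) := by
    intro j
    have h1 := Real.pow_div_factorial_le_exp (s * (1 + j)) (by positivity) k
    have hf : (0 : ℝ) < k.factorial := by positivity
    rw [div_le_iff₀ hf] at h1
    have h2 : (1 + j : ℝ) ^ k = (1 + μ) ^ k * (s * (1 + j)) ^ k := by
      rw [← mul_pow, hs]
      congr 1
      field_simp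
    have h3 : Real.exp (s * (1 + j)) ≤ Real.exp 1 * Real.exp (s * j) := by
      rw [← Real.exp_add, Real.exp_le_exp]
      linarith
    rw [h2]
    calc (1 + (μ : ℝ)) ^ k * (s * (1 + j)) ^ k
        ≤ (1 + μ) ^ k * (Real.exp 1 * Real.exp (s * j) * k.factorial) := by
          gcongr
          exact h1.trans (by gcongr)
      _ = _ := by ring
  have hexp : Real.exp (μ * (Real.exp s - 1)) ≤ Real.exp 2 := by
    rw [Real.exp_le_exp]
    have h1 := Real.abs_exp_sub_one_le (x := s) (by rwa [abs_of_nonneg hs0])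
    rw [abs_of_nonneg hs0] at h1
    have h2 : Real.exp s - 1 ≤ 2 * s := (le_abs_self _).trans h1
    calc μ * (Real.exp s - 1) ≤ μ * (2 * s) := by gcongr
      _ ≤ 2 := by linarith
  calc ∫⁻ j, ENNReal.ofReal ((1 + j : ℝ) ^ k) ∂(poissonMeasure μ)
      ≤ ∫⁻ j : ℕ, ENNReal.ofReal (k.factorial * Real.exp 1 * (1 + μ) ^ k)
          * ENNReal.ofReal (Real.exp (s * j)) ∂(poissonMeasure μ) := by
        refine lintegral_mono fun j => ?_
        rw [← ENNReal.ofReal_mul (by positivity)]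
        exact ENNReal.ofReal_le_ofReal (hpt j)
    _ = ENNReal.ofReal (k.factorial * Real.exp 1 * (1 + μ) ^ k
          * Real.exp (μ * (Real.exp s - 1))) := by
        rw [lintegral_const_mul _ measurable_from_nat, lintegral_exp_mul_poissonMeasure,
          ← ENNReal.ofReal_mul (by positivity)]
    _ ≤ _ := by
        refine ENNReal.ofReal_le_ofReal ?_
        have h3 : Real.exp 3 = Real.exp 1 * Real.exp 2 := by
          rw [← Real.exp_add]; norm_num
        rw [h3]
        calc _ ≤ k.factorial * Real.exp 1 * (1 + μ) ^ k * Real.exp 2 := by gcongr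
          _ = _ := by ring

/-- Jensen's inequality for the exponential function and weights of total mass at most one. -/
theorem exp_sum_add_le {ι : Type*} (s : Finset ι) {w x : ι → ℝ} {z : ℝ} (hw : ∀ i ∈ s, 0 ≤ w i)
    (hs : ∑ i ∈ s, w i ≤ 1) :
    Real.exp (∑ i ∈ s, w i * x i + (1 - ∑ i ∈ s, w i) * z)
      ≤ ∑ i ∈ s, w i * Real.exp (x i) + (1 - ∑ i ∈ s, w i) * Real.exp z := by
  set u := ∑ i ∈ s, w i * x i + (1 - ∑ i ∈ s, w i) * z with hu
  -- The tangent to `exp` at the weighted mean `u`; averaging the tangent values returns `exp u`.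
  have h : ∀ v, Real.exp u * (1 + v - u) ≤ Real.exp v := fun v => by
    have h1 := Real.add_one_le_exp (v - u)
    have h2 : Real.exp v = Real.exp u * Real.exp (v - u) := by
      rw [← Real.exp_add]; congr 1; ring
    rw [h2]
    exact mul_le_mul_of_nonneg_left (by linarith) (Real.exp_pos _).le
  calc Real.exp u = ∑ i ∈ s, w i * (Real.exp u * (1 + x i - u))
        + (1 - ∑ i ∈ s, w i) * (Real.exp u * (1 + z - u)) := by
        have h3 : ∑ i ∈ s, w i * (Real.exp u * (1 + x i - u))
            = Real.exp u * ((∑ i ∈ s, w i) * (1 - u) + ∑ i ∈ s, w i * x i) := by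
          rw [Finset.sum_mul, ← Finset.sum_add_distrib, Finset.mul_sum]
          exact Finset.sum_congr rfl fun i _ => by ring
        rw [h3]
        have h4 : ∑ i ∈ s, w i * x i = u - (1 - ∑ i ∈ s, w i) * z := by rw [hu]; ring
        rw [h4]
        ring
    _ ≤ _ := by
        refine add_le_add (Finset.sum_le_sum fun i hi => mul_le_mul_of_nonneg_left (h _) (hw i hi))
          (mul_le_mul_of_nonneg_left (h _) (by linarith))

/-- An exponential bound on the parameter; `B` is a free shift. -/
theorem exp_mul_le_of_le {a y b x : ℕ → ℝ} {l K A B α β : ℝ} {s m : ℕ} (ha : ∀ i, 0 ≤ a i)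
    (hb : ∀ j, 0 ≤ b j) (hx : ∀ j, 0 ≤ x j) (hK : 0 ≤ K) (hA : 0 ≤ A) (hB : 0 ≤ B) (hα1 : α < 1)
    (hα : ∑ i ∈ Finset.range s, a i ≤ α) (hβ : ∑ j ∈ Finset.range m, b j ≤ β) (hβ0 : 0 < β)
    (hl : l ≤ A + ∑ i ∈ Finset.range s, a i * y i + ∑ j ∈ Finset.range m, b j * x j) :
    Real.exp (K * l) ≤ ∑ i ∈ Finset.range s, a i * (Real.exp (-B) * Real.exp (K * y i))
      + Real.exp ((B + K * A) / (1 - α)) *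
        (∑ j ∈ Finset.range m, b j / β * Real.exp (K / (1 - α) * β * x j) + 1) := by
  have h1α : 0 < 1 - α := by linarith
  set W := ∑ i ∈ Finset.range s, a i with hW
  set R := ∑ j ∈ Finset.range m, b j * x j with hR
  have hW0 : 0 ≤ W := Finset.sum_nonneg fun i _ => ha i
  have hR0 : 0 ≤ R := Finset.sum_nonneg fun j _ => mul_nonneg (hb j) (hx j)
  -- The remaining weight `1 - W ≥ 1 - α` at the point `z` carries the constant and covariate terms,
  -- and also `B`. Since `W * B ≤ B`, this pays for lowering each `K * y i` by `B`.
  set z := (B + K * A + K * R) / (1 - α) with hz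
  have hz0 : 0 ≤ z := by positivity
  have hzW : B + K * A + K * R ≤ (1 - W) * z := by
    have : B + K * A + K * R = (1 - α) * z := by rw [hz]; field_simp
    rw [this]
    exact mul_le_mul_of_nonneg_right (by linarith) hz0
  have h1 : K * l ≤ ∑ i ∈ Finset.range s, a i * (K * y i - B) + (1 - W) * z := by
    have h2 : ∑ i ∈ Finset.range s, a i * (K * y i - B)
        = K * ∑ i ∈ Finset.range s, a i * y i - W * B := by
      rw [hW, Finset.sum_mul, Finset.mul_sum, ← Finset.sum_sub_distrib]
      exact Finset.sum_congr rfl fun i _ => by ring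
    rw [h2]
    have h3 := mul_le_mul_of_nonneg_left hl hK
    have h4 : W * B ≤ 1 * B := mul_le_mul_of_nonneg_right (by linarith) hB
    linarith
  have hV : ∑ j ∈ Finset.range m, b j / β ≤ 1 := by
    rw [← Finset.sum_div, div_le_one hβ0]
    exact hβ
  have hV0 : 0 ≤ ∑ j ∈ Finset.range m, b j / β :=
    Finset.sum_nonneg fun j _ => div_nonneg (hb j) hβ0.le
  -- Jensen again, with weights `b j / β`; the mass left over sits at `0` and contributes at most
  -- `1`.
  have h5 : Real.exp (K / (1 - α) * R)
      ≤ ∑ j ∈ Finset.range m, b j / β * Real.exp (K / (1 - α) * β * x j) + 1 := by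
    have h6 := exp_sum_add_le (Finset.range m) (w := fun j => b j / β)
      (x := fun j => K / (1 - α) * β * x j) (z := 0) (fun j _ => div_nonneg (hb j) hβ0.le) hV
    have h7 : ∑ j ∈ Finset.range m, b j / β * (K / (1 - α) * β * x j) = K / (1 - α) * R := by
      rw [hR, Finset.mul_sum]
      exact Finset.sum_congr rfl fun j _ => by field_simp
    rw [h7, mul_zero, add_zero, Real.exp_zero, mul_one] at h6
    linarith
  have hzexp : Real.exp z = Real.exp ((B + K * A) / (1 - α)) * Real.exp (K / (1 - α) * R) := by
    rw [← Real.exp_add, hz]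
    congr 1
    ring
  calc Real.exp (K * l) ≤ Real.exp (∑ i ∈ Finset.range s, a i * (K * y i - B) + (1 - W) * z) :=
        Real.exp_le_exp.2 h1
    _ ≤ ∑ i ∈ Finset.range s, a i * Real.exp (K * y i - B) + (1 - W) * Real.exp z :=
        exp_sum_add_le _ (fun i _ => ha i) (by linarith)
    _ ≤ ∑ i ∈ Finset.range s, a i * Real.exp (K * y i - B) + 1 * Real.exp z := by
        gcongr
        linarith
    _ ≤ _ := by
        rw [one_mul, hzexp]
        refine add_le_add (Finset.sum_le_sum fun i _ => ?_)
          (mul_le_mul_of_nonneg_left h5 (Real.exp_pos _).le)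
        rw [← Real.exp_add, neg_add_eq_sub]

theorem lintegral_ofReal_sum_mul_le {Ω ι : Type*} [MeasurableSpace Ω] {P : Measure Ω}
    (s : Finset ι) {w : ι → ℝ} {U : ι → Ω → ℝ} {m : ℝ} (hw : ∀ i ∈ s, 0 ≤ w i)
    (hUm : ∀ i ∈ s, Measurable (U i)) (hU : ∀ i ∈ s, ∀ ω, 0 ≤ U i ω)
    (h : ∀ i ∈ s, ∫⁻ ω, ENNReal.ofReal (U i ω) ∂P ≤ ENNReal.ofReal m) :
    ∫⁻ ω, ENNReal.ofReal (∑ i ∈ s, w i * U i ω) ∂P ≤ ENNReal.ofReal ((∑ i ∈ s, w i) * m) := by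
  have h1 : ∀ ω, ENNReal.ofReal (∑ i ∈ s, w i * U i ω)
      = ∑ i ∈ s, ENNReal.ofReal (w i) * ENNReal.ofReal (U i ω) := fun ω => by
    rw [ENNReal.ofReal_sum_of_nonneg fun i hi => mul_nonneg (hw i hi) (hU i hi ω)]
    exact Finset.sum_congr rfl fun i hi => ENNReal.ofReal_mul (hw i hi)
  simp only [h1]
  rw [lintegral_finsetSum' _ fun i hi => ((hUm i hi).ennreal_ofReal.const_mul _).aemeasurable,
    ENNReal.ofReal_mul (Finset.sum_nonneg hw), ENNReal.ofReal_sum_of_nonneg hw, Finset.sum_mul]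
  refine Finset.sum_le_sum fun i hi => ?_
  rw [lintegral_const_mul _ (hUm i hi).ennreal_ofReal]
  exact mul_le_mul_right (h i hi) _

section Moments

variable {Ω H : Type*} [MeasurableSpace Ω] [NormedAddCommGroup H] [MeasurableSpace H]
  {P : Measure Ω} {X : ℤ → Ω → H} {ε : ℤ → Ω → ℝ} {Λ : Set ℝ} {ν : ℝ → Measure ℕ}
  {g : ℕ → ℝ} {G : ℝ × ℝ → ℝ} {f : (ℕ → ℝ) → (ℕ → H) → ℝ} {c : ℝ} {C : Set (ℕ → ℝ)}
  {D : Set (ℕ → H)} {a b : ℕ → ℝ}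

/-- The regression function grows at most linearly. -/
theorem Model.f_le (hM : Model P X ε Λ ν g G f c C D a b) {y : ℕ → ℝ} {x : ℕ → H} {s m : ℕ}
    (hy : ∀ i, s ≤ i → y i = c) (hx : ∀ j, m ≤ j → x j = 0) :
    f y x ≤ |f (fun _ => c) (fun _ => 0)| + |c| + ∑ i ∈ Finset.range s, a i * |y i|
      + ∑ j ∈ Finset.range m, b j * ‖x j‖ := by
  have h := hM.f_lip y (hM.mem_C _ ⟨s, hy⟩) (fun _ => c) (hM.mem_C _ ⟨0, fun _ _ => rfl⟩) x
    (hM.mem_D _ ⟨m, hx⟩) (fun _ => 0) (hM.mem_D _ ⟨0, fun _ _ => rfl⟩)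
  rw [tsum_eq_sum (s := Finset.range s), tsum_eq_sum (s := Finset.range m)] at h
  · have e1 : ∀ i, ENNReal.ofReal (a i) * ‖y i - c‖ₑ = ENNReal.ofReal (a i * |y i - c|) := fun i => by
      rw [ENNReal.ofReal_mul (hM.a_nonneg i), Real.enorm_eq_ofReal_abs]
    have e2 : ∀ j, ENNReal.ofReal (b j) * ‖x j - 0‖ₑ = ENNReal.ofReal (b j * ‖x j‖) := fun j => by
      rw [ENNReal.ofReal_mul (hM.b_nonneg j), sub_zero, ofReal_norm]
    have n1 : ∀ i ∈ Finset.range s, 0 ≤ a i * |y i - c| := fun i _ =>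
      mul_nonneg (hM.a_nonneg i) (abs_nonneg _)
    have n2 : ∀ j ∈ Finset.range m, 0 ≤ b j * ‖x j‖ := fun j _ =>
      mul_nonneg (hM.b_nonneg j) (norm_nonneg _)
    simp only [e1, e2] at h
    rw [← ENNReal.ofReal_sum_of_nonneg n1, ← ENNReal.ofReal_sum_of_nonneg n2,
      ← ENNReal.ofReal_add (Finset.sum_nonneg n1) (Finset.sum_nonneg n2),
      Real.enorm_eq_ofReal_abs, ENNReal.ofReal_le_ofReal_iff
        (add_nonneg (Finset.sum_nonneg n1) (Finset.sum_nonneg n2))] at h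
    have h1 : ∑ i ∈ Finset.range s, a i * |y i - c|
        ≤ ∑ i ∈ Finset.range s, a i * |y i| + |c| := by
      calc ∑ i ∈ Finset.range s, a i * |y i - c|
          ≤ ∑ i ∈ Finset.range s, (a i * |y i| + a i * |c|) := by
            refine Finset.sum_le_sum fun i _ => ?_
            rw [← mul_add]
            exact mul_le_mul_of_nonneg_left (abs_sub _ _) (hM.a_nonneg i)
        _ = ∑ i ∈ Finset.range s, a i * |y i| + (∑ i ∈ Finset.range s, a i) * |c| := by
            rw [Finset.sum_add_distrib, Finset.sum_mul]
        _ ≤ _ := by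
            gcongr
            exact mul_le_of_le_one_left (abs_nonneg _)
              ((hM.summable_a.sum_le_tsum _ fun i _ => hM.a_nonneg i).trans hM.tsum_a.le)
    have h2 := le_abs_self (f y x - f (fun _ => c) fun _ => 0)
    have h3 := le_abs_self (f (fun _ => c) fun _ => (0 : H))
    linarith
  · intro j hj
    simp [hx j (by simpa using hj)]
  · intro i hi
    simp [hy i (by simpa using hi)]

variable [IsProbabilityMeasure P] [BorelSpace H]

/-- In the log-linear Poisson model, the exponential moments of the iterates are bounded. -/
theorem Model.exists_exp_moment_iter_le (hM : Model P X ε Λ ν g G f c C D a b)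
    (hg : ∀ k : ℕ, g k = Real.log (1 + k))
    (hν : ∀ l ∈ Λ, ν l = poissonMeasure (Real.toNNReal (Real.exp l)))
    (hX : ∀ K : ℝ, 1 ≤ K → Integrable (fun ω => Real.exp (K * ‖X 0 ω‖)) P) (k : ℕ) :
    ∃ m : ℝ, 0 ≤ m ∧ ∀ s t, ∫⁻ ω, ENNReal.ofReal (Real.exp (k * |iter X ε ν g f c s t ω|)) ∂P
      ≤ ENNReal.ofReal m := by
  set α := ∑' i, a i with hα
  have hα0 : 0 ≤ α := tsum_nonneg hM.a_nonneg
  have hα1 : α < 1 := hM.tsum_a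
  have h1α : 0 < 1 - α := by linarith
  -- The summand `1` keeps `β` positive, so that division by it is harmless.
  set β := ∑' j, b j + 1 with hβ
  have hb0 : 0 ≤ ∑' j, b j := tsum_nonneg hM.b_nonneg
  have hβ0 : 0 < β := by linarith
  set A := |f (fun _ => c) (fun _ => 0)| + |c| with hA
  have hA0 : 0 ≤ A := by positivity
  -- `F` is the constant in `E exp(k|Y|) ≤ F (1 + E exp(k λ))`. The product `F * α` may exceed one,
  -- so the recursion need not contract as it stands; the shift `B = log F` cancels `F` and leaves
  -- the factor `α`.
  set F : ℝ := k.factorial * Real.exp 3 * 2 ^ k with hF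
  have hF1 : 1 ≤ F := by
    have h1 : (1 : ℝ) ≤ k.factorial := by exact_mod_cast Nat.one_le_iff_ne_zero.2 k.factorial_ne_zero
    have h2 : (1 : ℝ) ≤ Real.exp 3 := Real.one_le_exp (by norm_num)
    have h3 : (1 : ℝ) ≤ 2 ^ k := one_le_pow₀ (by norm_num)
    exact one_le_mul_of_one_le_of_one_le (one_le_mul_of_one_le_of_one_le h1 h2) h3
  set B := Real.log F with hB
  have hB0 : 0 ≤ B := Real.log_nonneg hF1
  have hFB : F * Real.exp (-B) = 1 := by
    rw [hB, Real.exp_neg, Real.exp_log (by linarith), mul_inv_cancel₀ (by linarith)]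
  set K' : ℝ := k / (1 - α) * β with hK'
  have hK'0 : 0 ≤ K' := by positivity
  obtain ⟨m₁, hm₁, hXm⟩ : ∃ m₁ : ℝ, 0 ≤ m₁ ∧
      ∀ t, ∫⁻ ω, ENNReal.ofReal (Real.exp (K' * ‖X t ω‖)) ∂P ≤ ENNReal.ofReal m₁ := by
    have h1 := hX (max 1 K') (le_max_left _ _)
    refine ⟨∫ ω, Real.exp (max 1 K' * ‖X 0 ω‖) ∂P, integral_nonneg fun _ => (Real.exp_pos _).le,
      fun t => ?_⟩
    have h2 := hM.stationary.lintegral_hist hM.measurable_joint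
      (φ := fun w : ℕ → H × ℝ => ENNReal.ofReal (Real.exp (K' * ‖(w 0).1‖)))
      (((measurable_fst.comp (measurable_pi_apply 0)).norm.const_mul K').exp.ennreal_ofReal) t 0
    have h3 : ∫⁻ ω, ENNReal.ofReal (Real.exp (K' * ‖X t ω‖)) ∂P
        = ∫⁻ ω, ENNReal.ofReal (Real.exp (K' * ‖X 0 ω‖)) ∂P := by
      simpa [hist, joint] using h2
    rw [h3, ofReal_integral_eq_lintegral_ofReal h1 (ae_of_all _ fun _ => (Real.exp_pos _).le)]
    refine lintegral_mono fun ω => ENNReal.ofReal_le_ofReal ?_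
    gcongr
    exact le_max_right _ _
  set Q := Real.exp ((B + k * A) / (1 - α)) * (m₁ + 1) with hQ
  have hQ0 : 0 ≤ Q := by positivity
  -- `m` dominates the moment of the constant iterate and satisfies `α m + F (1 + Q) ≤ m`, so it
  -- survives the induction.
  set m := Real.exp (k * |c|) + F * (1 + Q) / (1 - α) with hm
  have hm0 : 0 ≤ m := by positivity
  have hmrec : α * m + F * (1 + Q) ≤ m := by
    have h1 : F * (1 + Q) / (1 - α) ≤ m := by rw [hm]; linarith [Real.exp_pos (k * |c|)]
    rw [div_le_iff₀ h1α] at h1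
    linarith
  refine ⟨m, hm0, fun s => ?_⟩
  induction s using Nat.strong_induction_on with
  | _ s ih =>
    intro t
    cases s with
    | zero =>
      simp only [iter_zero, lintegral_const, measure_univ, mul_one]
      refine ENNReal.ofReal_le_ofReal ?_
      have : 0 ≤ F * (1 + Q) / (1 - α) := by positivity
      rw [hm]
      linarith
    | succ s =>
      obtain ⟨l, hl, hlΛ, hfl⟩ := hM.exists_param t (hM.measurable_iterSeq_past s t)
        (measurable_zeroTrunc (s + 1) (measurable_hist_X_past X ε le_rfl))
        (fun ω => approx_seq_mem hM s _) (ae_of_all _ fun ω => zeroTrunc_mem hM _ _)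
      have hlin : ∀ᵐ ω ∂P, l ω ≤ A
          + ∑ i ∈ Finset.range s, a i * |iter X ε ν g f c (s - i) (t - 1 - i) ω|
          + ∑ j ∈ Finset.range (s + 1), b j * ‖X (t - 1 - j) ω‖ := by
        filter_upwards [hfl] with ω h1
        rw [← h1]
        refine (hM.f_le (s := s) (m := s + 1) (fun i hi => ?_) (fun j hj => ?_)).trans
          (le_of_eq ?_)
        · rw [Nat.sub_eq_zero_of_le hi, iter_zero]
        · simp [zeroTrunc, not_lt.2 hj]
        · congr 1
          refine Finset.sum_congr rfl fun j hj => ?_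
          simp only [zeroTrunc, Finset.mem_range.1 hj, if_true, hist]
      have hexp : ∀ᵐ ω ∂P, Real.exp (k * l ω) ≤ ∑ i ∈ Finset.range s, a i * (Real.exp (-B)
            * Real.exp (k * |iter X ε ν g f c (s - i) (t - 1 - i) ω|))
          + Real.exp ((B + k * A) / (1 - α)) *
            (∑ j ∈ Finset.range (s + 1), b j / β * Real.exp (K' * ‖X (t - 1 - j) ω‖) + 1) := by
        filter_upwards [hlin] with ω h1
        refine exp_mul_le_of_le hM.a_nonneg hM.b_nonneg (fun _ => norm_nonneg _)
          (Nat.cast_nonneg k) hA0 hB0 hα1 (hM.summable_a.sum_le_tsum _ fun i _ => hM.a_nonneg i)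
          ?_ hβ0 h1
        have := hM.summable_b.sum_le_tsum (Finset.range (s + 1)) fun i _ => hM.b_nonneg i
        linarith
      have hexpint : ∫⁻ ω, ENNReal.ofReal (Real.exp (k * l ω)) ∂P
          ≤ ENNReal.ofReal (Real.exp (-B) * (α * m) + Q) := by
        have hY : ∀ i, ∫⁻ ω, ENNReal.ofReal (Real.exp (-B)
            * Real.exp (k * |iter X ε ν g f c (s - i) (t - 1 - i) ω|)) ∂P
            ≤ ENNReal.ofReal (Real.exp (-B) * m) := fun i => by
          simp only [ENNReal.ofReal_mul (Real.exp_pos (-B)).le]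
          rw [lintegral_const_mul _
            ((hM.measurable_iter _ _).abs.const_mul (k : ℝ)).exp.ennreal_ofReal]
          exact mul_le_mul_right (ih _ (by omega) _) _
        have hsum1 := lintegral_ofReal_sum_mul_le (P := P) (Finset.range s)
          (w := a) (fun i _ => hM.a_nonneg i) (fun i _ =>
            ((((hM.measurable_iter (s - i) (t - 1 - i)).abs.const_mul (k : ℝ)).exp).const_mul
              (Real.exp (-B)))) (fun i _ ω => by positivity) (fun i _ => hY i)
        have hsum2 := lintegral_ofReal_sum_mul_le (P := P) (Finset.range (s + 1))
          (w := fun j => b j / β) (fun j _ => div_nonneg (hM.b_nonneg j) hβ0.le) (fun j _ =>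
            ((hM.measurable_X (t - 1 - j)).norm.const_mul K').exp) (fun j _ ω => by positivity)
          (fun j _ => hXm (t - 1 - j))
        have ha' : ∑ i ∈ Finset.range s, a i ≤ α :=
          hM.summable_a.sum_le_tsum _ fun i _ => hM.a_nonneg i
        have hb' : ∑ j ∈ Finset.range (s + 1), b j / β ≤ 1 := by
          rw [← Finset.sum_div, div_le_one hβ0]
          have := hM.summable_b.sum_le_tsum (Finset.range (s + 1)) fun i _ => hM.b_nonneg i
          linarith
        have hS1 : Measurable fun ω => ENNReal.ofReal (∑ i ∈ Finset.range s, a i * (Real.exp (-B)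
            * Real.exp (k * |iter X ε ν g f c (s - i) (t - 1 - i) ω|))) :=
          (Finset.measurable_sum _ fun i _ =>
            ((((hM.measurable_iter (s - i) (t - 1 - i)).abs.const_mul (k : ℝ)).exp).const_mul
              (Real.exp (-B))).const_mul (a i)).ennreal_ofReal
        have hS2 : Measurable fun ω => ENNReal.ofReal (∑ j ∈ Finset.range (s + 1),
            b j / β * Real.exp (K' * ‖X (t - 1 - j) ω‖)) :=
          (Finset.measurable_sum _ fun (j : ℕ) _ =>
            (((hM.measurable_X (t - 1 - j)).norm.const_mul K').exp).const_mul
              (b j / β)).ennreal_ofReal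
        set q := Real.exp ((B + k * A) / (1 - α)) with hq
        have hq0 : 0 ≤ q := (Real.exp_pos _).le
        calc ∫⁻ ω, ENNReal.ofReal (Real.exp (k * l ω)) ∂P
            ≤ ∫⁻ ω, (ENNReal.ofReal (∑ i ∈ Finset.range s, a i * (Real.exp (-B)
                * Real.exp (k * |iter X ε ν g f c (s - i) (t - 1 - i) ω|)))
              + ENNReal.ofReal q * (ENNReal.ofReal (∑ j ∈ Finset.range (s + 1),
                b j / β * Real.exp (K' * ‖X (t - 1 - j) ω‖)) + 1)) ∂P := by
              refine lintegral_mono_ae ?_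
              filter_upwards [hexp] with ω h1
              have n1 : 0 ≤ ∑ i ∈ Finset.range s, a i * (Real.exp (-B)
                  * Real.exp (k * |iter X ε ν g f c (s - i) (t - 1 - i) ω|)) :=
                Finset.sum_nonneg fun i _ => mul_nonneg (hM.a_nonneg i) (by positivity)
              have n2 : 0 ≤ ∑ j ∈ Finset.range (s + 1),
                  b j / β * Real.exp (K' * ‖X (t - 1 - j) ω‖) :=
                Finset.sum_nonneg fun j _ =>
                  mul_nonneg (div_nonneg (hM.b_nonneg j) hβ0.le) (Real.exp_pos _).le
              rw [← ENNReal.ofReal_one, ← ENNReal.ofReal_add n2 zero_le_one,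
                ← ENNReal.ofReal_mul hq0, ← ENNReal.ofReal_add n1
                  (mul_nonneg hq0 (add_nonneg n2 zero_le_one))]
              exact ENNReal.ofReal_le_ofReal h1
          _ ≤ ENNReal.ofReal ((∑ i ∈ Finset.range s, a i) * (Real.exp (-B) * m))
              + ENNReal.ofReal q * (ENNReal.ofReal ((∑ j ∈ Finset.range (s + 1), b j / β) * m₁)
                + 1) := by
              rw [lintegral_add_left hS1, lintegral_const_mul _ (hS2.add_const 1),
                lintegral_add_left hS2, lintegral_const, measure_univ, mul_one]
              gcongr
          _ ≤ ENNReal.ofReal (α * (Real.exp (-B) * m)) + ENNReal.ofReal q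
                * (ENNReal.ofReal (1 * m₁) + 1) := by
              gcongr
          _ = _ := by
              rw [← ENNReal.ofReal_one, ← ENNReal.ofReal_add (by positivity) zero_le_one,
                ← ENNReal.ofReal_mul hq0, ← ENNReal.ofReal_add (by positivity) (by positivity)]
              congr 1
              rw [hQ]
              ring
      have hiter : ∀ᵐ ω ∂P, ENNReal.ofReal (Real.exp (k * |iter X ε ν g f c (s + 1) t ω|))
          = ENNReal.ofReal (Real.exp (k * |G (l ω, ε t ω)|)) := by
        filter_upwards [hfl] with ω h1
        rw [iter, approx_succ_hist, h1, hM.G_eq _ (hlΛ ω)]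
      rw [lintegral_congr_ae hiter, lintegral_comp_quantile hM.prob hM.measurable_G hM.G_eq
        (hM.measurable_ε t) (hM.map_ε t) (hM.past_le _) (hM.indep t) hl (ae_of_all _ hlΛ)
        (φ := fun y => ENNReal.ofReal (Real.exp (k * |y|)))
        ((measurable_id.abs.const_mul (k : ℝ)).exp.ennreal_ofReal)]
      calc ∫⁻ ω, ∫⁻ j, ENNReal.ofReal (Real.exp (k * |g j|)) ∂(ν (l ω)) ∂P
          ≤ ∫⁻ ω, ENNReal.ofReal F * (1 + ENNReal.ofReal (Real.exp (k * l ω))) ∂P := by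
            refine lintegral_mono fun ω => ?_
            dsimp only
            have h1 : ∀ j : ℕ, Real.exp (k * |g j|) = (1 + j : ℝ) ^ k := fun j => by
              rw [hg, abs_of_nonneg (Real.log_nonneg (by linarith [Nat.cast_nonneg (α := ℝ) j])),
                Real.exp_nat_mul, Real.exp_log (by positivity)]
            simp only [h1]
            rw [hν _ (hlΛ ω)]
            refine (lintegral_pow_poissonMeasure_le _ k).trans ?_
            rw [Real.coe_toNNReal _ (Real.exp_pos _).le, ← ENNReal.ofReal_one,
              ← ENNReal.ofReal_add zero_le_one (Real.exp_pos _).le,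
              ← ENNReal.ofReal_mul (by linarith)]
            refine ENNReal.ofReal_le_ofReal ?_
            rw [hF, mul_assoc _ ((2 : ℝ) ^ k), Real.exp_nat_mul]
            refine mul_le_mul_of_nonneg_left ?_ (by positivity)
            have h2 : (1 + Real.exp (l ω)) ^ k ≤ (2 * max 1 (Real.exp (l ω))) ^ k := by
              gcongr
              linarith [le_max_left 1 (Real.exp (l ω)), le_max_right 1 (Real.exp (l ω))]
            refine h2.trans ?_
            rw [mul_pow]
            gcongr
            rcases max_choice 1 (Real.exp (l ω)) with h3 | h3 <;> rw [h3]
            · simp [(Real.exp_pos _).le]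
            · linarith
        _ = ENNReal.ofReal F * (1 + ∫⁻ ω, ENNReal.ofReal (Real.exp (k * l ω)) ∂P) := by
            have hlm : Measurable l := hl.mono (hM.past_le _) le_rfl
            have hem : Measurable fun ω => ENNReal.ofReal (Real.exp (k * l ω)) :=
              (hlm.const_mul _).exp.ennreal_ofReal
            rw [lintegral_const_mul _ (hem.const_add 1), lintegral_add_left measurable_const]
            simp
        _ ≤ ENNReal.ofReal F * (1 + ENNReal.ofReal (Real.exp (-B) * (α * m) + Q)) := by gcongr
        _ = ENNReal.ofReal (F * (1 + (Real.exp (-B) * (α * m) + Q))) := by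
            rw [ENNReal.ofReal_mul (p := F) (by linarith), ENNReal.ofReal_add zero_le_one (by positivity),
              ENNReal.ofReal_one]
        _ ≤ ENNReal.ofReal m := by
            refine ENNReal.ofReal_le_ofReal (le_trans (le_of_eq ?_) hmrec)
            linear_combination (α * m) * hFB

end Moments

/-! ### Probability that an iterate differs from the limit -/

/-- A mean value estimate: the difference of the exponentials is at most `exp (max y y')` times `|y
- y'|`. -/
theorem exp_neg_max_le {y y' : ℝ} (h : 1 ≤ |Real.exp y - Real.exp y'|) :
    Real.exp (-max y y') ≤ |y - y'| := by
  wlog hyy : y' ≤ y generalizing y y'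
  · rw [max_comm, abs_sub_comm]
    exact this (by rwa [abs_sub_comm]) (not_le.1 hyy).le
  rw [max_eq_left hyy, abs_of_nonneg (by linarith)]
  rw [abs_of_nonneg (by linarith [Real.exp_le_exp.2 hyy])] at h
  have h1 := Real.add_one_le_exp (y' - y)
  have h2 : Real.exp y' = Real.exp y * Real.exp (y' - y) := by
    rw [← Real.exp_add]; congr 1; ring
  have h3 : 1 ≤ Real.exp y * (y - y') := by
    refine h.trans ?_
    rw [h2]
    have := mul_le_mul_of_nonneg_left h1 (Real.exp_pos y).le
    linarith
  rw [Real.exp_neg, inv_le_iff_one_le_mul₀ (Real.exp_pos y), mul_comm]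
  exact h3

/-- With `M = max y y'`, the powers `exp(-M)^(K/(K+1))` and `exp(K M)^(1/(K+1))` multiply to one.
The first base is at most `|y - y'|`, the second at most the sum of exponentials. -/
theorem one_le_rpow_mul_rpow {y y' K : ℝ} {k : ℕ} (hK : 1 ≤ K) (hk : K ≤ k) (hy : 0 ≤ y)
    (h : 1 ≤ |Real.exp y - Real.exp y'|) :
    1 ≤ |y - y'| ^ (K / (K + 1))
      * (Real.exp (k * |y|) + Real.exp (k * |y'|)) ^ (1 / (K + 1)) := by
  have hK1 : 0 < K + 1 := by linarith
  set M := max y y' with hM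
  have hM0 : 0 ≤ M := le_max_of_le_left hy
  have h1 : Real.exp (K * M) ≤ Real.exp (k * |y|) + Real.exp (k * |y'|) := by
    have h2 : Real.exp (K * M) ≤ Real.exp (k * M) :=
      Real.exp_le_exp.2 (mul_le_mul_of_nonneg_right hk hM0)
    have h3 : ∀ v : ℝ, Real.exp (k * v) ≤ Real.exp (k * |v|) := fun v =>
      Real.exp_le_exp.2 (mul_le_mul_of_nonneg_left (le_abs_self v) (Nat.cast_nonneg k))
    rcases max_choice y y' with h4 | h4
    · rw [hM, h4] at h2 ⊢
      linarith [h3 y, Real.exp_pos (k * |y'|)]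
    · rw [hM, h4] at h2 ⊢
      linarith [h3 y', Real.exp_pos (k * |y|)]
  calc (1 : ℝ) = Real.exp (-M) ^ (K / (K + 1)) * Real.exp (K * M) ^ (1 / (K + 1)) := by
        rw [← Real.exp_mul, ← Real.exp_mul, ← Real.exp_add]
        have : -M * (K / (K + 1)) + K * M * (1 / (K + 1)) = 0 := by field_simp; ring
        rw [this, Real.exp_zero]
    _ ≤ _ := by
        gcongr
        exact exp_neg_max_le h

theorem one_le_abs_sub_of_mem_range_natCast {x x' : ℝ} (hx : x ∈ Set.range ((↑) : ℕ → ℝ))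
    (hx' : x' ∈ Set.range ((↑) : ℕ → ℝ)) (h : x ≠ x') : 1 ≤ |x - x'| := by
  obtain ⟨k, rfl⟩ := hx
  obtain ⟨k', rfl⟩ := hx'
  have h1 : (k : ℤ) - k' ≠ 0 := by
    intro h2
    exact h (by exact_mod_cast sub_eq_zero.1 h2)
  have := Int.one_le_abs h1
  exact_mod_cast this

theorem measure_ne_le_lintegral {Ω : Type*} [MeasurableSpace Ω] {P : Measure Ω} {x y : Ω → ℝ}
    (hx : Measurable x) (hy : Measurable y) {φ : Ω → ℝ≥0∞}
    (h : ∀ᵐ ω ∂P, x ω ≠ y ω → 1 ≤ φ ω) : P {ω | x ω ≠ y ω} ≤ ∫⁻ ω, φ ω ∂P := by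
  have hne : {ω | x ω ≠ y ω} = {ω | x ω = y ω}ᶜ := rfl
  rw [hne, ← lintegral_indicator_one (measurableSet_eq_fun hx hy).compl]
  refine lintegral_mono_ae ?_
  filter_upwards [h] with ω h1
  by_cases h2 : x ω = y ω
  · simp [h2]
  · simpa [h2] using h1 h2

section Mixing

variable {Ω H : Type*} [MeasurableSpace Ω] [NormedAddCommGroup H] [MeasurableSpace H]
  {P : Measure Ω} {X : ℤ → Ω → H} {ε : ℤ → Ω → ℝ} {Λ : Set ℝ} {ν : ℝ → Measure ℕ}
  {g : ℕ → ℝ} {G : ℝ × ℝ → ℝ} {f : (ℕ → ℝ) → (ℕ → H) → ℝ} {c : ℝ} {C : Set (ℕ → ℝ)}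
  {D : Set (ℕ → H)} {a b : ℕ → ℝ}

/-- A bound on the coupling probabilities gives a bound on the mixing coefficients. -/
theorem Model.alphaMix_le_of_measure_le (hM : Model P X ε Λ ν g G f c C D a b)
    [IsProbabilityMeasure P] {q : ℕ → ℕ → ℝ}
    {L : ℝ} (hL : 0 ≤ L) (h : ∀ r t : ℕ, r < t →
      P {ω | sol X ε ν g f c t ω ≠ iter X ε ν g f c (t - r) t ω} ≤ ENNReal.ofReal (L * q t r))
    {r n : ℕ} (hrn : r < n) :
    ENNReal.ofReal (alphaMix P (fullProc X ε (sol X ε ν g f c)) n)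
      ≤ ENNReal.ofReal (alphaMix P (zeta X ε) (r + 1))
        + ENNReal.ofReal (2 * L) * ∑' t : {t : ℕ // n ≤ t}, ENNReal.ofReal (q t r) := by
  refine (hM.ofReal_alphaMix_le hrn).trans (add_le_add le_rfl ?_)
  rw [ENNReal.ofReal_mul zero_le_two, mul_assoc, ENNReal.ofReal_ofNat]
  refine mul_le_mul_right ?_ _
  rw [← ENNReal.tsum_mul_left]
  refine ENNReal.tsum_le_tsum fun t => ?_
  rw [← ENNReal.ofReal_mul hL]
  exact h r t (hrn.trans_le t.2)

variable [IsProbabilityMeasure P] [BorelSpace H] [SecondCountableTopology H]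

/-- The naturals are closed in `ℝ`, so the limit is again integer-valued and Markov's inequality
applies. The order is `s + 1` because the iterate of order `0` is `c`, which need not be an integer.
-/
theorem Model.measure_sol_ne_iter_le (hM : Model P X ε Λ ν g G f c C D a b)
    (hg : ∀ k : ℕ, g k = k) (s : ℕ) (t : ℤ) :
    P {ω | sol X ε ν g f c t ω ≠ iter X ε ν g f c (s + 1) t ω} ≤ iterErr P X ε ν g f c (s + 1) := by
  rw [← hM.iterErr_eq (s + 1) t]
  refine measure_ne_le_lintegral (hM.measurable_sol t) (hM.measurable_iter _ t) ?_
  filter_upwards [hM.ae_sol_mem Nat.isClosedEmbedding_coe_real.isClosed_range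
    (fun k => ⟨k, (hg k).symm⟩) t] with ω h1 h2
  rw [Real.enorm_eq_ofReal_abs, ENNReal.one_le_ofReal, abs_sub_comm]
  refine one_le_abs_sub_of_mem_range_natCast h1 ?_ h2
  rw [iter, approx_succ_hist]
  exact ⟨_, (hg _).symm⟩

theorem Model.exists_measure_sol_ne_iter_le (hM : Model P X ε Λ ν g G f c C D a b)
    (hg : ∀ k : ℕ, g k = Real.log (1 + k))
    (hν : ∀ l ∈ Λ, ν l = poissonMeasure (Real.toNNReal (Real.exp l)))
    (hX : ∀ K : ℝ, 1 ≤ K → Integrable (fun ω => Real.exp (K * ‖X 0 ω‖)) P) {K : ℝ}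
    (hK : 1 ≤ K) :
    ∃ m : ℝ, 0 ≤ m ∧ ∀ s t, P {ω | sol X ε ν g f c t ω ≠ iter X ε ν g f c (s + 1) t ω}
      ≤ ENNReal.ofReal m * iterErr P X ε ν g f c (s + 1) ^ (K / (K + 1)) := by
  obtain ⟨k, hk⟩ := exists_nat_ge K
  obtain ⟨m, hm0, hm⟩ := hM.exists_exp_moment_iter_le hg hν hX k
  have hK1 : 0 < K + 1 := by linarith
  have hsol : ∀ t, ∫⁻ ω, ENNReal.ofReal (Real.exp (k * |sol X ε ν g f c t ω|)) ∂P
      ≤ ENNReal.ofReal m := by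
    intro t
    -- The uniform moment bound passes to the limit by Fatou's lemma.
    have h1 : ∀ᵐ ω ∂P, ENNReal.ofReal (Real.exp (k * |sol X ε ν g f c t ω|))
        = liminf (fun s => ENNReal.ofReal (Real.exp (k * |iter X ε ν g f c s t ω|))) atTop := by
      filter_upwards [hM.ae_tendsto_iter t] with ω hω
      refine (Tendsto.liminf_eq ?_).symm
      have hc : Continuous fun v : ℝ => ENNReal.ofReal (Real.exp (k * |v|)) :=
        ENNReal.continuous_ofReal.comp (by fun_prop)
      exact (hc.tendsto _).comp hω
    rw [lintegral_congr_ae h1]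
    refine (lintegral_liminf_le fun s =>
      ((hM.measurable_iter s t).abs.const_mul (k : ℝ)).exp.ennreal_ofReal).trans ?_
    refine (liminf_le_liminf (Eventually.of_forall fun s => hm s t)).trans ?_
    simp
  -- `T` is closed and contains every `log (1 + k)`, hence also the values of the limit; distinct
  -- points of `T` have exponentials at least one apart.
  let T : Set ℝ := {y | Real.exp y ∈ Set.range ((↑) : ℕ → ℝ)} ∩ Set.Ici 0
  have hT : IsClosed T :=
    (Nat.isClosedEmbedding_coe_real.isClosed_range.preimage Real.continuous_exp).inter isClosed_Ici
  have hgT : ∀ k, g k ∈ T := fun k => by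
    have hk : (0 : ℝ) < 1 + k := by positivity
    refine ⟨⟨1 + k, ?_⟩, ?_⟩
    · rw [hg, Real.exp_log hk]
      push_cast
      ring
    · rw [hg]
      exact Real.log_nonneg (by linarith [Nat.cast_nonneg (α := ℝ) k])
  refine ⟨(2 * m) ^ (1 / (K + 1)), by positivity, fun s t => ?_⟩
  set Y := sol X ε ν g f c t with hY
  set Y' := iter X ε ν g f c (s + 1) t with hY'
  have hYm : Measurable Y := hM.measurable_sol t
  have hYm' : Measurable Y' := hM.measurable_iter (s + 1) t
  have hE : Measurable fun ω => ENNReal.ofReal (Real.exp (k * |Y ω|)) :=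
    (hYm.abs.const_mul (k : ℝ)).exp.ennreal_ofReal
  have hE' : Measurable fun ω => ENNReal.ofReal (Real.exp (k * |Y' ω|)) :=
    (hYm'.abs.const_mul (k : ℝ)).exp.ennreal_ofReal
  calc P {ω | Y ω ≠ Y' ω}
      ≤ ∫⁻ ω, ‖Y' ω - Y ω‖ₑ ^ (K / (K + 1)) * (ENNReal.ofReal (Real.exp (k * |Y ω|))
          + ENNReal.ofReal (Real.exp (k * |Y' ω|))) ^ (1 / (K + 1)) ∂P := by
        refine measure_ne_le_lintegral hYm hYm' ?_
        filter_upwards [hM.ae_sol_mem hT hgT t] with ω h1 h2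
        have h3 : Y' ω ∈ T := by
          rw [hY', iter, approx_succ_hist]
          exact hgT _
        have h4 : 1 ≤ |Real.exp (Y ω) - Real.exp (Y' ω)| :=
          one_le_abs_sub_of_mem_range_natCast h1.1 h3.1 fun h => h2 (Real.exp_injective h)
        have h5 := one_le_rpow_mul_rpow hK hk h1.2 h4
        rw [Real.enorm_eq_ofReal_abs, abs_sub_comm,
          ← ENNReal.ofReal_add (Real.exp_pos _).le (Real.exp_pos _).le,
          ENNReal.ofReal_rpow_of_nonneg (abs_nonneg _) (by positivity),
          ENNReal.ofReal_rpow_of_nonneg (by positivity) (by positivity),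
          ← ENNReal.ofReal_mul (by positivity), ENNReal.one_le_ofReal]
        exact h5
    _ ≤ (∫⁻ ω, ‖Y' ω - Y ω‖ₑ ∂P) ^ (K / (K + 1))
          * (∫⁻ ω, (ENNReal.ofReal (Real.exp (k * |Y ω|))
            + ENNReal.ofReal (Real.exp (k * |Y' ω|))) ∂P) ^ (1 / (K + 1)) :=
        -- Hölder's inequality with exponents `(K + 1) / K` and `K + 1`.
        ENNReal.lintegral_mul_norm_pow_le (measurable_enorm_sub hYm' hYm).aemeasurable
          (hE.add hE').aemeasurable (by positivity) (by positivity) (by field_simp)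
    _ ≤ iterErr P X ε ν g f c (s + 1) ^ (K / (K + 1))
          * ENNReal.ofReal (2 * m) ^ (1 / (K + 1)) := by
        rw [hM.iterErr_eq (s + 1) t, lintegral_add_left hE, two_mul, ENNReal.ofReal_add hm0 hm0]
        gcongr
        · exact hsol t
        · exact hm (s + 1) t
    _ = _ := by
        rw [ENNReal.ofReal_rpow_of_nonneg (by positivity) (by positivity), mul_comm]

theorem Model.exists_alphaMix_le (hM : Model P X ε Λ ν g G f c C D a b)
    (hg : ∀ k : ℕ, g k = k) :
    ∃ L : ℝ, 0 < L ∧ ∀ r n : ℕ, 1 < r → r < n →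
      ENNReal.ofReal (alphaMix P (fullProc X ε (sol X ε ν g f c)) n)
        ≤ ENNReal.ofReal (alphaMix P (zeta X ε) (r + 1))
          + ENNReal.ofReal L * ∑' t : {t : ℕ // n ≤ t}, ENNReal.ofReal (omega a b t r) := by
  obtain ⟨L, hL, h⟩ := hM.exists_iterErr_le
  refine ⟨2 * L, by positivity, fun r n _ hrn =>
    hM.alphaMix_le_of_measure_le hL.le (fun r t hrt => ?_) hrn⟩
  obtain ⟨s, hs⟩ := Nat.exists_eq_add_of_le' (Nat.sub_pos_of_lt hrt)
  refine le_trans ?_ (h r t hrt)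
  rw [hs]
  exact hM.measure_sol_ne_iter_le hg s t

theorem Model.exists_alphaMix_le_of_log (hM : Model P X ε Λ ν g G f c C D a b)
    (hg : ∀ k : ℕ, g k = Real.log (1 + k))
    (hν : ∀ l ∈ Λ, ν l = poissonMeasure (Real.toNNReal (Real.exp l)))
    (hX : ∀ K : ℝ, 1 ≤ K → Integrable (fun ω => Real.exp (K * ‖X 0 ω‖)) P) {K : ℝ}
    (hK : 1 ≤ K) :
    ∃ L : ℝ, 0 < L ∧ ∀ r n : ℕ, 1 < r → r < n →
      ENNReal.ofReal (alphaMix P (fullProc X ε (sol X ε ν g f c)) n)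
        ≤ ENNReal.ofReal (alphaMix P (zeta X ε) (r + 1))
          + ENNReal.ofReal L *
            ∑' t : {t : ℕ // n ≤ t}, ENNReal.ofReal (omega a b t r ^ (K / (K + 1))) := by
  obtain ⟨L, hL, h⟩ := hM.exists_iterErr_le
  obtain ⟨m, hm0, hm⟩ := hM.exists_measure_sol_ne_iter_le hg hν hX hK
  have hK1 : 0 < K + 1 := by linarith
  refine ⟨2 * ((m + 1) * L ^ (K / (K + 1))), by positivity, fun r n _ hrn =>
    hM.alphaMix_le_of_measure_le (by positivity)
      (q := fun t r => omega a b t r ^ (K / (K + 1))) (fun r t hrt => ?_) hrn⟩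
  obtain ⟨s, hs⟩ := Nat.exists_eq_add_of_le' (Nat.sub_pos_of_lt hrt)
  have h1 := h r t hrt
  have hω := omega_nonneg hM.a_nonneg hM.b_nonneg t r
  rw [hs] at h1 ⊢
  calc P {ω | sol X ε ν g f c t ω ≠ iter X ε ν g f c (s + 1) t ω}
      ≤ ENNReal.ofReal m * iterErr P X ε ν g f c (s + 1) ^ (K / (K + 1)) := hm s t
    _ ≤ ENNReal.ofReal (m + 1) * ENNReal.ofReal (L * omega a b t r) ^ (K / (K + 1)) := by
        gcongr
        linarith
    _ = _ := by
        rw [ENNReal.ofReal_rpow_of_nonneg (by positivity) (by positivity),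
          ← ENNReal.ofReal_mul (by positivity), Real.mul_rpow hL.le hω, mul_assoc]

end Mixing

/-! ### From the hypotheses of the theorem to the model. -/

theorem quantileLipschitz_of_integral {Ω : Type*} [MeasurableSpace Ω] {P : Measure Ω} {e : Ω → ℝ}
    (he : Measurable e) (hu : P.map e = unif) {Λ : Set ℝ} {ν : ℝ → Measure ℕ} {g : ℕ → ℝ}
    (hint : ∀ l ∈ Λ, Integrable (fun ω => g (quantile (ν l) (e ω))) P)
    (hlip : ∀ l ∈ Λ, ∀ l' ∈ Λ,
      ∫ ω, |g (quantile (ν l) (e ω)) - g (quantile (ν l') (e ω))| ∂P ≤ |l - l'|) :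
    QuantileLipschitz Λ ν g := by
  intro l hl l' hl'
  have hm : ∀ l, Measurable fun u => g (quantile (ν l) u) := fun l =>
    measurable_from_nat.comp (measurable_quantile _)
  rw [← hu, lintegral_map (measurable_enorm_sub (hm l) (hm l')) he]
  simp only [Real.enorm_eq_ofReal_abs]
  have hi : Integrable (fun ω => |g (quantile (ν l) (e ω)) - g (quantile (ν l') (e ω))|) P :=
    ((hint l hl).sub (hint l' hl')).abs
  rw [← ofReal_integral_eq_lintegral_ofReal hi (ae_of_all _ fun _ => abs_nonneg _)]
  exact ENNReal.ofReal_le_ofReal (hlip l hl l' hl')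

end Ingarch

end

theorem corollary2
    {Ω : Type*} [MeasurableSpace Ω] (P : Measure Ω) [IsProbabilityMeasure P]
    -- `H` is `ℝ^d` with an arbitrary norm
    {H : Type*} [NormedAddCommGroup H] [NormedSpace ℝ H] [FiniteDimensional ℝ H]
    [MeasurableSpace H] [BorelSpace H]
    (X : ℤ → Ω → H) (ε : ℤ → Ω → ℝ)
    (hX : ∀ t, Measurable (X t)) (hε : ∀ t, Measurable (ε t))
    -- the noise is uniform on `[0,1]`
    (hunif : ∀ t, P.map (ε t) = volume.restrict (Set.Icc (0 : ℝ) 1))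
    -- `(X, ε)` is stationary and ergodic
    (hB2 : Ingarch.IsStationaryErgodic P (Ingarch.joint X ε))
    -- sequential exogeneity
    (hB3 : ∀ t, Indep (MeasurableSpace.comap (ε t) inferInstance)
      (Ingarch.past (Ingarch.joint X ε) (t - 1)) P)
    (hX1 : Integrable (fun ω => ‖X 0 ω‖) P)
    -- parameter set and family of distributions on `ℕ`
    (Λ : Set ℝ) (ν : ℝ → Measure ℕ) (hν : ∀ l ∈ Λ, IsProbabilityMeasure (ν l))
    (g : ℕ → ℝ) (hg : Function.Injective g)
    -- the domain of the regression function
    (c : ℝ) (C : Set (ℕ → ℝ)) (D : Set (ℕ → H))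
    (hC : ∀ y : ℕ → ℝ, (∃ k, ∀ i, k ≤ i → y i = c) → y ∈ C)
    (hD : ∀ x : ℕ → H, (∃ k, ∀ i, k ≤ i → x i = 0) → x ∈ D)
    (hDm : MeasurableSet D)
    (hXD : ∀ᵐ ω ∂P, Ingarch.hist X 0 ω ∈ D)
    (f : (ℕ → ℝ) → (ℕ → H) → ℝ)
    (hfΛ : ∀ y ∈ C, ∀ x ∈ D, f y x ∈ Λ)
    (hfm : Measurable (fun q : C × D => f q.1 q.2))
    -- first condition
    (hgint : ∀ l ∈ Λ, Integrable (fun ω => g (Ingarch.quantile (ν l) (ε 1 ω))) P)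
    (hfint : Integrable (fun ω => f (fun _ => c) (Ingarch.hist X 0 ω)) P)
    (hlip : ∀ l ∈ Λ, ∀ l' ∈ Λ,
      ∫ ω, |g (Ingarch.quantile (ν l) (ε 1 ω)) - g (Ingarch.quantile (ν l') (ε 1 ω))| ∂P
        ≤ |l - l'|)
    -- second condition (`a i`, `b j` are the coefficients of lags `i + 1`, `j + 1`)
    (a b : ℕ → ℝ) (ha0 : ∀ i, 0 ≤ a i) (hb0 : ∀ j, 0 ≤ b j)
    (ha : Summable a) (hb : Summable b) (ha1 : ∑' i, a i < 1)
    (hf : ∀ y ∈ C, ∀ y' ∈ C, ∀ x ∈ D, ∀ x' ∈ D,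
      ENNReal.ofReal |f y x - f y' x'|
        ≤ ∑' i, ENNReal.ofReal (a i * |y i - y' i|)
          + ∑' j, ENNReal.ofReal (b j * ‖x j - x' j‖)) :
    ∃ Y : ℤ → Ω → ℝ,
      -- existence
      Ingarch.IsSolution P X ε ν g f c Y ∧
      -- uniqueness
      (∀ Y' : ℤ → Ω → ℝ, Ingarch.IsSolution P X ε ν g f c Y' → ∀ t, Y' t =ᵐ[P] Y t) ∧
      -- the equation holds literally wherever its right-hand side is defined
      (∀ t, (∀ᵐ ω ∂P, Ingarch.hist Y (t - 1) ω ∈ C) →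
        ∀ᵐ ω ∂P, Y t ω = g (Ingarch.quantile
          (ν (f (Ingarch.hist Y (t - 1) ω) (Ingarch.hist X (t - 1) ω))) (ε t ω))) ∧
      Ingarch.IsStationaryErgodic P (Ingarch.fullProc X ε Y) ∧
      -- the mixing bound for `g(y) = y`
      ((∀ k : ℕ, g k = k) →
        ∃ L : ℝ, 0 < L ∧ ∀ r n : ℕ, 1 < r → r < n →
          ENNReal.ofReal (Ingarch.alphaMix P (Ingarch.fullProc X ε Y) n)
            ≤ ENNReal.ofReal (Ingarch.alphaMix P (Ingarch.zeta X ε) (r + 1))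
              + ENNReal.ofReal L *
                ∑' t : {t : ℕ // n ≤ t}, ENNReal.ofReal (Ingarch.omega a b t r)) ∧
      -- the mixing bound for the log-INGARCH model
      ((∀ k : ℕ, g k = Real.log (1 + k)) →
        (∀ l ∈ Λ, ν l = poissonMeasure (Real.toNNReal (Real.exp l))) →
        (∀ K : ℝ, 1 ≤ K → Integrable (fun ω => Real.exp (K * ‖X 0 ω‖)) P) →
        ∀ K : ℝ, 1 ≤ K → ∃ L : ℝ, 0 < L ∧ ∀ r n : ℕ, 1 < r → r < n →
          ENNReal.ofReal (Ingarch.alphaMix P (Ingarch.fullProc X ε Y) n)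
            ≤ ENNReal.ofReal (Ingarch.alphaMix P (Ingarch.zeta X ε) (r + 1))
              + ENNReal.ofReal L *
                ∑' t : {t : ℕ // n ≤ t},
                  ENNReal.ofReal (Ingarch.omega a b t r ^ (K / (K + 1)))) := by
  -- A proper space is second countable, which makes differences of `H`-valued variables measurable.
  have := FiniteDimensional.proper_real H
  have hlip' : Ingarch.QuantileLipschitz Λ ν g :=
    Ingarch.quantileLipschitz_of_integral (hε 1) (hunif 1) hgint hlip
  obtain ⟨G, hG, hGg⟩ := Ingarch.exists_measurable_eq_quantile hν hg hlip'
  have hM : Ingarch.Model P X ε Λ ν g G f c C D a b :=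
    { measurable_X := hX
      measurable_ε := hε
      map_ε := hunif
      stationary := hB2
      indep := hB3
      integrable_X := by
        have h := hX1.2
        rw [hasFiniteIntegral_iff_enorm] at h
        simpa using h.ne
      prob := hν
      measurable_G := hG
      G_eq := hGg
      lip := hlip'
      mem_C := hC
      mem_D := hD
      measurableSet_D := hDm
      hist_mem_D := hXD
      f_mem := hfΛ
      measurable_f := hfm
      integrable_g := fun l hl => by
        have hm : Measurable fun u => ‖g (Ingarch.quantile (ν l) u)‖ₑ :=
          (measurable_from_nat.comp (Ingarch.measurable_quantile (ν l))).enorm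
        have h := (hgint l hl).2
        rw [hasFiniteIntegral_iff_enorm, ← lintegral_map hm (hε 1), hunif 1] at h
        exact h.ne
      a_nonneg := ha0
      b_nonneg := hb0
      summable_a := ha
      summable_b := hb
      tsum_a := ha1
      f_lip := fun y hy y' hy' x hx x' hx' => by
        refine (Real.enorm_eq_ofReal_abs _).le.trans ((hf y hy y' hy' x hx x' hx').trans
          (le_of_eq ?_))
        congr 1
        · exact tsum_congr fun i => by
            rw [ENNReal.ofReal_mul (ha0 i), Real.enorm_eq_ofReal_abs]
        · exact tsum_congr fun j => by
            rw [ENNReal.ofReal_mul (hb0 j), ofReal_norm] }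
  exact ⟨Ingarch.sol X ε ν g f c, hM.isSolution_sol, fun Y' hY' t => hM.eq_sol hY' t, hM.sol_eq,
    hM.stationary_fullProc, hM.exists_alphaMix_le,
    fun h1 h2 h3 K hK => hM.exists_alphaMix_le_of_log h1 h2 h3 hK⟩
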